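/- Let $m\ge 0$ and let $\omega(\mathbf p)=\sqrt{|\mathbf p|^2+m^2}$ and $d\Omega_m(\mathbf p)=d^3p/\omega(\mathbf p)$. Let $\mathcal H=\bigoplus_{N\ge0}\mathcal H_N$ be the Fock space of the free neutral scalar field $\phi$ of mass $m$ on $\mathbb R^4$, where $\mathcal H_N$ is the space of symmetric functions in $L^2((\mathbb R^3)^N,\prod d\Omega_m)$, with vacuum $\Phi_0=(1,0,0,\dots)$. For $z\in\mathbb C^4$ with $-\operatorname{Im} z$ in the open forward light cone let $$D_m^{(-)}(z)=\frac1{2(2\pi)^3}\int_{\mathbb R^3}\omega(\mathbf p)^{-1}e^{-i\omega(\mathbf p)z^0+i\mathbf p\cdot\mathbf z}\,d^3p ,$$ the two-point function $(\Phi_0,\phi(x)\phi(y)\Phi_0)=D_m^{(-)}(x-y)$. Let $\mathcal T(T(\mathbb R^{d}))$ be the space of entire functions on $\mathbb C^d$ that are rapidly decreasing in every tube $\mathbb R^d+iK$, $K$ compact; its continuous linear functionals are the tempered ultra-hyperfunctions. For $f\in\mathcal T(T(\mathbb R^4))$ let $:\!\phi^k\!:\!(f)$ be the smeared Wick powers of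 $\phi$, as operators in $\mathcal H$, and for $g\in\mathbb C$ put $$:\!e^{g\phi^2}\!:\!(f)\,\Phi=\sum_{k=0}^\infty \frac{g^k}{k!}\,:\!\phi^{2k}\!:\!(f)\,\Phi$$ whenever all terms are defined and the series converges in the norm of $\mathcal H$. Let $n\in\mathbb N$, $l\in\mathbb R$, $r_1,\dots,r_n\in\{1,-1\}$, and $\rho^{(j)}(x)=\,:\!e^{-r_j i l^2\phi(x)^2}\!:$. For $z=(z_1,\dots,z_n)\in\mathbb C^{4n}$ let $A(z)$ be the symmetric $n\times n$ matrix with entries $a_{jj}=1$ and $$a_{jk}=a_{kj}=2h_{r_j}h_{r_k}l^2D_m^{(-)}(z_j-z_k)\quad(j<k),\qquad h_{\pm1}=e^{\pm i\pi/4}.$$ Then, in the sense of tempered ultra-hyperfunctions, $$(\Phi_0,\rho^{(1)}(x_1)\cdots\rho^{(n)}(x_n)\Phi_0)=(\det A)^{-1/2}.$$ Precisely: (a) For all $f_1,\dots,f_n\in\mathcal T(T(\mathbb R^4))$ the vector $\rho^{(1)}(f_1)\cdots\rho^{(n)}(f_n)\Phi_0\in\mathcal H$ is well defined. (b) There is $L>0$,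 depending only on $n$ and $l$, such that for all $y_1,\dots,y_n\in\mathbb R$ with $y_k-y_j>L$ for $j<k$, with $\Gamma_j=\mathbb R^4+i(y_j,0,0,0)$: on $\prod_j\Gamma_j$ one has $|\det A(z)-1|<1$; with the principal branch of the square root, $$F\mapsto\int_{\prod_j\Gamma_j}(\det A(z))^{-1/2}F(z)\,dz$$ is an absolutely convergent integral for $F\in\mathcal T(T(\mathbb R^{4n}))$ and defines a tempered ultra-hyperfunction; and for all $f_1,\dots,f_n\in\mathcal T(T(\mathbb R^4))$ $$(\Phi_0,\rho^{(1)}(f_1)\cdots\rho^{(n)}(f_n)\Phi_0)=\int_{\prod_j\Gamma_j}(\det A(z))^{-1/2}\prod_{j=1}^n f_j(z_j)\,dz .$$ -/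

import Mathlib

open MeasureTheory Filter Topology

noncomputable section

namespace WickField

/-! ### Kinematics -/

/-- Three-momentum (or position) space `ℝ³` with its Euclidean norm. -/
abbrev R3 : Type := EuclideanSpace ℝ (Fin 3)

/-- The energy `ω(p) = √(|p|² + m²)`. -/
def energy (m : ℝ) (p : R3) : ℝ := Real.sqrt (‖p‖ ^ 2 + m ^ 2)

/-- The point `(ω(p), p)` of the mass hyperboloid `ξ² = m²`, `ξ⁰ ≥ 0`, with spatial part `p`. -/
def onShell (m : ℝ) (p : R3) : Fin 4 → ℝ := Fin.cons (energy m p) (fun i : Fin 3 => p i)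

/-- The Minkowski product `p⁰ z⁰ - p¹ z¹ - p² z² - p³ z³` of a real and a complex four-vector. -/
def minkowski (p : Fin 4 → ℝ) (z : Fin 4 → ℂ) : ℂ :=
  (p 0 : ℂ) * z 0 - ∑ i : Fin 3, (p i.succ : ℂ) * z i.succ

/-- The two-point function
`D_m^{(-)}(z) = [2 (2π)³]⁻¹ ∫ ω(p)⁻¹ exp(-i ω(p) z⁰ + i p · z) dp`
(absolutely convergent if `-Im z` lies in the open forward light cone). -/
def twoPoint (m : ℝ) (z : Fin 4 → ℂ) : ℂ :=
  (2 * (2 * (Real.pi : ℂ)) ^ 3)⁻¹ *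
    ∫ p : R3, ((energy m p)⁻¹ : ℂ) * Complex.exp (-Complex.I * minkowski (onShell m p) z)

/-! ### Test functions and tempered ultra-hyperfunctions -/

/-- `SeminormLE k C F`: the seminorm `sup (1 + |z|)^k |F(z)|` of `F` over the closed tube
`|Im z_a| ≤ k` is at most `C`. -/
def SeminormLE {ι : Type} [Fintype ι] (k : ℕ) (C : ℝ) (F : (ι → ℂ) → ℂ) : Prop :=
  ∀ z : ι → ℂ, (∀ a, |(z a).im| ≤ k) → (1 + ‖z‖) ^ k * ‖F z‖ ≤ C

/-- The space `𝒯(T(ℝ^ι))` of entire functions on `ℂ^ι` that are rapidly decreasing in every tube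
`ℝ^ι + iK`, `K` compact. -/
def testSpace (ι : Type) [Fintype ι] : Submodule ℂ ((ι → ℂ) → ℂ) where
  carrier := {F | Differentiable ℂ F ∧ ∀ k : ℕ, ∃ C : ℝ, SeminormLE k C F}
  add_mem' := by
    rintro F G ⟨hF, hF'⟩ ⟨hG, hG'⟩
    refine ⟨hF.add hG, fun k => ?_⟩
    obtain ⟨C, hC⟩ := hF' k
    obtain ⟨D, hD⟩ := hG' k
    refine ⟨C + D, fun z hz => ?_⟩
    have h1 := hC z hz
    have h2 := hD z hz
    have h3 : ‖(F + G) z‖ ≤ ‖F z‖ + ‖G z‖ := norm_add_le _ _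
    have h4 : (0 : ℝ) ≤ (1 + ‖z‖) ^ k := by positivity
    nlinarith [mul_le_mul_of_nonneg_left h3 h4]
  zero_mem' := by
    refine ⟨differentiable_const 0, fun k => ⟨0, fun z _ => ?_⟩⟩
    simp
  smul_mem' := by
    rintro c F ⟨hF, hF'⟩
    refine ⟨hF.const_smul c, fun k => ?_⟩
    obtain ⟨C, hC⟩ := hF' k
    refine ⟨‖c‖ * C, fun z hz => ?_⟩
    have h1 := mul_le_mul_of_nonneg_left (hC z hz) (norm_nonneg c)
    have h2 : ‖(c • F) z‖ = ‖c‖ * ‖F z‖ := by simp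
    rw [h2]
    linarith

/-- `W` restricts to a continuous linear functional on `testSpace ι`, i.e. to a tempered
ultra-hyperfunction (the seminorms above are increasing in `k` and define the topology). -/
def IsTemperedUltrahyperfunction {ι : Type} [Fintype ι] (W : ((ι → ℂ) → ℂ) → ℂ) : Prop :=
  IsLinearMap ℂ (fun F : testSpace ι => W F) ∧
    ∃ (k : ℕ) (C : ℝ), ∀ F ∈ testSpace ι, ∀ B : ℝ, SeminormLE k B F → ‖W F‖ ≤ C * B

/-- The Fourier transform `f̃(p) = (2π)⁻² ∫ f(x) exp(-i p·x) dx` over real Minkowski space. -/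
def fourier4 (f : (Fin 4 → ℂ) → ℂ) (p : Fin 4 → ℝ) : ℂ :=
  ((2 * (Real.pi : ℂ)) ^ 2)⁻¹ *
    ∫ x : Fin 4 → ℝ, f (fun μ => (x μ : ℂ)) *
      Complex.exp (-Complex.I * minkowski p (fun μ => (x μ : ℂ)))

/-! ### Fock space -/

/-- The Lorentz invariant measure `dΩ_m(ξ) = dξ¹ dξ² dξ³ / √(|ξ|² + m²)`, with the hyperboloid
parametrized by the spatial momentum. -/
def shellMeasure (m : ℝ) : Measure R3 :=
  volume.withDensity (fun p => ENNReal.ofReal (energy m p)⁻¹)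

instance (m : ℝ) : SigmaFinite (shellMeasure m) := by
  unfold shellMeasure
  infer_instance

/-- The product measure `∏ dΩ_m(ξ_k)` on `n` copies of the hyperboloid. -/
abbrev shellMeasures (m : ℝ) (n : ℕ) : Measure (Fin n → R3) :=
  Measure.pi (fun _ => shellMeasure m)

theorem measurePreserving_perm (m : ℝ) {n : ℕ} (σ : Equiv.Perm (Fin n)) :
    MeasurePreserving (fun ξ : Fin n → R3 => ξ ∘ σ) (shellMeasures m n) (shellMeasures m n) := by
  have h := measurePreserving_piCongrLeft (α := fun _ : Fin n => R3)
    (fun _ : Fin n => shellMeasure m) σ.symm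
  have e : (fun ξ : Fin n → R3 => ξ ∘ σ) =
      (MeasurableEquiv.piCongrLeft (fun _ : Fin n => R3) σ.symm) := by
    funext ξ i
    have := Equiv.piCongrLeft_apply_apply (P := fun _ : Fin n => R3) σ.symm ξ (σ i)
    rw [Equiv.symm_apply_apply] at this
    rw [MeasurableEquiv.coe_piCongrLeft, this]
    rfl
  rw [e]
  exact h

/-- The `n`-particle space `ℋ_n`: symmetric square-integrable functions of `n` momenta. -/
def particleSpace (m : ℝ) (n : ℕ) : Submodule ℂ (Lp ℂ 2 (shellMeasures m n)) where
  carrier := {g | ∀ σ : Equiv.Perm (Fin n),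
    (fun ξ : Fin n → R3 => g (ξ ∘ σ)) =ᵐ[shellMeasures m n] g}
  add_mem' := by
    intro g h hg hh σ
    have q := (measurePreserving_perm m σ).quasiMeasurePreserving.ae (Lp.coeFn_add g h)
    filter_upwards [hg σ, hh σ, q, Lp.coeFn_add g h] with ξ h1 h2 h3 h4
    rw [h3, h4, Pi.add_apply, Pi.add_apply, h1, h2]
  zero_mem' := by
    intro σ
    have z := Lp.coeFn_zero ℂ 2 (shellMeasures m n)
    have q := (measurePreserving_perm m σ).quasiMeasurePreserving.ae z
    filter_upwards [q, z] with ξ h1 h2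
    rw [h1, h2]
    rfl
  smul_mem' := by
    intro c g hg σ
    have q := (measurePreserving_perm m σ).quasiMeasurePreserving.ae (Lp.coeFn_smul c g)
    filter_upwards [hg σ, q, Lp.coeFn_smul c g] with ξ h1 h2 h3
    rw [h2, h3, Pi.smul_apply, Pi.smul_apply, h1]

/-- The Fock space `ℋ = ⊕ ℋ_n` (Hilbert space direct sum). -/
abbrev Fock (m : ℝ) : Type := lp (fun n : ℕ => particleSpace m n) 2

/-- The `n`-particle component `Φ⁽ⁿ⁾` of a Fock vector, as a function of `n` momenta. -/
def component {m : ℝ} (Φ : Fock m) (n : ℕ) : (Fin n → R3) → ℂ :=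
  ((Φ n : particleSpace m n) : Lp ℂ 2 (shellMeasures m n))

theorem memLp_one_zero (m : ℝ) :
    MemLp (fun _ : Fin 0 → R3 => (1 : ℂ)) 2 (shellMeasures m 0) := by
  have : IsFiniteMeasure (shellMeasures m 0) := by
    rw [shellMeasures, Measure.pi_of_empty]
    infer_instance
  exact memLp_const 1

/-- The vacuum `Φ₀ = (1, 0, 0, …)`. -/
def vacuum (m : ℝ) : Fock m :=
  lp.single 2 0 ⟨(memLp_one_zero m).toLp, by
    intro σ
    have : ∀ ξ : Fin 0 → R3, ξ ∘ σ = ξ := fun ξ => Subsingleton.elim _ _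
    simp only [this]
    exact Filter.EventuallyEq.rfl⟩

/-! ### Wick powers of the free field -/

/-- The integrand in the contribution to `(:φ^l:(f) Φ)⁽ⁿ⁾(ξ)` in which the particles with label in
`S` are created and `j = l - #S` particles, with momenta `η`, are annihilated. -/
def wickIntegrand (m : ℝ) (l : ℕ) (f : (Fin 4 → ℂ) → ℂ) (Φ : Fock m) {n : ℕ}
    (S : Finset (Fin n)) (ξ : Fin n → R3) (η : Fin (l - S.card) → R3) : ℂ :=
  fourier4 f (∑ r, onShell m (η r) - ∑ k ∈ S, onShell m (ξ k)) *
    component Φ ((l - S.card) + Sᶜ.card) (Fin.append η (fun i => ξ (Sᶜ.orderEmbOfFin rfl i)))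

/-- The right-hand side of the Wightman–Gårding formula for `(:φ^l:(f) Φ)⁽ⁿ⁾(ξ)`. With `j = l - #S`,
```
π^{l/2} / (2π)^{2(l-1)} ∑_S √((n - l + 2j)! / n!) (l! / j!)
  ∫ f̃(∑ η_r - ∑_{k ∈ S} ξ_k) Φ⁽ⁿ⁻ˡ⁺²ʲ⁾(η, ξ without S) ∏ dΩ_m(η_r),
```
the sum being over all `S ⊆ {1, …, n}` with at most `l` elements; the factor `l!` is the number of
(equal) terms of the sum over permutations of the `l` momenta. -/
def wickFormula (m : ℝ) (l : ℕ) (f : (Fin 4 → ℂ) → ℂ) (Φ : Fock m) (n : ℕ)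
    (ξ : Fin n → R3) : ℂ :=
  ((Real.sqrt Real.pi ^ l * (2 * Real.pi) ^ 2 / (2 * Real.pi) ^ (2 * l) : ℝ) : ℂ) *
    ∑ S : Finset (Fin n) with S.card ≤ l,
      ((Real.sqrt ((((l - S.card) + Sᶜ.card).factorial : ℝ) / (n.factorial : ℝ)) *
          ((l.factorial : ℝ) / ((l - S.card).factorial : ℝ)) : ℝ) : ℂ) *
        ∫ η, wickIntegrand m l f Φ S ξ η ∂(shellMeasures m (l - S.card))

/-- The graph of the operator `:φ^l:(f)` in Fock space: `Φ` is in its domain and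
`:φ^l:(f) Φ = Ψ`. -/
def IsWickPowerApply (m : ℝ) (l : ℕ) (f : (Fin 4 → ℂ) → ℂ) (Φ Ψ : Fock m) : Prop :=
  ∀ n : ℕ, ∀ᵐ ξ ∂(shellMeasures m n),
    (∀ S : Finset (Fin n), S.card ≤ l →
      Integrable (wickIntegrand m l f Φ S ξ) (shellMeasures m (l - S.card))) ∧
    component Ψ n ξ = wickFormula m l f Φ n ξ

/-- The graph of the operator `:exp(g φ²):(f) = ∑_k g^k :φ^{2k}:(f) / k!`, the series being
strongly convergent: `:exp(g φ²):(f) Φ = Ψ`. -/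
def IsWickExpSqApply (m : ℝ) (g : ℂ) (f : (Fin 4 → ℂ) → ℂ) (Φ Ψ : Fock m) : Prop :=
  ∃ χ : ℕ → Fock m, (∀ k, IsWickPowerApply m (2 * k) f Φ (χ k)) ∧
    Tendsto (fun N : ℕ => ∑ k ∈ Finset.range N, (g ^ k / (k.factorial : ℂ)) • χ k)
      atTop (𝓝 Ψ)

/-- `Ψ = ρ⁽¹⁾(f₁) ⋯ ρ⁽ⁿ⁾(f_n) Φ₀`, where `ρ⁽ʲ⁾ = :exp(g_j φ²):`; the operators are applied one
after the other, the last one first. -/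
def IsWickExpSqProduct (m : ℝ) {n : ℕ} (g : Fin n → ℂ) (f : Fin n → (Fin 4 → ℂ) → ℂ)
    (Ψ : Fock m) : Prop :=
  ∃ V : Fin (n + 1) → Fock m, V (Fin.last n) = vacuum m ∧ V 0 = Ψ ∧
    ∀ j : Fin n, IsWickExpSqApply m (g j) (f j) (V j.succ) (V j.castSucc)

/-! ### The determinant -/

/-- `h_r = exp(i r π / 4)` for `r = ±1`. -/
def phase (r : ℤ) : ℂ := Complex.exp (Complex.I * r * Real.pi / 4)

/-- The symmetric matrix `A` with `a_{jj} = 1` and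
`a_{jk} = a_{kj} = 2 h_{r_j} h_{r_k} l² D_m^{(-)}(z_j - z_k)` for `j < k`. -/
def vevMatrix (m l : ℝ) {n : ℕ} (r : Fin n → ℤ) (z : Fin n → Fin 4 → ℂ) :
    Matrix (Fin n) (Fin n) ℂ :=
  Matrix.of fun j k => if j = k then 1 else
    2 * phase (r j) * phase (r k) * (l : ℂ) ^ 2 * twoPoint m (z (min j k) - z (max j k))

/-- The point with components `x_j + i (y_j, 0, 0, 0)` of the contour `∏ Γ_j`,
`Γ_j = ℝ⁴ + i (y_j, 0, 0, 0)`. -/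
def contour {n : ℕ} (y : Fin n → ℝ) (x : Fin n → Fin 4 → ℝ) : Fin n → Fin 4 → ℂ :=
  fun j μ => (x j μ : ℂ) + if μ = 0 then (y j : ℂ) * Complex.I else 0

/-- The integrand `(det A(z))^{-1/2} F(z)` (principal branch) at a point of the contour. -/
def detIntegrand (m l : ℝ) {n : ℕ} (r : Fin n → ℤ) (y : Fin n → ℝ)
    (F : (Fin n × Fin 4 → ℂ) → ℂ) (x : Fin n → Fin 4 → ℝ) : ℂ :=
  (vevMatrix m l r (contour y x)).det ^ (-(1 / 2) : ℂ) * F (fun a => contour y x a.1 a.2)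

/-- The generalized function `(det A)^{-1/2}`:
`F ↦ ∫_{∏ Γ_j} (det A(z))^{-1/2} F(z) dz`. -/
def detFunctional (m l : ℝ) {n : ℕ} (r : Fin n → ℤ) (y : Fin n → ℝ)
    (F : (Fin n × Fin 4 → ℂ) → ℂ) : ℂ :=
  ∫ x : Fin n → Fin 4 → ℝ, detIntegrand m l r y F x

/-- The test function `f₁ ⊗ ⋯ ⊗ f_n`. -/
def tensorFun {n : ℕ} (f : Fin n → (Fin 4 → ℂ) → ℂ) : (Fin n × Fin 4 → ℂ) → ℂ :=
  fun w => ∏ j, f j (fun μ => w (j, μ))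

end WickField

end

noncomputable section

namespace WickField

/-! ### Kinematics on the mass shell -/

/-! The Gaussian identity `exp(c²φ²/2) = E[exp(c t φ)]`, with `t` standard normal, linearizes the
Wick exponentials: the odd moments of `t` vanish and the even ones, `(2k)!/(2^k k!)`, turn the term
of order `2k` of `:exp(c t φ):` into `(c²/2)^k :φ^{2k}: / k!`. Now `:exp(c t φ(z)):` maps a coherent
vector to a multiple of a coherent vector: the one-particle function gains a plane wave of amplitude
proportional to `c t`, and the factor is the exponential of the contraction of the new source with
the old ones. Hence a product of Wick exponentials applied to the vacuum is a superposition of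
coherent vectors over amplitudes `t_j` and positions `z_j`, with weight `∏ f_j(z_j) exp(∑_{j<k} c_j
c_k t_j t_k D(z_j - z_k))`; this is `component_of_isWickExpSqProduct`. For `c_j = i √2 l h_{r_j}`
the exponent is `(∑ t_j² - tᵀ A t) / 2`, and integrating out the amplitudes in the vacuum component
gives `(det A)^{-1/2}`.

Convergence comes from the contours. The test functions are entire, so each Fourier integral may be
taken at imaginary time `y_j` (`fourier4_eq_integral_timeShift`). Plane waves then decay like
`exp(-y_j ω)`, and a contraction across a separation of at least `L` is at most a constant times
`L⁻²`, uniformly in the mass (`norm_twoPoint_le`). For large `L` the interaction is a small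
quadratic form in the amplitudes, controlled by the Gaussian weight. This justifies Fubini in
`ae_wickFormula_eq_wickState`, the summation of the series in `hasSum_wickState`, and the norm
estimates behind `exists_isWickExpSqProduct`.

The Gaussian integral is evaluated in `integral_cexp_quadForm_eq_det`: its square follows by
induction with Schur complements, and the sign of the root by deforming `A` to the identity. -/

theorem energy_nonneg (m : ℝ) (p : R3) : 0 ≤ energy m p := Real.sqrt_nonneg _

theorem norm_le_energy (m : ℝ) (p : R3) : ‖p‖ ≤ energy m p :=
  Real.le_sqrt_of_sq_le (by nlinarith [sq_nonneg m])

theorem continuous_energy (m : ℝ) : Continuous (energy m) := by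
  unfold energy
  fun_prop

@[fun_prop]
theorem measurable_energy (m : ℝ) : Measurable (energy m) := (continuous_energy m).measurable

/-- The plane wave `exp(i p·z)` attached to the point of the mass shell over `p`. -/
def planeWave (m : ℝ) (p : R3) (z : Fin 4 → ℂ) : ℂ :=
  Complex.exp (Complex.I * minkowski (onShell m p) z)

/-- The point `x + i (y, 0, 0, 0)`. -/
def timeShift (y : ℝ) (x : Fin 4 → ℝ) : Fin 4 → ℂ :=
  fun μ => (x μ : ℂ) + if μ = 0 then (y : ℂ) * Complex.I else 0

theorem minkowski_sub_right (p : Fin 4 → ℝ) (z w : Fin 4 → ℂ) :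
    minkowski p (z - w) = minkowski p z - minkowski p w := by
  simp only [minkowski, Pi.sub_apply, mul_sub, Finset.sum_sub_distrib]
  ring

theorem minkowski_sub_left (p q : Fin 4 → ℝ) (z : Fin 4 → ℂ) :
    minkowski (p - q) z = minkowski p z - minkowski q z := by
  simp only [minkowski, Pi.sub_apply, Complex.ofReal_sub, sub_mul, Finset.sum_sub_distrib]
  ring

theorem minkowski_sum_left {ι : Type*} (s : Finset ι) (p : ι → Fin 4 → ℝ) (z : Fin 4 → ℂ) :
    minkowski (∑ i ∈ s, p i) z = ∑ i ∈ s, minkowski (p i) z := by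
  simp only [minkowski, Finset.sum_apply, Complex.ofReal_sum, Finset.sum_mul,
    Finset.sum_sub_distrib]
  rw [Finset.sum_comm]

theorem exp_neg_minkowski_sub {ι κ : Type*} (m : ℝ) (s : Finset ι) (t : Finset κ) (η : ι → R3)
    (ξ : κ → R3) (z : Fin 4 → ℂ) :
    Complex.exp (-Complex.I *
        minkowski (∑ r ∈ s, onShell m (η r) - ∑ k ∈ t, onShell m (ξ k)) z) =
      (∏ r ∈ s, (planeWave m (η r) z)⁻¹) * ∏ k ∈ t, planeWave m (ξ k) z := by
  simp only [planeWave, ← Complex.exp_neg, ← Complex.exp_sum, ← Complex.exp_add,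
    minkowski_sub_left, minkowski_sum_left]
  congr 1
  simp only [Finset.sum_neg_distrib, ← Finset.mul_sum]
  ring

theorem norm_planeWave_timeShift (m : ℝ) (p : R3) (y : ℝ) (x : Fin 4 → ℝ) :
    ‖planeWave m p (timeShift y x)‖ = Real.exp (-(y * energy m p)) := by
  rw [planeWave, Complex.norm_exp]
  congr 1
  simp [minkowski, timeShift, onShell, Fin.sum_univ_succ, Complex.mul_re, Complex.mul_im,
    Fin.succ_ne_zero]
  ring

@[fun_prop]
theorem measurable_planeWave {α : Type*} [MeasurableSpace α] {m : ℝ} {p : α → R3}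
    {z : α → Fin 4 → ℂ} (hp : Measurable p) (hz : Measurable z) :
    Measurable (fun a => planeWave m (p a) (z a)) := by
  unfold planeWave minkowski onShell
  simp only [Fin.cons_zero, Fin.cons_succ]
  fun_prop

@[fun_prop]
theorem measurable_timeShift_comp {α : Type*} [MeasurableSpace α] {y : ℝ} {x : α → Fin 4 → ℝ}
    (hx : Measurable x) : Measurable (fun a => timeShift y (x a)) := by
  unfold timeShift
  fun_prop

/-! ### Integrals over the mass shell -/

/-- The constant in the bound of `∫ exp(-L ω) dΩ_m` by a multiple of `L⁻²`. -/
def shellConst : ℝ := 3 * volume.real (Metric.ball (0 : R3) 1)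

theorem shellConst_nonneg : 0 ≤ shellConst := by
  unfold shellConst
  positivity

/-- In polar coordinates the singularity `‖p‖⁻¹` meets the density `r²`, leaving `r exp(-L r)`. -/
theorem integrable_norm_inv_mul_exp {L : ℝ} (hL : 0 < L) :
    Integrable (fun p : R3 => ‖p‖⁻¹ * Real.exp (-(L * ‖p‖))) := by
  refine (integrable_fun_norm_addHaar (volume : Measure R3)
    (f := fun r : ℝ => r⁻¹ * Real.exp (-(L * r)))).2 ?_
  have h := integrableOn_rpow_mul_exp_neg_mul_rpow (p := 1) (s := 1) (b := L) (by norm_num)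
    one_pos hL
  refine h.congr_fun (fun r hr => ?_) measurableSet_Ioi
  have : (0 : ℝ) < r := hr
  simp only [finrank_euclideanSpace, Fintype.card_fin, Real.rpow_one, smul_eq_mul]
  field_simp

theorem integral_norm_inv_mul_exp {L : ℝ} (hL : 0 < L) :
    ∫ p : R3, ‖p‖⁻¹ * Real.exp (-(L * ‖p‖)) = shellConst / L ^ 2 := by
  rw [integral_fun_norm_addHaar (volume : Measure R3) (fun r : ℝ => r⁻¹ * Real.exp (-(L * r)))]
  have h := Real.integral_rpow_mul_exp_neg_mul_Ioi (a := 2) (r := L) two_pos hL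
  have h2 : ∫ y in Set.Ioi (0 : ℝ), y ^ (Module.finrank ℝ R3 - 1) • (y⁻¹ * Real.exp (-(L * y)))
      = ∫ t in Set.Ioi (0 : ℝ), t ^ ((2 : ℝ) - 1) * Real.exp (-(L * t)) := by
    refine setIntegral_congr_fun measurableSet_Ioi (fun r hr => ?_)
    have : (0 : ℝ) < r := hr
    have e : (2 : ℝ) - 1 = 1 := by norm_num
    simp only [finrank_euclideanSpace, Fintype.card_fin, e, Real.rpow_one, smul_eq_mul]
    field_simp
  rw [h2, h]
  rw [Real.Gamma_two]
  simp only [finrank_euclideanSpace, Fintype.card_fin, nsmul_eq_mul, smul_eq_mul, shellConst,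
    one_div, inv_pow, mul_one, Real.rpow_two]
  push_cast
  ring

theorem integral_shellMeasure {E : Type*} [NormedAddCommGroup E] [NormedSpace ℝ E] (m : ℝ)
    (g : R3 → E) : ∫ p, g p ∂(shellMeasure m) = ∫ p, (energy m p)⁻¹ • g p := by
  unfold shellMeasure
  rw [integral_withDensity_eq_integral_toReal_smul]
  · simp [ENNReal.toReal_ofReal (inv_nonneg.2 (energy_nonneg m _))]
  · fun_prop
  · exact ae_of_all _ (fun p => ENNReal.ofReal_lt_top)

theorem integrable_shellMeasure_iff {E : Type*} [NormedAddCommGroup E] [NormedSpace ℝ E] (m : ℝ)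
    (g : R3 → E) : Integrable g (shellMeasure m) ↔ Integrable (fun p => (energy m p)⁻¹ • g p) := by
  unfold shellMeasure
  rw [integrable_withDensity_iff_integrable_smul' (by fun_prop)
    (ae_of_all _ (fun p => ENNReal.ofReal_lt_top))]
  simp [ENNReal.toReal_ofReal (inv_nonneg.2 (energy_nonneg m _))]

/-- The massless integrand dominates every other, since `‖p‖ ≤ ω(p)`. This keeps all later bounds
independent of the mass. -/
theorem inv_energy_mul_exp_le (m : ℝ) {L : ℝ} (hL : 0 < L) {p : R3} (hp : p ≠ 0) :
    (energy m p)⁻¹ * Real.exp (-(L * energy m p)) ≤ ‖p‖⁻¹ * Real.exp (-(L * ‖p‖)) := by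
  have h0 : 0 < ‖p‖ := norm_pos_iff.2 hp
  have h1 := norm_le_energy m p
  gcongr

theorem integrable_exp_neg_energy (m : ℝ) {L : ℝ} (hL : 0 < L) :
    Integrable (fun p => Real.exp (-(L * energy m p))) (shellMeasure m) := by
  rw [integrable_shellMeasure_iff]
  refine (integrable_norm_inv_mul_exp hL).mono' ?_ ?_
  · exact Measurable.aestronglyMeasurable (by fun_prop)
  · have : ∀ᵐ p : R3, p ≠ 0 := by simp [ae_iff, measure_singleton]
    filter_upwards [this] with p hp
    rw [smul_eq_mul, Real.norm_of_nonneg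
      (mul_nonneg (inv_nonneg.2 (energy_nonneg m p)) (Real.exp_pos _).le)]
    exact inv_energy_mul_exp_le m hL hp

theorem integral_exp_neg_energy_le (m : ℝ) {L : ℝ} (hL : 0 < L) :
    ∫ p, Real.exp (-(L * energy m p)) ∂(shellMeasure m) ≤ shellConst / L ^ 2 := by
  rw [← integral_norm_inv_mul_exp hL, integral_shellMeasure]
  refine integral_mono_ae ((integrable_shellMeasure_iff m _).1 (integrable_exp_neg_energy m hL))
    (integrable_norm_inv_mul_exp hL) ?_
  have : ∀ᵐ p : R3, p ≠ 0 := by simp [ae_iff, measure_singleton]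
  filter_upwards [this] with p hp
  exact inv_energy_mul_exp_le m hL hp

/-! ### The two-point function -/

/-- The normalization `√π / (2π)²` of the field. -/
def fieldConst : ℝ := Real.sqrt Real.pi / (2 * Real.pi) ^ 2

theorem fieldConst_pos : 0 < fieldConst := by
  unfold fieldConst
  positivity

theorem fieldConst_sq : fieldConst ^ 2 = (2 * (2 * Real.pi) ^ 3)⁻¹ := by
  unfold fieldConst
  rw [div_pow, Real.sq_sqrt Real.pi_pos.le]
  field_simp

/-- An annihilated wave at `z` is paired with a created wave at `w`. Both sides have the same
integrand up to constants, so no convergence is needed. -/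
theorem twoPoint_sub_eq (m : ℝ) (z w : Fin 4 → ℂ) :
    twoPoint m (z - w) = (fieldConst : ℂ) ^ 2 *
      ∫ p, (planeWave m p z)⁻¹ * planeWave m p w ∂(shellMeasure m) := by
  rw [integral_shellMeasure, twoPoint, ← Complex.ofReal_pow, fieldConst_sq]
  push_cast
  congr 2
  funext p
  rw [minkowski_sub_right, planeWave, planeWave, ← Complex.exp_neg, ← Complex.exp_add,
    Complex.real_smul]
  push_cast
  congr 2
  ring

theorem norm_inv_planeWave_mul (m : ℝ) (p : R3) (y y' : ℝ) (x x' : Fin 4 → ℝ) :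
    ‖(planeWave m p (timeShift y x))⁻¹ * planeWave m p (timeShift y' x')‖ =
      Real.exp (-((y' - y) * energy m p)) := by
  rw [norm_mul, norm_inv, norm_planeWave_timeShift, norm_planeWave_timeShift, ← Real.exp_neg,
    ← Real.exp_add]
  congr 1
  ring

theorem integrable_inv_planeWave_mul (m : ℝ) {y y' : ℝ} (h : y < y') (x x' : Fin 4 → ℝ) :
    Integrable (fun p => (planeWave m p (timeShift y x))⁻¹ * planeWave m p (timeShift y' x'))
      (shellMeasure m) := by
  refine (integrable_exp_neg_energy m (sub_pos.2 h)).mono'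
    (Measurable.aestronglyMeasurable (by fun_prop)) (ae_of_all _ fun p => ?_)
  rw [norm_inv_planeWave_mul]

/-- The imaginary time separation turns oscillation into the decay `exp(-(y' - y) ω)`. All smallness
for large `L` originates here. -/
theorem norm_twoPoint_le (m : ℝ) {L y y' : ℝ} (hL : 0 < L) (h : L ≤ y' - y) (x x' : Fin 4 → ℝ) :
    ‖twoPoint m (timeShift y x - timeShift y' x')‖ ≤ fieldConst ^ 2 * (shellConst / L ^ 2) := by
  rw [twoPoint_sub_eq, norm_mul, norm_pow, Complex.norm_real,
    Real.norm_of_nonneg fieldConst_pos.le]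
  gcongr
  refine (norm_integral_le_integral_norm _).trans ((integral_mono_of_nonneg
    (ae_of_all _ fun p => norm_nonneg _) (integrable_exp_neg_energy m hL)
    (ae_of_all _ fun p => ?_)).trans (integral_exp_neg_energy_le m hL))
  simp only [norm_inv_planeWave_mul]
  have := energy_nonneg m p
  gcongr

theorem measurable_twoPoint (m : ℝ) : Measurable (twoPoint m) := by
  unfold twoPoint
  refine Measurable.const_mul ?_ _
  have h : Measurable (fun q : (Fin 4 → ℂ) × R3 => ((energy m q.2)⁻¹ : ℂ) *
      Complex.exp (-Complex.I * minkowski (onShell m q.2) q.1)) := by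
    unfold minkowski onShell
    simp only [Fin.cons_zero, Fin.cons_succ]
    fun_prop
  exact h.stronglyMeasurable.integral_prod_right.measurable

@[fun_prop]
theorem measurable_twoPoint_comp {α : Type*} [MeasurableSpace α] {m : ℝ} {z : α → Fin 4 → ℂ}
    (hz : Measurable z) : Measurable (fun a => twoPoint m (z a)) :=
  (measurable_twoPoint m).comp hz

/-! ### The polynomials of a Wick power acting on a coherent vector -/

/-- The part of degree `l` (in `X` and `a`) of `exp X * ∏ k, (a k + b k)`. -/
def wickPoly {𝕜 : Type*} [Field 𝕜] {N : ℕ} (l : ℕ) (X : 𝕜) (a b : Fin N → 𝕜) : 𝕜 :=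
  ∑ S : Finset (Fin N) with S.card ≤ l,
    X ^ (l - S.card) / ((l - S.card).factorial : 𝕜) * ((∏ k ∈ S, a k) * ∏ k ∈ Sᶜ, b k)

theorem hasSum_pow_sub_div_factorial {𝕜 : Type*} [RCLike 𝕜] (X : 𝕜) (s : ℕ) :
    HasSum (fun l : ℕ => if s ≤ l then X ^ (l - s) / ((l - s).factorial : 𝕜) else 0)
      (NormedSpace.exp X) := by
  have h := NormedSpace.expSeries_div_hasSum_exp X
  have hinj : Function.Injective (fun j : ℕ => j + s) := fun i j hij => by simpa using hij
  rw [← hinj.hasSum_iff]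
  · convert h using 2 with j
    simp
  · intro l hl
    rw [if_neg]
    intro hsl
    exact hl ⟨l - s, by simp [hsl]⟩

/-- Expand the product by the set `S` of factors `a` (created particles) against factors `b`
(spectators), and multiply by the exponential series of `X` (annihilated particles). -/
theorem hasSum_wickPoly {𝕜 : Type*} [RCLike 𝕜] {N : ℕ} (X : 𝕜) (a b : Fin N → 𝕜) :
    HasSum (fun l => wickPoly l X a b) (NormedSpace.exp X * ∏ k, (a k + b k)) := by
  have h : ∀ S ∈ (Finset.univ : Finset (Finset (Fin N))),
      HasSum (fun l : ℕ => (if S.card ≤ l then X ^ (l - S.card) / ((l - S.card).factorial : 𝕜)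
        else 0) * ((∏ k ∈ S, a k) * ∏ k ∈ Sᶜ, b k))
        (NormedSpace.exp X * ((∏ k ∈ S, a k) * ∏ k ∈ Sᶜ, b k)) := fun S _ =>
    (hasSum_pow_sub_div_factorial X S.card).mul_right _
  have h2 := hasSum_sum h
  rw [← Finset.mul_sum] at h2
  convert h2 using 1
  · funext l
    rw [wickPoly, Finset.sum_filter]
    refine Finset.sum_congr rfl fun S _ => ?_
    split_ifs <;> simp
  · rw [Finset.prod_add]
    simp [Finset.compl_eq_univ_sdiff]

/-- Every term contains `l` factors from `X` and `a` together. This extracts the amplitude of a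
source, so that only a Gaussian moment remains. -/
theorem wickPoly_mul {𝕜 : Type*} [Field 𝕜] {N : ℕ} (l : ℕ) (s X : 𝕜) (a b : Fin N → 𝕜) :
    wickPoly l (s * X) (fun k => s * a k) b = s ^ l * wickPoly l X a b := by
  unfold wickPoly
  rw [Finset.mul_sum]
  refine Finset.sum_congr rfl fun S hS => ?_
  have hS' : S.card ≤ l := (Finset.mem_filter.1 hS).2
  rw [Finset.prod_mul_distrib, Finset.prod_const, mul_pow]
  nth_rewrite 4 [← Nat.sub_add_cancel hS']
  rw [pow_add]
  ring

/-- Every index contributes exactly one factor `a k` or `b k`. This extracts the common decay in the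
momenta. -/
theorem wickPoly_prod_mul {𝕜 : Type*} [Field 𝕜] {N : ℕ} (l : ℕ) (X : 𝕜) (d a b : Fin N → 𝕜) :
    wickPoly l X (fun k => d k * a k) (fun k => d k * b k) = (∏ k, d k) * wickPoly l X a b := by
  unfold wickPoly
  rw [Finset.mul_sum]
  refine Finset.sum_congr rfl fun S _ => ?_
  rw [Finset.prod_mul_distrib, Finset.prod_mul_distrib, ← Finset.prod_mul_prod_compl S d]
  ring

theorem wickPoly_nonneg {N : ℕ} (l : ℕ) {X : ℝ} {a b : Fin N → ℝ} (hX : 0 ≤ X)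
    (ha : ∀ k, 0 ≤ a k) (hb : ∀ k, 0 ≤ b k) : 0 ≤ wickPoly l X a b :=
  Finset.sum_nonneg fun S _ => mul_nonneg (by positivity)
    (mul_nonneg (Finset.prod_nonneg fun k _ => ha k) (Finset.prod_nonneg fun k _ => hb k))

theorem norm_wickPoly_le {N : ℕ} (l : ℕ) {X : ℂ} {a b : Fin N → ℂ} {X' : ℝ} {a' b' : Fin N → ℝ}
    (hX : ‖X‖ ≤ X') (ha : ∀ k, ‖a k‖ ≤ a' k) (hb : ∀ k, ‖b k‖ ≤ b' k) :
    ‖wickPoly l X a b‖ ≤ wickPoly l X' a' b' := by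
  refine (norm_sum_le _ _).trans (Finset.sum_le_sum fun S _ => ?_)
  rw [norm_mul, norm_div, norm_pow, norm_mul, norm_prod, norm_prod, Complex.norm_natCast]
  have ha0 : ∀ k, 0 ≤ a' k := fun k => (norm_nonneg _).trans (ha k)
  have h1 : ∏ k ∈ S, ‖a k‖ ≤ ∏ k ∈ S, a' k :=
    Finset.prod_le_prod (fun k _ => norm_nonneg _) fun k _ => ha k
  have h2 : ∏ k ∈ Sᶜ, ‖b k‖ ≤ ∏ k ∈ Sᶜ, b' k :=
    Finset.prod_le_prod (fun k _ => norm_nonneg _) fun k _ => hb k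
  have h3 : 0 ≤ ∏ k ∈ S, a' k := Finset.prod_nonneg fun k _ => ha0 k
  have h4 : 0 ≤ ∏ k ∈ Sᶜ, ‖b k‖ := Finset.prod_nonneg fun k _ => norm_nonneg _
  have h5 : 0 ≤ X' := (norm_nonneg _).trans hX
  gcongr

theorem wickPoly_comp_perm {𝕜 : Type*} [Field 𝕜] {N : ℕ} (l : ℕ) (X : 𝕜) (a b : Fin N → 𝕜)
    (σ : Equiv.Perm (Fin N)) :
    wickPoly l X (fun k => a (σ k)) (fun k => b (σ k)) = wickPoly l X a b := by
  unfold wickPoly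
  simp only [Finset.sum_filter]
  refine Fintype.sum_equiv σ.finsetCongr _ _ fun S => ?_
  have e : (S.map σ.toEmbedding)ᶜ = Sᶜ.map σ.toEmbedding := by
    ext x
    simp
  simp only [Equiv.finsetCongr_apply, Finset.card_map, e, Finset.prod_map,
    Equiv.coe_toEmbedding]

/-! ### One-dimensional Gaussian integrals -/

/-- The standard Gaussian measure on the line. -/
abbrev stdGauss : Measure ℝ := ProbabilityTheory.gaussianReal 0 1

theorem integral_stdGauss {E : Type*} [NormedAddCommGroup E] [NormedSpace ℝ E] (g : ℝ → E) :
    ∫ t, g t ∂stdGauss = ∫ t : ℝ, ((Real.sqrt (2 * Real.pi))⁻¹ * Real.exp (-t ^ 2 / 2)) • g t := by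
  rw [ProbabilityTheory.integral_gaussianReal_eq_integral_smul one_ne_zero]
  simp [ProbabilityTheory.gaussianPDFReal]

theorem integrable_stdGauss_iff {E : Type*} [NormedAddCommGroup E] [NormedSpace ℝ E] (g : ℝ → E) :
    Integrable g stdGauss ↔ Integrable (fun t : ℝ => Real.exp (-t ^ 2 / 2) • g t) := by
  rw [stdGauss, ProbabilityTheory.gaussianReal_of_var_ne_zero _ one_ne_zero,
    integrable_withDensity_iff_integrable_smul' (by fun_prop)
    (ae_of_all _ (fun p => by simp [ProbabilityTheory.gaussianPDF]))]
  have h : (Real.sqrt (2 * Real.pi))⁻¹ ≠ 0 := by positivity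
  rw [← integrable_smul_iff h (fun t : ℝ => Real.exp (-t ^ 2 / 2) • g t)]
  simp only [ProbabilityTheory.toReal_gaussianPDF]
  refine iff_of_eq (congrArg (fun u => Integrable u volume) ?_)
  funext t
  simp [ProbabilityTheory.gaussianPDFReal, smul_smul]

theorem integrable_exp_mul_sq_stdGauss {θ : ℝ} (hθ : θ < 1 / 2) :
    Integrable (fun t : ℝ => Real.exp (θ * t ^ 2)) stdGauss := by
  rw [integrable_stdGauss_iff]
  have h := integrable_exp_neg_mul_sq (b := 1 / 2 - θ) (by linarith)
  convert h using 2 with t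
  rw [smul_eq_mul, ← Real.exp_add]
  congr 1
  ring

theorem integral_pow_odd_stdGauss (k : ℕ) : ∫ t : ℝ, (t : ℂ) ^ (2 * k + 1) ∂stdGauss = 0 := by
  rw [integral_stdGauss]
  have h := integral_neg_eq_self (fun t : ℝ => ((Real.sqrt (2 * Real.pi))⁻¹ *
    Real.exp (-t ^ 2 / 2)) • (t : ℂ) ^ (2 * k + 1)) volume
  have h2 : ∀ t : ℝ, ((Real.sqrt (2 * Real.pi))⁻¹ * Real.exp (-(-t) ^ 2 / 2)) •
      ((-t : ℝ) : ℂ) ^ (2 * k + 1) = -(((Real.sqrt (2 * Real.pi))⁻¹ * Real.exp (-t ^ 2 / 2)) •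
      (t : ℂ) ^ (2 * k + 1)) := fun t => by
    rw [Complex.ofReal_neg, Odd.neg_pow ⟨k, rfl⟩, neg_sq, smul_neg]
  simp only [h2] at h
  rw [integral_neg] at h
  have h3 : ∀ x : ℂ, -x = x → x = 0 := fun x hx => by
    linear_combination -(1 / 2 : ℂ) * hx
  exact h3 _ h

theorem integral_pow_even_stdGauss (k : ℕ) :
    ∫ t : ℝ, (t : ℂ) ^ (2 * k) ∂stdGauss =
      ((2 * k).factorial : ℂ) / (2 ^ k * (k.factorial : ℂ)) := by
  have hR : ∫ t : ℝ, t ^ (2 * k) ∂stdGauss =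
      ((2 * k).factorial : ℝ) / (2 ^ k * (k.factorial : ℝ)) := by
    rw [integral_stdGauss]
    have e : ∀ t : ℝ, ((Real.sqrt (2 * Real.pi))⁻¹ * Real.exp (-t ^ 2 / 2)) • t ^ (2 * k) =
        (fun r : ℝ => (Real.sqrt (2 * Real.pi))⁻¹ *
          (r ^ (2 * k) * Real.exp (-(1 / 2) * r ^ 2))) |t| := fun t => by
      simp only [smul_eq_mul, pow_mul, sq_abs]
      rw [show -t ^ 2 / 2 = -(1 / 2) * t ^ 2 by ring]
      ring
    simp only [e]
    rw [integral_comp_abs (f := fun r : ℝ => (Real.sqrt (2 * Real.pi))⁻¹ *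
          (r ^ (2 * k) * Real.exp (-(1 / 2) * r ^ 2))), integral_const_mul]
    have h := integral_rpow_mul_exp_neg_mul_rpow (p := 2) (q := ((2 * k : ℕ) : ℝ)) (b := 1 / 2)
      two_pos (by linarith [(Nat.cast_nonneg (2 * k) : (0 : ℝ) ≤ ((2 * k : ℕ) : ℝ))])
      (by norm_num)
    simp only [Real.rpow_natCast, Real.rpow_two] at h
    have hG : ((2 * k : ℕ) + 1 : ℝ) / 2 = k + 1 / 2 := by
      push_cast
      ring
    -- This is `(2k)! = (2k)!! (2k-1)!!`; for `k = 0` truncated subtraction makes the last factor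
    -- `0!! = 1`.
    have hd : ((2 * k).factorial : ℝ) = (2 ^ k * (k.factorial : ℝ)) *
        ((2 * k - 1 : ℕ).doubleFactorial : ℝ) := by
      rw_mod_cast [← Nat.doubleFactorial_two_mul]
      cases k with
      | zero => simp
      | succ k => exact Nat.factorial_eq_mul_doubleFactorial (2 * k + 1)
    have hp : ((1 : ℝ) / 2) ^ (-((2 * k : ℕ) + 1 : ℝ) / 2) = 2 ^ k * Real.sqrt 2 := by
      rw [neg_div, hG, one_div, Real.inv_rpow two_pos.le, Real.rpow_neg two_pos.le, inv_inv,
        Real.rpow_add two_pos, Real.rpow_natCast, Real.sqrt_eq_rpow, one_div]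
    rw [h, hG, Real.Gamma_nat_add_half, hp, hd, Real.sqrt_mul two_pos.le]
    have h2 : Real.sqrt 2 ≠ 0 := by positivity
    have h3 : Real.sqrt Real.pi ≠ 0 := by positivity
    field_simp
  have := congrArg (fun x : ℝ => (x : ℂ)) hR
  simp only [← integral_complex_ofReal] at this
  push_cast at this
  exact this

/-! ### Gaussian integrals in several variables -/

theorem piFinSuccAbove_symm_apply_zero {α : Type*} [MeasurableSpace α] {n : ℕ}
    (p : α × (Fin n → α)) :
    (MeasurableEquiv.piFinSuccAbove (fun _ : Fin (n + 1) => α) 0).symm p = Fin.cons p.1 p.2 := by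
  change Fin.insertNth (α := fun _ => α) 0 p.1 p.2 = _
  exact Fin.insertNth_zero' _ _

theorem integral_pi_fin_succ {α E : Type*} [MeasurableSpace α] [NormedAddCommGroup E]
    [NormedSpace ℝ E] (μ : Measure α) [SigmaFinite μ] (n : ℕ) (F : (Fin (n + 1) → α) → E) :
    ∫ w, F w ∂(Measure.pi fun _ : Fin (n + 1) => μ) =
      ∫ p : α × (Fin n → α), F (Fin.cons p.1 p.2) ∂(μ.prod (Measure.pi fun _ : Fin n => μ)) := by
  have h := (measurePreserving_piFinSuccAbove (fun _ : Fin (n + 1) => μ) 0).symm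
  rw [← h.integral_comp']
  simp only [piFinSuccAbove_symm_apply_zero]

theorem integrable_pi_fin_succ_iff {α E : Type*} [MeasurableSpace α] [NormedAddCommGroup E]
    (μ : Measure α) [SigmaFinite μ] (n : ℕ) (F : (Fin (n + 1) → α) → E) :
    Integrable F (Measure.pi fun _ : Fin (n + 1) => μ) ↔
      Integrable (fun p : α × (Fin n → α) => F (Fin.cons p.1 p.2))
        (μ.prod (Measure.pi fun _ : Fin n => μ)) := by
  have h := (measurePreserving_piFinSuccAbove (fun _ : Fin (n + 1) => μ) 0).symm
  rw [← h.integrable_comp_emb (MeasurableEquiv.measurableEmbedding _)]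
  simp only [Function.comp_def, piFinSuccAbove_symm_apply_zero]

/-- Only `K² a = 1` is recorded: a product of principal roots need not be the principal root of the
product, so the branch is settled later. What matters is that `K` does not depend on `b`. -/
theorem exists_integral_cexp_stdGauss {a : ℂ} (ha : 0 < a.re) :
    ∃ K : ℂ, K ^ 2 * a = 1 ∧ ∀ b : ℂ,
      ∫ t : ℝ, Complex.exp ((1 - a) / 2 * (t : ℂ) ^ 2 + b * t) ∂stdGauss =
        K * Complex.exp (b ^ 2 / (2 * a)) := by
  have ha0 : a ≠ 0 := fun h => by simp [h] at ha
  refine ⟨((Real.sqrt (2 * Real.pi))⁻¹ : ℝ) * (Real.pi / -(-a / 2)) ^ (1 / 2 : ℂ), ?_,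
    fun b => ?_⟩
  · rw [mul_pow, ← Complex.cpow_nat_mul]
    rw [← Complex.ofReal_pow, inv_pow, Real.sq_sqrt (by positivity)]
    have : (Real.pi : ℂ) ≠ 0 := by exact_mod_cast Real.pi_ne_zero
    norm_num
    field_simp
  · have h := integral_cexp_quadratic (b := -a / 2) (by
      rw [neg_div, Complex.neg_re, Complex.div_ofNat_re]
      linarith) b 0
    rw [integral_stdGauss]
    have e : ∀ t : ℝ, ((Real.sqrt (2 * Real.pi))⁻¹ * Real.exp (-t ^ 2 / 2)) •
        Complex.exp ((1 - a) / 2 * (t : ℂ) ^ 2 + b * t) = ((Real.sqrt (2 * Real.pi))⁻¹ : ℝ) *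
        Complex.exp (-a / 2 * (t : ℂ) ^ 2 + b * t + 0) := fun t => by
      rw [Complex.real_smul, Complex.ofReal_mul, Complex.ofReal_exp, mul_assoc, ← Complex.exp_add]
      congr 2
      push_cast
      ring
    simp only [e]
    rw [integral_const_mul, h, mul_assoc]
    congr 3
    field_simp
    ring

/-- Row operations with row `0` clear the first column below the pivot. -/
theorem det_eq_mul_det_schur {n : ℕ} (A : Matrix (Fin (n + 1)) (Fin (n + 1)) ℂ)
    (ha : A 0 0 ≠ 0) :
    A.det = A 0 0 * (Matrix.of fun i j : Fin n =>
      A i.succ j.succ - A i.succ 0 * A 0 j.succ / A 0 0).det := by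
  let c : Fin (n + 1) → ℂ := Fin.cons 0 fun i => A i.succ 0 / A 0 0
  let B : Matrix (Fin (n + 1)) (Fin (n + 1)) ℂ := Matrix.of fun i j => A i j - c i * A 0 j
  have hB0 : ∀ j, B 0 j = A 0 j := fun j => by simp [B, c]
  rw [Matrix.det_eq_of_forall_row_eq_smul_add_const (B := B) c 0 (by simp [c])
    (fun i j => by rw [hB0]; simp [B]), Matrix.det_succ_column_zero, Fin.sum_univ_succ,
    Finset.sum_eq_zero]
  · simp only [Fin.val_zero, pow_zero, one_mul, hB0, add_zero]
    congr 2
    ext i j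
    simp only [Matrix.submatrix_apply, Fin.zero_succAbove, Matrix.of_apply, B, c, Fin.cons_succ]
    ring
  · intro i _
    have : B i.succ 0 = 0 := by
      simp only [Matrix.of_apply, B, c, Fin.cons_succ]
      field_simp
      ring
    rw [this]
    simp

/-- The quadratic form `∑ A_ij t_i t_j` on real vectors. -/
def quadForm {n : ℕ} (A : Matrix (Fin n) (Fin n) ℂ) (t : Fin n → ℝ) : ℂ :=
  ∑ i, ∑ j, A i j * t i * t j

theorem quadForm_cons {n : ℕ} (A : Matrix (Fin (n + 1)) (Fin (n + 1)) ℂ) (hA : A.IsSymm)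
    (x : ℝ) (t : Fin n → ℝ) :
    quadForm A (Fin.cons x t) = A 0 0 * x ^ 2 + 2 * x * ∑ i, A 0 i.succ * t i +
      ∑ i, ∑ j, A i.succ j.succ * t i * t j := by
  have h : ∀ i : Fin n, A i.succ 0 = A 0 i.succ := fun i => hA.apply 0 i.succ
  simp only [quadForm, Fin.sum_univ_succ, Fin.cons_zero, Fin.cons_succ, h,
    Finset.sum_add_distrib, Finset.mul_sum]
  have e : ∀ i : Fin n, A 0 i.succ * (t i : ℂ) * x = x * (A 0 i.succ * t i) := fun i => by ring
  have e' : ∀ i : Fin n, A 0 i.succ * (x : ℂ) * t i = x * (A 0 i.succ * t i) := fun i => by ring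
  simp only [e, e', mul_assoc, ← Finset.mul_sum]
  ring

theorem quadForm_schur {n : ℕ} (A : Matrix (Fin (n + 1)) (Fin (n + 1)) ℂ) (hA : A.IsSymm)
    (t : Fin n → ℝ) :
    quadForm (Matrix.of fun i j : Fin n => A i.succ j.succ - A i.succ 0 * A 0 j.succ / A 0 0) t =
      ∑ i, ∑ j, A i.succ j.succ * t i * t j - (∑ i, A 0 i.succ * t i) ^ 2 / A 0 0 := by
  have h : ∀ i : Fin n, A i.succ 0 = A 0 i.succ := fun i => hA.apply 0 i.succ
  simp only [quadForm, Matrix.of_apply, h, sub_mul, Finset.sum_sub_distrib]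
  congr 1
  rw [sq, Finset.sum_mul_sum, Finset.sum_div]
  refine Finset.sum_congr rfl fun i _ => ?_
  rw [Finset.sum_div]
  refine Finset.sum_congr rfl fun j _ => ?_
  ring

theorem integrable_exp_mul_sum_sq {n : ℕ} {θ : ℝ} (hθ : θ < 1 / 2) :
    Integrable (fun t : Fin n → ℝ => Real.exp (θ * ∑ i, t i ^ 2))
      (Measure.pi fun _ : Fin n => stdGauss) := by
  have h := Integrable.fintype_prod (μ := fun _ : Fin n => stdGauss)
    (f := fun _ : Fin n => fun t : ℝ => Real.exp (θ * t ^ 2))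
    (fun _ => integrable_exp_mul_sq_stdGauss hθ)
  convert h using 2 with t
  rw [Finset.mul_sum, Real.exp_sum]

theorem integrable_cexp_quadForm {n : ℕ} (A : Matrix (Fin n) (Fin n) ℂ) {ε : ℝ} (hε : 0 < ε)
    (hpos : ∀ t : Fin n → ℝ, ε * ∑ i, t i ^ 2 ≤ (quadForm A t).re) :
    Integrable (fun t : Fin n → ℝ => Complex.exp ((∑ i, (t i : ℂ) ^ 2 - quadForm A t) / 2))
      (Measure.pi fun _ : Fin n => stdGauss) := by
  refine (integrable_exp_mul_sum_sq (θ := (1 - ε) / 2) (by linarith)).mono' ?_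
    (ae_of_all _ fun t => ?_)
  · unfold quadForm
    exact Measurable.aestronglyMeasurable (by fun_prop)
  · rw [Complex.norm_exp, Real.exp_le_exp, Complex.div_ofNat_re, Complex.sub_re]
    have : (∑ i, (t i : ℂ) ^ 2).re = ∑ i, t i ^ 2 := by
      rw [Complex.re_sum]
      exact Finset.sum_congr rfl fun i _ => by rw [← Complex.ofReal_pow, Complex.ofReal_re]
    rw [this]
    linarith [hpos t]

/-- Integrating out the first variable by completing the square leaves the quadratic form of the
Schur complement, and the determinant splits off the same pivot. -/
theorem integral_cexp_quadForm_sq {n : ℕ} (A : Matrix (Fin n) (Fin n) ℂ) (hA : A.IsSymm) {ε : ℝ}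
    (hε : 0 < ε) (hpos : ∀ t : Fin n → ℝ, ε * ∑ i, t i ^ 2 ≤ (quadForm A t).re) :
    (∫ t : Fin n → ℝ, Complex.exp ((∑ i, (t i : ℂ) ^ 2 - quadForm A t) / 2)
      ∂(Measure.pi fun _ : Fin n => stdGauss)) ^ 2 * A.det = 1 := by
  induction n with
  | zero => simp [quadForm]
  | succ n ih =>
    have ha : ε ≤ (A 0 0).re := by
      have h := hpos (Fin.cons 1 0)
      rw [quadForm_cons A hA] at h
      simpa [Fin.sum_univ_succ] using h
    have ha0 : A 0 0 ≠ 0 := fun h => by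
      rw [h, Complex.zero_re] at ha
      linarith
    let A' : Matrix (Fin n) (Fin n) ℂ :=
      Matrix.of fun i j : Fin n => A i.succ j.succ - A i.succ 0 * A 0 j.succ / A 0 0
    have hA' : A'.IsSymm := by
      refine Matrix.IsSymm.ext fun i j => ?_
      have h1 : A j.succ i.succ = A i.succ j.succ := hA.apply _ _
      have h2 : A j.succ 0 = A 0 j.succ := hA.apply _ _
      have h3 : A i.succ 0 = A 0 i.succ := hA.apply _ _
      simp only [A', Matrix.of_apply, h1, h2, h3]
      ring
    -- Write `Q(x, t) = a (x + q)² + Q'(t)` with `a = A 0 0` and `q = β / a`. At the real point `x =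
    -- -Re q` the square contributes `-a (Im q)²`, so `Re Q'(t)` exceeds `Re Q(x, t)` by `(Im q)² Re
    -- a ≥ 0`.
    have hpos' : ∀ t : Fin n → ℝ, ε * ∑ i, t i ^ 2 ≤ (quadForm A' t).re := fun t => by
      set β := ∑ i, A 0 i.succ * (t i : ℂ) with hβ
      have h := hpos (Fin.cons (-(β / A 0 0).re) t)
      rw [quadForm_cons A hA, ← hβ] at h
      have e : quadForm A' t = (A 0 0 * ((-(β / A 0 0).re : ℝ) : ℂ) ^ 2 +
          2 * ((-(β / A 0 0).re : ℝ) : ℂ) * β + ∑ i, ∑ j, A i.succ j.succ * t i * t j) +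
          ((β / A 0 0).im ^ 2 : ℝ) * A 0 0 := by
        rw [quadForm_schur A hA, ← hβ]
        set q := β / A 0 0 with hq
        have hβq : β = q * A 0 0 := by rw [hq]; field_simp
        have hq2 : q = (q.re : ℂ) + q.im * Complex.I := (Complex.re_add_im q).symm
        have hI := Complex.I_sq
        rw [show β ^ 2 / A 0 0 = q ^ 2 * A 0 0 by rw [hβq]; field_simp, hβq]
        have key : -(q ^ 2) = (q.re : ℂ) ^ 2 - 2 * q.re * q + (q.im : ℂ) ^ 2 := by
          linear_combination (q.re - q.im * Complex.I - q : ℂ) * hq2 - (q.im : ℂ) ^ 2 * hI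
        push_cast
        linear_combination A 0 0 * key
      rw [e, Complex.add_re, Complex.re_ofReal_mul]
      have h1 : 0 ≤ (β / A 0 0).im ^ 2 * (A 0 0).re := by
        have : 0 ≤ (A 0 0).re := hε.le.trans ha
        positivity
      simp only [Fin.sum_univ_succ, Fin.cons_zero, Fin.cons_succ] at h
      have h2 : 0 ≤ ε * (-(β / A 0 0).re) ^ 2 := by positivity
      rw [mul_add] at h
      linarith
    obtain ⟨K, hK, hinteg⟩ := exists_integral_cexp_stdGauss (hε.trans_le ha)
    have hI : ∫ t : Fin (n + 1) → ℝ, Complex.exp ((∑ i, (t i : ℂ) ^ 2 - quadForm A t) / 2)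
        ∂(Measure.pi fun _ : Fin (n + 1) => stdGauss) =
        K * ∫ t : Fin n → ℝ, Complex.exp ((∑ i, (t i : ℂ) ^ 2 - quadForm A' t) / 2)
        ∂(Measure.pi fun _ : Fin n => stdGauss) := by
      rw [integral_pi_fin_succ, integral_prod_symm _
        ((integrable_pi_fin_succ_iff _ _ _).1 (integrable_cexp_quadForm A hε hpos)),
        ← integral_const_mul]
      congr 1
      funext t
      have e : ∀ x : ℝ, Complex.exp ((∑ i, ((Fin.cons x t : Fin (n + 1) → ℝ) i : ℂ) ^ 2 -
          quadForm A (Fin.cons x t)) / 2) =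
          Complex.exp ((1 - A 0 0) / 2 * (x : ℂ) ^ 2 + -(∑ i, A 0 i.succ * (t i : ℂ)) * x) *
          Complex.exp ((∑ i, (t i : ℂ) ^ 2 - ∑ i, ∑ j, A i.succ j.succ * t i * t j) / 2) :=
        fun x => by
          rw [← Complex.exp_add, quadForm_cons A hA, Fin.sum_univ_succ]
          simp only [Fin.cons_zero, Fin.cons_succ]
          congr 1
          ring
      simp only [e]
      rw [integral_mul_const, hinteg, mul_assoc, ← Complex.exp_add, quadForm_schur A hA]
      congr 2
      field_simp
      ring
    rw [hI, det_eq_mul_det_schur A ha0, mul_pow]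
    have := ih A' hA' hpos'
    linear_combination (K ^ 2 * A 0 0) * this + hK

/-! ### The determinant -/

/-- A permutation other than the identity moves some index, so its term contains an off-diagonal
entry; there are fewer than `n!` such terms. -/
theorem norm_det_sub_one_le {n : ℕ} (A : Matrix (Fin n) (Fin n) ℂ) {δ : ℝ} (hδ : 0 ≤ δ)
    (hδ1 : δ ≤ 1) (hdiag : ∀ i, A i i = 1) (hoff : ∀ i j, i ≠ j → ‖A i j‖ ≤ δ) :
    ‖A.det - 1‖ ≤ n.factorial * δ := by
  have hle : ∀ i j, ‖A i j‖ ≤ 1 := fun i j => by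
    by_cases h : i = j
    · subst h
      simp [hdiag]
    · exact (hoff i j h).trans hδ1
  have hdet : A.det - 1 = ∑ σ ∈ (Finset.univ : Finset (Equiv.Perm (Fin n))).erase 1,
      Equiv.Perm.sign σ • ∏ i, A (σ i) i := by
    rw [Matrix.det_apply, ← Finset.add_sum_erase _ _ (Finset.mem_univ 1)]
    simp [hdiag]
  rw [hdet]
  refine (norm_sum_le_of_le (n := fun _ => δ) _ fun σ hσ => ?_).trans ?_
  · obtain ⟨i, hi⟩ : ∃ i, σ i ≠ i := by
      by_contra! h
      exact (Finset.mem_erase.1 hσ).1 (Equiv.ext h)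
    have : ‖Equiv.Perm.sign σ • ∏ i, A (σ i) i‖ = ∏ i, ‖A (σ i) i‖ := by
      rcases Int.units_eq_one_or (Equiv.Perm.sign σ) with h | h <;> simp [h, norm_prod]
    rw [this, ← Finset.mul_prod_erase _ _ (Finset.mem_univ i)]
    calc ‖A (σ i) i‖ * ∏ x ∈ Finset.univ.erase i, ‖A (σ x) x‖ ≤ δ * 1 := by
          refine mul_le_mul (hoff _ _ hi) (Finset.prod_le_one (fun _ _ => norm_nonneg _)
            fun x _ => hle _ _) (Finset.prod_nonneg fun _ _ => norm_nonneg _) hδ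
      _ = δ := mul_one δ
  · rw [Finset.sum_const, nsmul_eq_mul]
    gcongr
    refine (Finset.card_le_card (Finset.erase_subset _ _)).trans ?_
    rw [Finset.card_univ, Fintype.card_perm, Fintype.card_fin]

/-- The diagonal cancels, and Cauchy–Schwarz gives `(∑ |t_i|)² ≤ n ∑ t_i²` for the rest. -/
theorem norm_sum_sq_sub_quadForm_le {n : ℕ} (A : Matrix (Fin n) (Fin n) ℂ) {δ : ℝ} (hδ : 0 ≤ δ)
    (hdiag : ∀ i, A i i = 1) (hoff : ∀ i j, i ≠ j → ‖A i j‖ ≤ δ) (t : Fin n → ℝ) :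
    ‖∑ i, (t i : ℂ) ^ 2 - quadForm A t‖ ≤ n * δ * ∑ i, t i ^ 2 := by
  have e : ∑ i, (t i : ℂ) ^ 2 - quadForm A t =
      ∑ i, ∑ j, (if i = j then 0 else -(A i j * t i * t j)) := by
    rw [quadForm, ← Finset.sum_sub_distrib]
    refine Finset.sum_congr rfl fun i _ => ?_
    rw [← Finset.add_sum_erase _ _ (Finset.mem_univ i),
      ← Finset.add_sum_erase (a := i) _ (fun j => if i = j then 0 else _) (Finset.mem_univ i)]
    rw [Finset.sum_congr rfl (g := fun j => -(A i j * t i * t j)) (fun j hj =>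
      if_neg (Finset.ne_of_mem_erase hj).symm), Finset.sum_neg_distrib, hdiag]
    simp only [if_true]
    ring
  rw [e]
  calc ‖∑ i, ∑ j, (if i = j then 0 else -(A i j * t i * t j))‖
      ≤ ∑ i : Fin n, ∑ j : Fin n, δ * (|t i| * |t j|) := by
        refine norm_sum_le_of_le _ fun i _ => norm_sum_le_of_le _ fun j _ => ?_
        split_ifs with h
        · rw [norm_zero]
          positivity
        · rw [norm_neg, norm_mul, norm_mul, Complex.norm_real, Complex.norm_real, mul_assoc]
          exact mul_le_mul_of_nonneg_right (hoff i j h) (by positivity)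
    _ = δ * (∑ i, |t i|) ^ 2 := by
        rw [sq, Finset.sum_mul_sum, Finset.mul_sum]
        simp only [Finset.mul_sum]
    _ ≤ δ * (n * ∑ i, t i ^ 2) := by
        gcongr
        have := sq_sum_le_card_mul_sum_sq (s := Finset.univ) (f := fun i => |t i|)
        simpa using this
    _ = _ := by ring

/-- The squares agree by `integral_cexp_quadForm_sq`. To identify the root, scale the off-diagonal
entries by `s ∈ [0, 1]`: the determinant stays in the right half-plane, where the principal root is
continuous. -/
theorem integral_cexp_quadForm_eq_det {n : ℕ} (A : Matrix (Fin n) (Fin n) ℂ) (hA : A.IsSymm)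
    {δ : ℝ} (hδ : 0 ≤ δ) (hδ1 : δ ≤ 1) (hδn : n * δ ≤ 1 / 2) (hδf : n.factorial * δ ≤ 1 / 2)
    (hdiag : ∀ i, A i i = 1) (hoff : ∀ i j, i ≠ j → ‖A i j‖ ≤ δ) :
    ∫ t : Fin n → ℝ, Complex.exp ((∑ i, (t i : ℂ) ^ 2 - quadForm A t) / 2)
      ∂(Measure.pi fun _ : Fin n => stdGauss) = A.det ^ (-(1 / 2) : ℂ) := by
  let As : ℝ → Matrix (Fin n) (Fin n) ℂ := fun s =>
    Matrix.of fun i j => if i = j then 1 else s * A i j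
  have hAs1 : As 1 = A := by
    ext i j
    by_cases h : i = j
    · subst h
      simp [As, hdiag]
    · simp [As, h]
  have hAs0 : As 0 = 1 := by
    ext i j
    simp [As, Matrix.one_apply]
  have hdiags : ∀ s i, As s i i = 1 := fun s i => by simp [As]
  have hoffs : ∀ s ∈ Set.Icc (0 : ℝ) 1, ∀ i j, i ≠ j → ‖As s i j‖ ≤ δ := fun s hs i j hij => by
    simp only [As, Matrix.of_apply, if_neg hij, norm_mul, Complex.norm_real,
      Real.norm_of_nonneg hs.1]
    calc s * ‖A i j‖ ≤ 1 * δ := mul_le_mul hs.2 (hoff i j hij) (norm_nonneg _) zero_le_one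
      _ = δ := one_mul δ
  have hsymm : ∀ s, (As s).IsSymm := fun s => by
    refine Matrix.IsSymm.ext fun i j => ?_
    simp only [As, Matrix.of_apply, eq_comm (a := j), hA.apply i j]
  have hnorm : ∀ s ∈ Set.Icc (0 : ℝ) 1, ∀ t : Fin n → ℝ,
      ‖∑ i, (t i : ℂ) ^ 2 - quadForm (As s) t‖ ≤ 1 / 2 * ∑ i, t i ^ 2 := fun s hs t =>
    (norm_sum_sq_sub_quadForm_le (As s) hδ (hdiags s) (hoffs s hs) t).trans
      (mul_le_mul_of_nonneg_right hδn (Finset.sum_nonneg fun i _ => sq_nonneg _))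
  have hpos : ∀ s ∈ Set.Icc (0 : ℝ) 1, ∀ t : Fin n → ℝ,
      1 / 2 * ∑ i, t i ^ 2 ≤ (quadForm (As s) t).re := fun s hs t => by
    have h := (Complex.re_le_norm _).trans (hnorm s hs t)
    have : (∑ i, (t i : ℂ) ^ 2).re = ∑ i, t i ^ 2 := by
      rw [Complex.re_sum]
      exact Finset.sum_congr rfl fun i _ => by rw [← Complex.ofReal_pow, Complex.ofReal_re]
    rw [Complex.sub_re, this] at h
    linarith
  have hdetn : ∀ s ∈ Set.Icc (0 : ℝ) 1, ‖(As s).det - 1‖ ≤ 1 / 2 := fun s hs =>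
    (norm_det_sub_one_le (As s) hδ hδ1 (hdiags s) (hoffs s hs)).trans hδf
  have hslit : ∀ s ∈ Set.Icc (0 : ℝ) 1, (As s).det ∈ Complex.slitPlane := fun s hs => by
    refine Or.inl ?_
    have h := (Complex.abs_re_le_norm _).trans (hdetn s hs)
    rw [Complex.sub_re, Complex.one_re] at h
    linarith [(abs_le.1 h).1]
  have hcontAs : ∀ i j, Continuous fun s => As s i j := fun i j => by
    simp only [As, Matrix.of_apply]
    split_ifs <;> fun_prop
  have hcontdet : Continuous fun s => (As s).det :=
    Continuous.matrix_det (continuous_pi fun i => continuous_pi fun j => hcontAs i j)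
  -- Continuous functions on a connected set with equal squares, one of them without zeros, agree
  -- once they agree at one point, here `s = 0`.
  have key := isPreconnected_Icc.eq_of_sq_eq (S := Set.Icc (0 : ℝ) 1)
    (f := fun s => ∫ t : Fin n → ℝ, Complex.exp ((∑ i, (t i : ℂ) ^ 2 - quadForm (As s) t) / 2)
      ∂(Measure.pi fun _ : Fin n => stdGauss))
    (g := fun s => (As s).det ^ (-(1 / 2) : ℂ)) ?_ ?_ ?_ ?_ (y := 0) (by simp) ?_
  · have := key (Set.right_mem_Icc.2 zero_le_one)
    simpa only [hAs1] using this
  · refine continuousOn_of_dominated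
      (bound := fun t : Fin n → ℝ => Real.exp (1 / 4 * ∑ i, t i ^ 2)) (fun s hs => ?_)
      (fun s hs => ae_of_all _ fun t => ?_) (integrable_exp_mul_sum_sq (by norm_num))
      (ae_of_all _ fun t => ?_)
    · exact (integrable_cexp_quadForm (As s) one_half_pos (hpos s hs)).aestronglyMeasurable
    · rw [Complex.norm_exp, Real.exp_le_exp, Complex.div_ofNat_re]
      have := (Complex.re_le_norm _).trans (hnorm s hs t)
      linarith
    · refine Continuous.continuousOn ?_
      unfold quadForm
      fun_prop
  · exact hcontdet.continuousOn.cpow_const hslit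
  · intro s hs
    have h1 := integral_cexp_quadForm_sq (As s) (hsymm s) one_half_pos (hpos s hs)
    have h0 : (As s).det ≠ 0 := Complex.slitPlane_ne_zero (hslit s hs)
    simp only [Pi.pow_apply]
    rw [← Complex.cpow_nat_mul, eq_div_of_mul_eq h0 h1]
    norm_num [Complex.cpow_neg_one]
  · intro s hs
    rw [Ne, Complex.cpow_eq_zero_iff]
    exact fun h => Complex.slitPlane_ne_zero (hslit s hs) h.1
  · simp only [hAs0, Matrix.det_one, Complex.one_cpow]
    have : ∀ t : Fin n → ℝ, quadForm 1 t = ∑ i, (t i : ℂ) ^ 2 := fun t => by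
      simp [quadForm, Matrix.one_apply, sq]
    simp [this]

/-! ### Test functions on shifted contours -/

theorem exists_norm_mul_le_of_mem_testSpace {ι : Type} [Fintype ι] {F : (ι → ℂ) → ℂ}
    (hF : F ∈ testSpace ι) (k : ℕ) :
    ∃ C : ℝ, 0 ≤ C ∧ ∀ z : ι → ℂ, (∀ a, |(z a).im| ≤ k) → ‖F z‖ ≤ C * ((1 + ‖z‖) ^ k)⁻¹ := by
  obtain ⟨C, hC⟩ := hF.2 k
  refine ⟨C, le_trans (by positivity) (hC 0 (by simp)), fun z hz => ?_⟩
  rw [← div_eq_mul_inv, le_div_iff₀' (by positivity)]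
  exact hC z hz

theorem im_timeShift (y : ℝ) (x : Fin 4 → ℝ) (μ : Fin 4) :
    (timeShift y x μ).im = if μ = 0 then y else 0 := by
  unfold timeShift
  split_ifs <;> simp

theorem re_timeShift (y : ℝ) (x : Fin 4 → ℝ) (μ : Fin 4) : (timeShift y x μ).re = x μ := by
  unfold timeShift
  split_ifs <;> simp

theorem norm_le_norm_timeShift (y : ℝ) (x : Fin 4 → ℝ) : ‖x‖ ≤ ‖timeShift y x‖ := by
  refine (pi_norm_le_iff_of_nonneg (norm_nonneg _)).2 fun μ => ?_
  refine le_trans ?_ (norm_le_pi_norm _ μ)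
  rw [Real.norm_eq_abs, ← re_timeShift y x μ]
  exact Complex.abs_re_le_norm _

theorem integrable_inv_one_add_norm_pow {E : Type*} [NormedAddCommGroup E] [NormedSpace ℝ E]
    [FiniteDimensional ℝ E] [MeasurableSpace E] [BorelSpace E] (μ : Measure E)
    [μ.IsAddHaarMeasure] {k : ℕ} (hk : Module.finrank ℝ E < k) :
    Integrable (fun x : E => ((1 + ‖x‖) ^ k)⁻¹) μ := by
  have h := integrable_one_add_norm (μ := μ) (r := k) (by exact_mod_cast hk)
  convert h using 2 with x
  rw [Real.rpow_neg (by positivity), Real.rpow_natCast]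

theorem continuous_timeShift (y : ℝ) : Continuous (timeShift y) := by
  refine continuous_pi fun μ => ?_
  unfold timeShift
  fun_prop

theorem integrable_comp_timeShift {f : (Fin 4 → ℂ) → ℂ} (hf : f ∈ testSpace (Fin 4)) (y : ℝ) :
    Integrable (fun x : Fin 4 → ℝ => f (timeShift y x)) := by
  -- An order `k ≥ |y|` puts the contour inside the tube of the seminorm; `k ≥ 5` exceeds the real
  -- dimension `4`.
  obtain ⟨k, hk⟩ := exists_nat_ge (max |y| 5)
  obtain ⟨C, hC0, hC⟩ := exists_norm_mul_le_of_mem_testSpace hf k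
  have hk5 : 5 ≤ k := by exact_mod_cast (le_max_right _ _).trans hk
  refine ((integrable_inv_one_add_norm_pow (E := Fin 4 → ℝ) volume (k := k)
    (by simp; omega)).const_mul C).mono' ?_ (ae_of_all _ fun x => ?_)
  · exact (hf.1.continuous.comp (continuous_timeShift y)).aestronglyMeasurable
  · refine (hC _ fun μ => ?_).trans ?_
    · rw [im_timeShift]
      split_ifs
      · exact (le_max_left _ _).trans hk
      · simp
    · have := norm_le_norm_timeShift y x
      gcongr

/-- Cauchy's theorem on the rectangle with corners `-T` and `T + i y`; the vertical sides are
`O(T⁻²)`. -/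
theorem integral_eq_integral_add_mul_I {h : ℂ → ℂ} (hd : Differentiable ℂ h) (y C : ℝ)
    (hb : ∀ x v : ℝ, |v| ≤ |y| → ‖h (x + v * Complex.I)‖ ≤ C * (1 + x ^ 2)⁻¹) :
    ∫ x : ℝ, h x = ∫ x : ℝ, h (x + y * Complex.I) := by
  have hinteg : ∀ v : ℝ, |v| ≤ |y| → Integrable fun x : ℝ => h (x + v * Complex.I) := fun v hv => by
    refine (integrable_inv_one_add_sq.const_mul C).mono' ?_ (ae_of_all _ fun x => hb x v hv)
    exact (hd.continuous.comp (by fun_prop)).aestronglyMeasurable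
  have h0 : Tendsto (fun T : ℝ => ∫ x in (-T)..T, h (x + (0 : ℝ) * Complex.I)) atTop
      (𝓝 (∫ x : ℝ, h (x + (0 : ℝ) * Complex.I))) :=
    intervalIntegral_tendsto_integral (hinteg 0 (by simp)) tendsto_neg_atTop_atBot tendsto_id
  have hy : Tendsto (fun T : ℝ => ∫ x in (-T)..T, h (x + y * Complex.I)) atTop
      (𝓝 (∫ x : ℝ, h (x + y * Complex.I))) :=
    intervalIntegral_tendsto_integral (hinteg y le_rfl) tendsto_neg_atTop_atBot tendsto_id
  -- The sign `s = ±1` selects the right or the left side of the rectangle.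
  have hv : ∀ s : ℝ, s ^ 2 = 1 → Tendsto (fun T : ℝ =>
      Complex.I • ∫ v in (0 : ℝ)..y, h ((s * T : ℝ) + v * Complex.I)) atTop (𝓝 0) := by
    intro s hs
    have hlim : Tendsto (fun T : ℝ => C * (1 + T ^ 2)⁻¹ * |y - 0|) atTop (𝓝 0) := by
      have : Tendsto (fun T : ℝ => (1 + T ^ 2)⁻¹) atTop (𝓝 0) :=
        tendsto_inv_atTop_zero.comp
          (tendsto_atTop_add_const_left _ _ (tendsto_pow_atTop two_ne_zero))
      simpa using (this.const_mul C).mul_const |y - 0|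
    refine squeeze_zero_norm (fun T => ?_) hlim
    rw [norm_smul, Complex.norm_I, one_mul]
    refine intervalIntegral.norm_integral_le_of_norm_le_const fun v hv => ?_
    have hv' : |v| ≤ |y| := by
      rcases Set.mem_uIoc.1 hv with h | h
      · rw [abs_of_pos h.1, abs_of_pos (h.1.trans_le h.2)]
        exact h.2
      · rw [abs_of_nonpos h.2, abs_of_neg (h.1.trans_le h.2)]
        linarith [h.1]
    refine (hb _ v hv').trans_eq ?_
    rw [mul_pow, hs, one_mul]
  have hrect : ∀ T : ℝ, (∫ x in (-T)..T, h (x + (0 : ℝ) * Complex.I)) -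
      (∫ x in (-T)..T, h (x + y * Complex.I)) +
      Complex.I • (∫ v in (0 : ℝ)..y, h ((1 * T : ℝ) + v * Complex.I)) -
      Complex.I • (∫ v in (0 : ℝ)..y, h ((-1 * T : ℝ) + v * Complex.I)) = 0 := fun T => by
    have := Complex.integral_boundary_rect_eq_zero_of_differentiableOn h (-T : ℂ)
      (T + y * Complex.I) hd.differentiableOn
    simpa using this
  have hlim := ((h0.sub hy).add (hv 1 (by norm_num))).sub (hv (-1) (by norm_num))
  simp only [hrect, add_zero, sub_zero] at hlim
  have := tendsto_nhds_unique hlim tendsto_const_nhds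
  simpa using sub_eq_zero.1 this

theorem norm_exp_minkowski_timeShift (p : Fin 4 → ℝ) (y : ℝ) (x : Fin 4 → ℝ) :
    ‖Complex.exp (-Complex.I * minkowski p (timeShift y x))‖ = Real.exp (p 0 * y) := by
  rw [Complex.norm_exp]
  congr 1
  simp [minkowski, timeShift, Fin.sum_univ_succ, Complex.mul_re, Complex.mul_im,
    Fin.succ_ne_zero]

theorem integrable_comp_timeShift_mul_exp {f : (Fin 4 → ℂ) → ℂ} (hf : f ∈ testSpace (Fin 4))
    (p : Fin 4 → ℝ) (y : ℝ) :
    Integrable (fun x : Fin 4 → ℝ =>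
      f (timeShift y x) * Complex.exp (-Complex.I * minkowski p (timeShift y x))) := by
  refine (integrable_comp_timeShift hf y).mul_bdd (c := Real.exp (p 0 * y)) ?_
    (ae_of_all _ fun x => (norm_exp_minkowski_timeShift p y x).le)
  unfold minkowski
  exact Measurable.aestronglyMeasurable (by fun_prop)

theorem timeShift_cons (y s : ℝ) (x : Fin 3 → ℝ) :
    timeShift y (Fin.cons s x) = Fin.cons ((s : ℂ) + y * Complex.I) (fun i => (x i : ℂ)) := by
  funext μ
  refine Fin.cases ?_ (fun i => ?_) μ
  · simp [timeShift]
  · simp [timeShift, Fin.succ_ne_zero]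

/-- The Fourier integral of a test function may be taken over any contour `ℝ⁴ + i (y, 0, 0, 0)`. -/
theorem fourier4_eq_integral_timeShift {f : (Fin 4 → ℂ) → ℂ} (hf : f ∈ testSpace (Fin 4))
    (p : Fin 4 → ℝ) (y : ℝ) :
    fourier4 f p = ((2 * (Real.pi : ℂ)) ^ 2)⁻¹ * ∫ x : Fin 4 → ℝ,
      f (timeShift y x) * Complex.exp (-Complex.I * minkowski p (timeShift y x)) := by
  have h0 : ∀ x : Fin 4 → ℝ, (fun μ => (x μ : ℂ)) = timeShift 0 x := fun x => by
    funext μ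
    simp [timeShift]
  unfold fourier4
  simp only [h0]
  congr 1
  have hinteg := fun v => integrable_comp_timeShift_mul_exp hf p v
  have hinteg' := fun v => (integrable_pi_fin_succ_iff (volume : Measure ℝ) 3 _).1 (hinteg v)
  -- The order of integration is chosen so that time, the only shifted variable, is innermost.
  rw [volume_pi, integral_pi_fin_succ, integral_pi_fin_succ, integral_prod_symm _ (hinteg' 0),
    integral_prod_symm _ (hinteg' y)]
  congr 1
  funext x
  obtain ⟨k, hk⟩ := exists_nat_ge (max |y| 2)
  obtain ⟨C, hC0, hC⟩ := exists_norm_mul_le_of_mem_testSpace hf k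
  have hk2 : 2 ≤ k := by exact_mod_cast (le_max_right _ _).trans hk
  simp only [timeShift_cons]
  let h : ℂ → ℂ := fun ζ => f (Fin.cons ζ fun i => (x i : ℂ)) *
    Complex.exp (-Complex.I * minkowski p (Fin.cons ζ fun i => (x i : ℂ)))
  have hcons : Differentiable ℂ fun ζ : ℂ => (Fin.cons ζ fun i => (x i : ℂ) : Fin 4 → ℂ) := by
    refine differentiable_pi.2 fun μ => ?_
    refine Fin.cases ?_ (fun i => ?_) μ
    · simp only [Fin.cons_zero]
      fun_prop
    · simp only [Fin.cons_succ]
      fun_prop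
  have hd : Differentiable ℂ h := by
    refine (hf.1.comp hcons).mul (Differentiable.cexp ?_)
    simp only [minkowski, Fin.cons_zero, Fin.cons_succ]
    fun_prop
  have key := integral_eq_integral_add_mul_I hd y (C * Real.exp (|p 0| * |y|)) fun s v hv => ?_
  · simpa [h] using key
  · simp only [h]
    rw [← timeShift_cons, norm_mul, norm_exp_minkowski_timeShift, mul_right_comm]
    have h1 : Real.exp (p 0 * v) ≤ Real.exp (|p 0| * |y|) := by
      rw [Real.exp_le_exp]
      refine (le_abs_self _).trans ?_
      rw [abs_mul]
      gcongr
    have h2 : ‖f (timeShift v (Fin.cons s x))‖ ≤ C * (1 + s ^ 2)⁻¹ := by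
      refine (hC _ fun μ => ?_).trans ?_
      · rw [im_timeShift]
        split_ifs
        · exact hv.trans ((le_max_left _ _).trans hk)
        · simp
      · gcongr
        have hs : |s| ≤ ‖timeShift v (Fin.cons s x)‖ := by
          refine le_trans ?_ (norm_le_norm_timeShift _ _)
          exact norm_le_pi_norm (Fin.cons s x : Fin 4 → ℝ) 0
        calc 1 + s ^ 2 ≤ (1 + |s|) ^ 2 := by nlinarith [sq_abs s, abs_nonneg s]
          _ ≤ (1 + ‖timeShift v (Fin.cons s x)‖) ^ 2 := by gcongr
          _ ≤ (1 + ‖timeShift v (Fin.cons s x)‖) ^ k :=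
              pow_le_pow_right₀ (by linarith [norm_nonneg (timeShift v (Fin.cons s x))]) hk2
    exact mul_le_mul h2 h1 (Real.exp_pos _).le (by positivity)

/-! ### Gaussian superpositions of coherent vectors -/

/-- A source: its Gaussian amplitude and its (real) position. -/
abbrev Source : Type := ℝ × (Fin 4 → ℝ)

/-- The standard Gaussian measure in the amplitude times Lebesgue measure in the position. -/
def sourceMeasure : Measure Source := stdGauss.prod volume

instance : SigmaFinite sourceMeasure := by
  unfold sourceMeasure
  infer_instance

/-- The product of `sourceMeasure` over `n` sources. -/
abbrev sourceMeasures (n : ℕ) : Measure (Fin n → Source) := Measure.pi fun _ => sourceMeasure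

/-- The one-particle function of the coherent vector created by the sources `w`. -/
def sourceField (m : ℝ) {n : ℕ} (c : Fin n → ℂ) (y : Fin n → ℝ) (w : Fin n → Source) (ξ : R3) :
    ℂ :=
  fieldConst * ∑ i, c i * (w i).1 * planeWave m ξ (timeShift (y i) (w i).2)

/-- The contraction of the field at `z` with the sources `w`. -/
def contraction (m : ℝ) {n : ℕ} (c : Fin n → ℂ) (y : Fin n → ℝ) (w : Fin n → Source)
    (z : Fin 4 → ℂ) : ℂ :=
  ∑ i, c i * (w i).1 * twoPoint m (z - timeShift (y i) (w i).2)

/-- The sum of the contractions of all pairs of sources. -/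
def interaction (m : ℝ) {n : ℕ} (c : Fin n → ℂ) (y : Fin n → ℝ) (w : Fin n → Source) : ℂ :=
  ∑ i, ∑ k, if i < k then c i * (w i).1 * (c k * (w k).1 *
    twoPoint m (timeShift (y i) (w i).2 - timeShift (y k) (w k).2)) else 0

/-- The product of the test functions with the exponential of the interaction. -/
def sourceWeight (m : ℝ) {n : ℕ} (c : Fin n → ℂ) (f : Fin n → (Fin 4 → ℂ) → ℂ) (y : Fin n → ℝ)
    (w : Fin n → Source) : ℂ :=
  (∏ i, f i (timeShift (y i) (w i).2)) * Complex.exp (interaction m c y w)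

/-- The `N`-particle function of the Gaussian superposition of coherent vectors that represents
a product of Wick exponentials applied to the vacuum. -/
def sourceState (m : ℝ) {n : ℕ} (c : Fin n → ℂ) (f : Fin n → (Fin 4 → ℂ) → ℂ) (y : Fin n → ℝ)
    (N : ℕ) (ξ : Fin N → R3) : ℂ :=
  ∫ w, sourceWeight m c f y w *
    (((Real.sqrt N.factorial)⁻¹ : ℝ) * ∏ a, sourceField m c y w (ξ a)) ∂(sourceMeasures n)

@[fun_prop]
theorem measurable_sourceField {α : Type*} [MeasurableSpace α] {m : ℝ} {n : ℕ} {c : Fin n → ℂ}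
    {y : Fin n → ℝ} {w : α → Fin n → Source} {ξ : α → R3} (hw : Measurable w)
    (hξ : Measurable ξ) : Measurable (fun a => sourceField m c y (w a) (ξ a)) := by
  unfold sourceField
  fun_prop

@[fun_prop]
theorem measurable_contraction {α : Type*} [MeasurableSpace α] {m : ℝ} {n : ℕ} {c : Fin n → ℂ}
    {y : Fin n → ℝ} {w : α → Fin n → Source} {z : α → Fin 4 → ℂ} (hw : Measurable w)
    (hz : Measurable z) : Measurable (fun a => contraction m c y (w a) (z a)) := by
  unfold contraction
  fun_prop

theorem measurable_sourceWeight (m : ℝ) {n : ℕ} (c : Fin n → ℂ) {f : Fin n → (Fin 4 → ℂ) → ℂ}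
    (hf : ∀ i, f i ∈ testSpace (Fin 4)) (y : Fin n → ℝ) :
    Measurable (sourceWeight m c f y) := by
  have hf' : ∀ i, Measurable (f i) := fun i => (hf i).1.continuous.measurable
  unfold sourceWeight
  refine Measurable.mul (Finset.measurable_prod _ fun i _ => (hf' i).comp (by fun_prop)) ?_
  refine Complex.measurable_exp.comp ?_
  unfold interaction
  refine Finset.measurable_sum _ fun i _ => Finset.measurable_sum _ fun k _ => ?_
  split_ifs <;> fun_prop

theorem sourceField_cons (m : ℝ) {n : ℕ} (c : Fin (n + 1) → ℂ) (y : Fin (n + 1) → ℝ) (w₀ : Source)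
    (w : Fin n → Source) (ξ : R3) :
    sourceField m c y (Fin.cons w₀ w : Fin (n + 1) → Source) ξ =
      c 0 * w₀.1 * (fieldConst * planeWave m ξ (timeShift (y 0) w₀.2)) +
        sourceField m (fun i => c i.succ) (fun i => y i.succ) w ξ := by
  simp only [sourceField, Fin.sum_univ_succ, Fin.cons_zero, Fin.cons_succ]
  ring

theorem interaction_cons (m : ℝ) {n : ℕ} (c : Fin (n + 1) → ℂ) (y : Fin (n + 1) → ℝ) (w₀ : Source)
    (w : Fin n → Source) :
    interaction m c y (Fin.cons w₀ w : Fin (n + 1) → Source) =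
      c 0 * w₀.1 * contraction m (fun i => c i.succ) (fun i => y i.succ) w (timeShift (y 0) w₀.2) +
        interaction m (fun i => c i.succ) (fun i => y i.succ) w := by
  simp only [interaction, contraction, Fin.sum_univ_succ, Fin.cons_zero, Fin.cons_succ,
    if_false, Fin.succ_pos, if_true, Fin.not_lt_zero, Fin.succ_lt_succ_iff, zero_add,
    Finset.mul_sum]

/-- A further operator on the left acts as a new source `0`, whose contraction with the old sources
appears as the factor `exp X` of `hasSum_wickPoly`. -/
theorem sourceWeight_cons (m : ℝ) {n : ℕ} (c : Fin (n + 1) → ℂ)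
    (f : Fin (n + 1) → (Fin 4 → ℂ) → ℂ) (y : Fin (n + 1) → ℝ) (w₀ : Source)
    (w : Fin n → Source) :
    sourceWeight m c f y (Fin.cons w₀ w : Fin (n + 1) → Source) =
      f 0 (timeShift (y 0) w₀.2) *
        sourceWeight m (fun i => c i.succ) (fun i => f i.succ) (fun i => y i.succ) w *
        Complex.exp (c 0 * w₀.1 *
          contraction m (fun i => c i.succ) (fun i => y i.succ) w (timeShift (y 0) w₀.2)) := by
  simp only [sourceWeight, interaction_cons, Fin.prod_univ_succ, Fin.cons_zero, Fin.cons_succ,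
    Complex.exp_add]
  ring

/-! ### Bounds for source fields, contractions and weights -/

/-- The sum of the absolute values of the amplitudes. -/
def totalAmp {n : ℕ} (w : Fin n → Source) : ℝ := ∑ i, |(w i).1|

theorem totalAmp_nonneg {n : ℕ} (w : Fin n → Source) : 0 ≤ totalAmp w :=
  Finset.sum_nonneg fun _ _ => abs_nonneg _

@[fun_prop]
theorem measurable_totalAmp {n : ℕ} : Measurable (totalAmp (n := n)) := by
  unfold totalAmp
  fun_prop

/-- The bound of the interaction per pair of sources: `C` bounds the couplings and `L` is a lower
bound of the imaginary time separations. -/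
def pairBound (C L : ℝ) : ℝ := C ^ 2 * (fieldConst ^ 2 * (shellConst / L ^ 2))

theorem pairBound_nonneg (C L : ℝ) : 0 ≤ pairBound C L := by
  have := shellConst_nonneg
  unfold pairBound
  positivity

theorem norm_sourceField_le (m : ℝ) {n : ℕ} {c : Fin n → ℂ} {y : Fin n → ℝ} {C y₀ : ℝ}
    (hC : ∀ i, ‖c i‖ ≤ C) (hy : ∀ i, y₀ ≤ y i) (w : Fin n → Source) (ξ : R3) :
    ‖sourceField m c y w ξ‖ ≤
      Real.exp (-(y₀ * energy m ξ)) * (fieldConst * C * totalAmp w) := by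
  rw [sourceField, norm_mul, Complex.norm_real, Real.norm_of_nonneg fieldConst_pos.le, totalAmp]
  have h : ‖∑ i, c i * ((w i).1 : ℂ) * planeWave m ξ (timeShift (y i) (w i).2)‖ ≤
      ∑ i, C * |(w i).1| * Real.exp (-(y₀ * energy m ξ)) := by
    refine norm_sum_le_of_le _ fun i _ => ?_
    rw [norm_mul, norm_mul, Complex.norm_real, Real.norm_eq_abs, norm_planeWave_timeShift]
    have h1 := hC i
    have h2 := hy i
    have h3 := energy_nonneg m ξ
    have h4 : 0 ≤ C := (norm_nonneg _).trans h1
    gcongr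
  refine (mul_le_mul_of_nonneg_left h fieldConst_pos.le).trans_eq ?_
  rw [← Finset.sum_mul, ← Finset.mul_sum]
  ring

theorem norm_mul_contraction_le (m : ℝ) {n : ℕ} {c : Fin n → ℂ} {y : Fin n → ℝ} {C L y₀ : ℝ}
    (hC : ∀ i, ‖c i‖ ≤ C) (hL : 0 < L) (hy : ∀ i, L ≤ y i - y₀) {c₀ : ℂ} (hc₀ : ‖c₀‖ ≤ C)
    (w₀ : Source) (w : Fin n → Source) :
    ‖c₀ * w₀.1 * contraction m c y w (timeShift y₀ w₀.2)‖ ≤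
      pairBound C L * (|w₀.1| * totalAmp w) := by
  have hC0 : 0 ≤ C := (norm_nonneg _).trans hc₀
  have h : ‖contraction m c y w (timeShift y₀ w₀.2)‖ ≤
      ∑ i, C * |(w i).1| * (fieldConst ^ 2 * (shellConst / L ^ 2)) := by
    refine norm_sum_le_of_le _ fun i _ => ?_
    rw [norm_mul, norm_mul, Complex.norm_real, Real.norm_eq_abs]
    have h1 := hC i
    have h2 := norm_twoPoint_le m hL (hy i) w₀.2 (w i).2
    gcongr
  rw [norm_mul, norm_mul, Complex.norm_real, Real.norm_eq_abs]
  calc ‖c₀‖ * |w₀.1| * ‖contraction m c y w (timeShift y₀ w₀.2)‖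
      ≤ C * |w₀.1| * ∑ i, C * |(w i).1| * (fieldConst ^ 2 * (shellConst / L ^ 2)) := by gcongr
    _ = _ := by
      rw [← Finset.sum_mul, ← Finset.mul_sum, totalAmp, pairBound]
      ring

/-- The sum over ordered pairs is enlarged to the full double sum, a square. -/
theorem norm_interaction_le (m : ℝ) {n : ℕ} {c : Fin n → ℂ} {y : Fin n → ℝ} {C L : ℝ}
    (hC : ∀ i, ‖c i‖ ≤ C) (hL : 0 < L) (hy : ∀ i k, i < k → L ≤ y k - y i)
    (w : Fin n → Source) :
    ‖interaction m c y w‖ ≤ pairBound C L * totalAmp w ^ 2 := by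
  rw [totalAmp, sq, Finset.sum_mul_sum, Finset.mul_sum]
  refine norm_sum_le_of_le _ fun i _ => ?_
  rw [Finset.mul_sum]
  refine norm_sum_le_of_le _ fun k _ => ?_
  split_ifs with h
  · simp only [norm_mul, Complex.norm_real, Real.norm_eq_abs]
    have h1 := hC i
    have h2 := hC k
    have h3 := norm_twoPoint_le m hL (hy i k h) (w i).2 (w k).2
    have h4 : 0 ≤ C := (norm_nonneg _).trans h1
    calc _ ≤ C * |(w i).1| * (C * |(w k).1| * (fieldConst ^ 2 * (shellConst / L ^ 2))) := by
          gcongr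
      _ = _ := by
        rw [pairBound]
        ring
  · rw [norm_zero]
    have := pairBound_nonneg C L
    positivity

/-- The product of the absolute values of the test functions on the contours. -/
def testBound {n : ℕ} (f : Fin n → (Fin 4 → ℂ) → ℂ) (y : Fin n → ℝ) (w : Fin n → Source) : ℝ :=
  ∏ i, ‖f i (timeShift (y i) (w i).2)‖

theorem testBound_nonneg {n : ℕ} (f : Fin n → (Fin 4 → ℂ) → ℂ) (y : Fin n → ℝ)
    (w : Fin n → Source) : 0 ≤ testBound f y w :=
  Finset.prod_nonneg fun _ _ => norm_nonneg _

theorem measurable_testBound {n : ℕ} {f : Fin n → (Fin 4 → ℂ) → ℂ}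
    (hf : ∀ i, f i ∈ testSpace (Fin 4)) (y : Fin n → ℝ) : Measurable (testBound f y) :=
  Finset.measurable_prod _ fun i _ =>
    ((hf i).1.continuous.measurable.comp (by fun_prop)).norm

theorem norm_sourceWeight_le (m : ℝ) {n : ℕ} {c : Fin n → ℂ} (f : Fin n → (Fin 4 → ℂ) → ℂ)
    {y : Fin n → ℝ} {C L : ℝ} (hC : ∀ i, ‖c i‖ ≤ C) (hL : 0 < L)
    (hy : ∀ i k, i < k → L ≤ y k - y i) (w : Fin n → Source) :
    ‖sourceWeight m c f y w‖ ≤ testBound f y w * Real.exp (pairBound C L * totalAmp w ^ 2) := by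
  rw [sourceWeight, norm_mul, norm_prod, Complex.norm_exp, testBound]
  gcongr
  exact (Complex.re_le_norm _).trans (norm_interaction_le m hC hL hy w)

theorem totalAmp_sq_le {n : ℕ} (w : Fin n → Source) : totalAmp w ^ 2 ≤ n * ∑ i, (w i).1 ^ 2 := by
  have := sq_sum_le_card_mul_sum_sq (s := Finset.univ) (f := fun i => |(w i).1|)
  simpa [totalAmp] using this

theorem integrable_testBound_mul_exp_sum {n : ℕ} {f : Fin n → (Fin 4 → ℂ) → ℂ}
    (hf : ∀ i, f i ∈ testSpace (Fin 4)) (y : Fin n → ℝ) {θ : ℝ} (hθ : θ < 1 / 2) :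
    Integrable (fun w => testBound f y w * Real.exp (θ * ∑ i, (w i).1 ^ 2))
      (sourceMeasures n) := by
  have h := Integrable.fintype_prod (μ := fun _ : Fin n => sourceMeasure)
    (f := fun (i : Fin n) (s : Source) => Real.exp (θ * s.1 ^ 2) * ‖f i (timeShift (y i) s.2)‖)
    (fun i => (integrable_exp_mul_sq_stdGauss hθ).mul_prod
      (integrable_comp_timeShift (hf i) (y i)).norm)
  refine h.congr (ae_of_all _ fun w => ?_)
  simp only [testBound, Finset.prod_mul_distrib, Finset.mul_sum, Real.exp_sum]
  ring

/-- By `totalAmp_sq_le` the exponent is at most `n b ∑ t_i²`, and a standard Gaussian tolerates any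
coefficient below `1/2`. -/
theorem integrable_testBound_mul_exp {n : ℕ} {f : Fin n → (Fin 4 → ℂ) → ℂ}
    (hf : ∀ i, f i ∈ testSpace (Fin 4)) (y : Fin n → ℝ) {b : ℝ} (hb0 : 0 ≤ b)
    (hb : n * b < 1 / 2) :
    Integrable (fun w => testBound f y w * Real.exp (b * totalAmp w ^ 2)) (sourceMeasures n) := by
  refine (integrable_testBound_mul_exp_sum hf y hb).mono' ?_ (ae_of_all _ fun w => ?_)
  · have := measurable_testBound hf y
    exact Measurable.aestronglyMeasurable (by fun_prop)
  · have h := testBound_nonneg f y w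
    rw [Real.norm_of_nonneg (by positivity)]
    refine mul_le_mul_of_nonneg_left (Real.exp_le_exp.2 ?_) h
    refine (mul_le_mul_of_nonneg_left (totalAmp_sq_le w) hb0).trans_eq ?_
    ring

/-- Combine `τ^M ≤ M! exp τ` with `τ ≤ θ τ² + 1/(4θ)`. -/
theorem pow_le_const_mul_exp (M : ℕ) {θ : ℝ} (hθ : 0 < θ) :
    ∃ K : ℝ, 0 ≤ K ∧ ∀ τ : ℝ, 0 ≤ τ → τ ^ M ≤ K * Real.exp (θ * τ ^ 2) := by
  refine ⟨M.factorial * Real.exp ((4 * θ)⁻¹), by positivity, fun τ hτ => ?_⟩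
  have h1 : τ ^ M ≤ M.factorial * Real.exp τ := by
    have := Real.pow_div_factorial_le_exp τ hτ M
    rwa [div_le_iff₀' (by positivity)] at this
  refine h1.trans ?_
  rw [mul_assoc, ← Real.exp_add]
  gcongr
  have h2 : (4 * θ)⁻¹ + θ * τ ^ 2 - τ = θ * (τ - (2 * θ)⁻¹) ^ 2 := by
    field_simp
    ring
  have h3 : 0 ≤ θ * (τ - (2 * θ)⁻¹) ^ 2 := by positivity
  linarith

theorem integrable_testBound_mul_exp_mul_pow {n : ℕ} {f : Fin n → (Fin 4 → ℂ) → ℂ}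
    (hf : ∀ i, f i ∈ testSpace (Fin 4)) (y : Fin n → ℝ) {b : ℝ} (hb0 : 0 ≤ b)
    (hb : n * b < 1 / 2) (M : ℕ) :
    Integrable (fun w => testBound f y w * Real.exp (b * totalAmp w ^ 2) * totalAmp w ^ M)
      (sourceMeasures n) := by
  obtain ⟨θ, hθ, hθ'⟩ : ∃ θ : ℝ, 0 < θ ∧ n * (b + θ) < 1 / 2 := by
    -- This `θ` spends at most half of the slack in `n b < 1/2`; the shift to `n + 1` covers `n =
    -- 0`.
    refine ⟨(1 / 2 - n * b) / (2 * (n + 1)), by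
      have : 0 < 1 / 2 - n * b := by linarith
      positivity, ?_⟩
    have h1 : (n : ℝ) * ((1 / 2 - n * b) / (2 * (n + 1))) ≤ (1 / 2 - n * b) / 2 := by
      have h2 : (n : ℝ) * ((1 / 2 - n * b) / (2 * (n + 1))) =
          (1 / 2 - n * b) / 2 * (n / (n + 1)) := by
        field_simp
      rw [h2]
      refine mul_le_of_le_one_right (by linarith) ?_
      rw [div_le_one (by positivity)]
      linarith
    rw [mul_add]
    linarith
  obtain ⟨K, hK0, hK⟩ := pow_le_const_mul_exp M hθ
  refine ((integrable_testBound_mul_exp hf y (add_nonneg hb0 hθ.le) hθ').const_mul K).mono' ?_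
    (ae_of_all _ fun w => ?_)
  · have := measurable_testBound hf y
    exact Measurable.aestronglyMeasurable (by fun_prop)
  · have h := testBound_nonneg f y w
    have h' := totalAmp_nonneg w
    rw [Real.norm_of_nonneg (by positivity)]
    refine (mul_le_mul_of_nonneg_left (hK _ h') (by positivity)).trans_eq ?_
    rw [add_mul, Real.exp_add]
    ring

/-! ### Rearranging momenta -/

theorem measurePreserving_fin_append {α : Type*} [MeasurableSpace α] (μ : Measure α)
    [SigmaFinite μ] (j k : ℕ) :
    MeasurePreserving (fun p : (Fin j → α) × (Fin k → α) => Fin.append p.1 p.2)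
      ((Measure.pi fun _ : Fin j => μ).prod (Measure.pi fun _ : Fin k => μ))
      (Measure.pi fun _ : Fin (j + k) => μ) := by
  have hm : Measurable (fun p : (Fin j → α) × (Fin k → α) => Fin.append p.1 p.2) := by
    refine measurable_pi_lambda _ fun i => ?_
    refine Fin.addCases (fun a => ?_) (fun a => ?_) i
    · simp only [Fin.append_left]
      fun_prop
    · simp only [Fin.append_right]
      fun_prop
  refine ⟨hm, (Measure.pi_eq fun s hs => ?_).symm⟩
  rw [Measure.map_apply hm (MeasurableSet.univ_pi hs)]
  have : (fun p : (Fin j → α) × (Fin k → α) => Fin.append p.1 p.2) ⁻¹' Set.univ.pi s =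
      (Set.univ.pi fun a => s (Fin.castAdd k a)) ×ˢ (Set.univ.pi fun a => s (Fin.natAdd j a)) := by
    ext p
    simp only [Set.mem_preimage, Set.mem_univ_pi, Set.mem_prod, Fin.forall_fin_add,
      Fin.append_left, Fin.append_right]
  rw [this, Measure.prod_prod, Measure.pi_pi, Measure.pi_pi, Fin.prod_univ_add]

/-- Forgetting coordinates does not preserve an infinite measure, but it still pulls null sets back
to null sets. -/
theorem quasiMeasurePreserving_comp_injective {α : Type*} [MeasurableSpace α] (μ : Measure α)
    [SigmaFinite μ] {k N : ℕ} (e : Fin k → Fin N) (he : Function.Injective e) :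
    Measure.QuasiMeasurePreserving (fun ξ : Fin N → α => ξ ∘ e)
      (Measure.pi fun _ : Fin N => μ) (Measure.pi fun _ : Fin k => μ) := by
  classical
  obtain ⟨P, hP⟩ : ∃ P : Fin N → Prop, ∀ i, i ∈ Set.range e ↔ P i := ⟨_, fun _ => Iff.rfl⟩
  have h1 := (measurePreserving_piEquivPiSubtypeProd (fun _ : Fin N => μ)
    P).quasiMeasurePreserving
  have h2 := Measure.quasiMeasurePreserving_fst
    (μ := Measure.pi fun _ : {i // P i} => μ) (ν := Measure.pi fun _ : {i // ¬ P i} => μ)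
  let f : Fin k ≃ {i // P i} := (Equiv.ofInjective e he).trans (Equiv.subtypeEquivRight hP)
  have h3 := (measurePreserving_piCongrLeft (α := fun _ : Fin k => α)
    (fun _ : Fin k => μ) f.symm).quasiMeasurePreserving
  have hcomp : (fun ξ : Fin N → α => ξ ∘ e) =
      (MeasurableEquiv.piCongrLeft (fun _ : Fin k => α) f.symm ∘ Prod.fst) ∘
        MeasurableEquiv.piEquivPiSubtypeProd (fun _ : Fin N => α) P := by
    funext ξ i
    have := Equiv.piCongrLeft_apply_apply (P := fun _ : Fin k => α) f.symm
      (fun j : {i // P i} => ξ j) (f i)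
    rw [Equiv.symm_apply_apply] at this
    exact this.symm
  rw [hcomp]
  exact (h3.comp h2).comp h1

/-- Components of Fock vectors are known only almost everywhere, while a Wick power evaluates them
at annihilated momenta joined to a subfamily of the outer ones. -/
theorem ae_ae_append_of_ae {α : Type*} [MeasurableSpace α] (μ : Measure α) [SigmaFinite μ]
    {j k N : ℕ} (e : Fin k → Fin N) (he : Function.Injective e) {P : (Fin (j + k) → α) → Prop}
    (hP : ∀ᵐ ζ ∂(Measure.pi fun _ : Fin (j + k) => μ), P ζ) :
    ∀ᵐ ξ ∂(Measure.pi fun _ : Fin N => μ), ∀ᵐ η ∂(Measure.pi fun _ : Fin j => μ),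
      P (Fin.append η (fun i => ξ (e i))) := by
  have h1 := (measurePreserving_fin_append μ j k).quasiMeasurePreserving.ae hP
  have h2 := Measure.measurePreserving_swap.quasiMeasurePreserving.ae h1
  exact (quasiMeasurePreserving_comp_injective μ e he).ae (Measure.ae_ae_of_ae_prod h2)

theorem prod_comp_orderEmbOfFin {M : Type*} [CommMonoid M] {N : ℕ} (s : Finset (Fin N))
    (g : Fin N → M) : ∏ i, g (s.orderEmbOfFin rfl i) = ∏ k ∈ s, g k := by
  conv_rhs => rw [← Finset.map_orderEmbOfFin_univ s rfl]
  rw [Finset.prod_map]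
  rfl

/-! ### Wick powers of superpositions of coherent vectors -/

/-- Each annihilated particle produces one contraction. The inverse `fieldConst` appears because a
two-point function carries two such constants and a source field only one. -/
theorem integral_inv_planeWave_mul_sourceField (m : ℝ) {n : ℕ} (c : Fin n → ℂ) {y : Fin n → ℝ}
    {y₀ : ℝ} (hy : ∀ i, y₀ < y i) (w : Fin n → Source) (x₀ : Fin 4 → ℝ) :
    ∫ η, (planeWave m η (timeShift y₀ x₀))⁻¹ * sourceField m c y w η ∂(shellMeasure m) =
      (fieldConst : ℂ)⁻¹ * contraction m c y w (timeShift y₀ x₀) := by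
  have h0 : (fieldConst : ℂ) ≠ 0 := by exact_mod_cast fieldConst_pos.ne'
  have e : ∀ η, (planeWave m η (timeShift y₀ x₀))⁻¹ * sourceField m c y w η =
      ∑ i, fieldConst * (c i * (w i).1) * ((planeWave m η (timeShift y₀ x₀))⁻¹ *
        planeWave m η (timeShift (y i) (w i).2)) := fun η => by
    rw [sourceField, Finset.mul_sum, Finset.mul_sum]
    refine Finset.sum_congr rfl fun i _ => ?_
    ring
  simp only [e]
  rw [integral_finsetSum _ fun i _ =>
    (integrable_inv_planeWave_mul m (hy i) x₀ (w i).2).const_mul _, contraction, Finset.mul_sum]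
  refine Finset.sum_congr rfl fun i _ => ?_
  rw [integral_const_mul, twoPoint_sub_eq]
  field_simp

/-- The inverse wave grows like `exp(y₀ ω)`, but the sources lie at imaginary times at least `y₀ +
L`. -/
theorem norm_inv_planeWave_mul_sourceField_le (m : ℝ) {n : ℕ} {c : Fin n → ℂ} {y : Fin n → ℝ}
    {C L y₀ : ℝ} (hC : ∀ i, ‖c i‖ ≤ C) (hy : ∀ i, L ≤ y i - y₀) (w : Fin n → Source)
    (x₀ : Fin 4 → ℝ) (η : R3) :
    ‖(planeWave m η (timeShift y₀ x₀))⁻¹ * sourceField m c y w η‖ ≤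
      Real.exp (-(L * energy m η)) * (fieldConst * C * totalAmp w) := by
  rw [norm_mul, norm_inv, norm_planeWave_timeShift, ← Real.exp_neg]
  refine (mul_le_mul_of_nonneg_left (norm_sourceField_le m hC (y₀ := y₀ + L)
    (fun i => by linarith [hy i]) w η) (Real.exp_pos _).le).trans_eq ?_
  rw [← mul_assoc, ← Real.exp_add]
  congr 2
  ring

/-- The contribution of the set `S` of created particles: the factor that does not depend on the
momenta of the annihilated particles. -/
def createdPart (m : ℝ) {n : ℕ} (c : Fin n → ℂ) (f : Fin n → (Fin 4 → ℂ) → ℂ) (y : Fin n → ℝ)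
    (f₀ : (Fin 4 → ℂ) → ℂ) (y₀ : ℝ) {N : ℕ} (S : Finset (Fin N)) (ξ : Fin N → R3)
    (q : (Fin 4 → ℝ) × (Fin n → Source)) : ℂ :=
  f₀ (timeShift y₀ q.1) * sourceWeight m c f y q.2 *
    ((∏ k ∈ S, planeWave m (ξ k) (timeShift y₀ q.1)) * ∏ k ∈ Sᶜ, sourceField m c y q.2 (ξ k))

/-- The factor belonging to the annihilated particles. -/
def annihilatedPart (m : ℝ) {n : ℕ} (c : Fin n → ℂ) (y : Fin n → ℝ) (y₀ : ℝ) {j : ℕ}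
    (η : Fin j → R3) (q : (Fin 4 → ℝ) × (Fin n → Source)) : ℂ :=
  ∏ r, ((planeWave m (η r) (timeShift y₀ q.1))⁻¹ * sourceField m c y q.2 (η r))

section Step

variable {m : ℝ} {n : ℕ} {c : Fin n → ℂ} {f : Fin n → (Fin 4 → ℂ) → ℂ} {y : Fin n → ℝ}
  {C L y₀ : ℝ} {f₀ : (Fin 4 → ℂ) → ℂ}

/-- Joint integrability in the annihilated momenta, the new position and the sources; this is the
hypothesis of Fubini below. -/
theorem integrable_createdPart_mul_annihilatedPart (hC : ∀ i, ‖c i‖ ≤ C) (hL : 0 < L)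
    (hsep : ∀ i k, i < k → L ≤ y k - y i) (hy : ∀ i, L ≤ y i - y₀)
    (hb : n * pairBound C L < 1 / 2) (hf : ∀ i, f i ∈ testSpace (Fin 4))
    (hf₀ : f₀ ∈ testSpace (Fin 4)) {N : ℕ} (S : Finset (Fin N)) (ξ : Fin N → R3) (j : ℕ) :
    Integrable (fun p : (Fin j → R3) × ((Fin 4 → ℝ) × (Fin n → Source)) =>
        createdPart m c f y f₀ y₀ S ξ p.2 * annihilatedPart m c y y₀ p.1 p.2)
      ((shellMeasures m j).prod (volume.prod (sourceMeasures n))) := by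
  let B : ℝ := (∏ k ∈ S, Real.exp (-(y₀ * energy m (ξ k)))) *
    (∏ k ∈ Sᶜ, (Real.exp (-(y₀ * energy m (ξ k))) * (fieldConst * C))) * (fieldConst * C) ^ j
  have h1 : Integrable (fun η : Fin j → R3 => ∏ r, Real.exp (-(L * energy m (η r))))
      (shellMeasures m j) :=
    Integrable.fintype_prod (μ := fun _ : Fin j => shellMeasure m)
      (f := fun _ : Fin j => fun p => Real.exp (-(L * energy m p)))
      fun _ => integrable_exp_neg_energy m hL
  -- One power of the total amplitude comes from each of the `j` annihilated particles and from each
  -- spectator in `Sᶜ`.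
  have h2 := (integrable_comp_timeShift hf₀ y₀).norm.mul_prod
    (integrable_testBound_mul_exp_mul_pow hf y (pairBound_nonneg C L) hb (j + Sᶜ.card))
  refine ((h1.mul_prod h2).const_mul B).mono' ?_ (ae_of_all _ fun p => ?_)
  · have hm₀ := hf₀.1.continuous.measurable
    have hm := measurable_sourceWeight m c hf y
    unfold createdPart annihilatedPart
    refine Measurable.aestronglyMeasurable ?_
    refine Measurable.mul (Measurable.mul (Measurable.mul (hm₀.comp (by fun_prop))
      (hm.comp (by fun_prop))) (Measurable.mul ?_ ?_)) ?_
    · exact Finset.measurable_prod _ fun k _ => by fun_prop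
    · exact Finset.measurable_prod _ fun k _ => by fun_prop
    · exact Finset.measurable_prod _ fun k _ => by fun_prop
  · obtain ⟨η, x₀, w⟩ := p
    have hτ := totalAmp_nonneg w
    have e1 := norm_sourceWeight_le m f hC hL hsep w
    have e2 : ∏ k ∈ S, ‖planeWave m (ξ k) (timeShift y₀ x₀)‖ =
        ∏ k ∈ S, Real.exp (-(y₀ * energy m (ξ k))) :=
      Finset.prod_congr rfl fun k _ => norm_planeWave_timeShift _ _ _ _
    have e3 : ∏ k ∈ Sᶜ, ‖sourceField m c y w (ξ k)‖ ≤
        (∏ k ∈ Sᶜ, (Real.exp (-(y₀ * energy m (ξ k))) * (fieldConst * C))) *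
          totalAmp w ^ Sᶜ.card := by
      rw [← Finset.prod_const, ← Finset.prod_mul_distrib]
      refine Finset.prod_le_prod (fun _ _ => norm_nonneg _) fun k _ => ?_
      refine (norm_sourceField_le m hC (y₀ := y₀) (fun i => by linarith [hy i]) w _).trans_eq ?_
      ring
    have e4 : ∏ r, ‖(planeWave m (η r) (timeShift y₀ x₀))⁻¹ * sourceField m c y w (η r)‖ ≤
        (∏ r, Real.exp (-(L * energy m (η r)))) * ((fieldConst * C) ^ j * totalAmp w ^ j) := by
      rw [← mul_pow, ← Fin.prod_const, ← Finset.prod_mul_distrib]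
      exact Finset.prod_le_prod (fun _ _ => norm_nonneg _) fun r _ =>
        norm_inv_planeWave_mul_sourceField_le m hC hy w x₀ (η r)
    simp only [createdPart, annihilatedPart, norm_mul, norm_prod, e2] at e4 ⊢
    have p0 : 0 ≤ ∏ k ∈ S, Real.exp (-(y₀ * energy m (ξ k))) :=
      Finset.prod_nonneg fun _ _ => (Real.exp_pos _).le
    have p1 : 0 ≤ ∏ k ∈ Sᶜ, ‖sourceField m c y w (ξ k)‖ :=
      Finset.prod_nonneg fun _ _ => norm_nonneg _
    have p2 : 0 ≤ testBound f y w * Real.exp (pairBound C L * totalAmp w ^ 2) :=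
      mul_nonneg (testBound_nonneg f y w) (Real.exp_pos _).le
    have p3 : 0 ≤ ∏ r, (‖(planeWave m (η r) (timeShift y₀ x₀))⁻¹‖ * ‖sourceField m c y w (η r)‖) :=
      Finset.prod_nonneg fun _ _ => by positivity
    calc _ ≤ ‖f₀ (timeShift y₀ x₀)‖ *
          (testBound f y w * Real.exp (pairBound C L * totalAmp w ^ 2)) *
          ((∏ k ∈ S, Real.exp (-(y₀ * energy m (ξ k)))) *
          ((∏ k ∈ Sᶜ, (Real.exp (-(y₀ * energy m (ξ k))) * (fieldConst * C))) *
            totalAmp w ^ Sᶜ.card)) *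
          ((∏ r, Real.exp (-(L * energy m (η r)))) *
            ((fieldConst * C) ^ j * totalAmp w ^ j)) := by
            have p4 := p1.trans e3
            gcongr
      _ = _ := by
        simp only [B]
        rw [pow_add]
        ring

theorem integral_annihilatedPart (hL : 0 < L) (hy : ∀ i, L ≤ y i - y₀) (j : ℕ)
    (q : (Fin 4 → ℝ) × (Fin n → Source)) :
    ∫ η, annihilatedPart m c y y₀ η q ∂(shellMeasures m j) =
      ((fieldConst : ℂ)⁻¹ * contraction m c y q.2 (timeShift y₀ q.1)) ^ j := by
  unfold annihilatedPart
  rw [← integral_inv_planeWave_mul_sourceField m c (fun i => by linarith [hy i]) q.2 q.1]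
  have h := integral_fintype_prod_eq_pow (𝕜 := ℂ) (ι := Fin j) (μ := shellMeasure m)
    (fun η => (planeWave m η (timeShift y₀ q.1))⁻¹ * sourceField m c y q.2 η)
  simpa using h

end Step

/-- The `N`-particle function of a Wick power, divided by `l!`, applied to a superposition of
coherent vectors. -/
def wickState (m : ℝ) {n : ℕ} (c : Fin n → ℂ) (f : Fin n → (Fin 4 → ℂ) → ℂ) (y : Fin n → ℝ)
    (f₀ : (Fin 4 → ℂ) → ℂ) (y₀ : ℝ) (l N : ℕ) (ξ : Fin N → R3) : ℂ :=
  ∫ q : (Fin 4 → ℝ) × (Fin n → Source),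
    f₀ (timeShift y₀ q.1) * sourceWeight m c f y q.2 * (((Real.sqrt N.factorial)⁻¹ : ℝ) *
      wickPoly l (contraction m c y q.2 (timeShift y₀ q.1))
        (fun a => fieldConst * planeWave m (ξ a) (timeShift y₀ q.1))
        (fun a => sourceField m c y q.2 (ξ a))) ∂(volume.prod (sourceMeasures n))

section Step

variable {m : ℝ} {n : ℕ} {c : Fin n → ℂ} {f : Fin n → (Fin 4 → ℂ) → ℂ} {y : Fin n → ℝ}
  {C L y₀ : ℝ} {f₀ : (Fin 4 → ℂ) → ℂ}

/-- The Fourier transform of `f₀` is taken on the contour at `y₀`; its exponential then factors into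
inverse waves of annihilated and waves of created particles. -/
theorem wickIntegrand_eq_integral (hf₀ : f₀ ∈ testSpace (Fin 4)) {Φ : Fock m} {l N : ℕ}
    (S : Finset (Fin N)) (ξ : Fin N → R3) (η : Fin (l - S.card) → R3)
    (hη : component Φ ((l - S.card) + Sᶜ.card)
        (Fin.append η (fun i => ξ (Sᶜ.orderEmbOfFin rfl i))) =
      sourceState m c f y ((l - S.card) + Sᶜ.card)
        (Fin.append η (fun i => ξ (Sᶜ.orderEmbOfFin rfl i)))) :
    wickIntegrand m l f₀ Φ S ξ η = ((2 * (Real.pi : ℂ)) ^ 2)⁻¹ *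
      ((Real.sqrt ((l - S.card) + Sᶜ.card).factorial)⁻¹ : ℝ) *
      ∫ q, createdPart m c f y f₀ y₀ S ξ q * annihilatedPart m c y y₀ η q
        ∂(volume.prod (sourceMeasures n)) := by
  rw [wickIntegrand, hη, fourier4_eq_integral_timeShift hf₀ _ y₀, sourceState, mul_assoc,
    ← integral_prod_mul, mul_assoc,
    ← integral_const_mul _ (fun q => createdPart m c f y f₀ y₀ S ξ q * _)]
  congr 2
  funext q
  rw [exp_neg_minkowski_sub, Fin.prod_univ_add]
  simp only [Fin.append_left, Fin.append_right]
  rw [prod_comp_orderEmbOfFin Sᶜ (fun k => sourceField m c y q.2 (ξ k)), createdPart,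
    annihilatedPart, Finset.prod_mul_distrib]
  ring

theorem integrable_createdPart_mul_contraction (hC : ∀ i, ‖c i‖ ≤ C) (hL : 0 < L)
    (hsep : ∀ i k, i < k → L ≤ y k - y i) (hy : ∀ i, L ≤ y i - y₀)
    (hb : n * pairBound C L < 1 / 2) (hf : ∀ i, f i ∈ testSpace (Fin 4))
    (hf₀ : f₀ ∈ testSpace (Fin 4)) {N : ℕ} (S : Finset (Fin N)) (ξ : Fin N → R3) (j : ℕ) :
    Integrable (fun q => createdPart m c f y f₀ y₀ S ξ q *
        ((fieldConst : ℂ)⁻¹ * contraction m c y q.2 (timeShift y₀ q.1)) ^ j)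
      (volume.prod (sourceMeasures n)) := by
  have h := (integrable_createdPart_mul_annihilatedPart (m := m) hC hL hsep hy hb hf hf₀ S ξ
    j).integral_prod_right
  simpa only [integral_const_mul, integral_annihilatedPart hL hy] using h

theorem integrable_wickIntegrand_and_integral_eq (hC : ∀ i, ‖c i‖ ≤ C) (hL : 0 < L)
    (hsep : ∀ i k, i < k → L ≤ y k - y i) (hy : ∀ i, L ≤ y i - y₀)
    (hb : n * pairBound C L < 1 / 2) (hf : ∀ i, f i ∈ testSpace (Fin 4))
    (hf₀ : f₀ ∈ testSpace (Fin 4)) {Φ : Fock m} {l N : ℕ} (S : Finset (Fin N)) (ξ : Fin N → R3)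
    (hξ : ∀ᵐ η ∂(shellMeasures m (l - S.card)), component Φ ((l - S.card) + Sᶜ.card)
        (Fin.append η (fun i => ξ (Sᶜ.orderEmbOfFin rfl i))) =
      sourceState m c f y ((l - S.card) + Sᶜ.card)
        (Fin.append η (fun i => ξ (Sᶜ.orderEmbOfFin rfl i)))) :
    Integrable (wickIntegrand m l f₀ Φ S ξ) (shellMeasures m (l - S.card)) ∧
    ∫ η, wickIntegrand m l f₀ Φ S ξ η ∂(shellMeasures m (l - S.card)) =
      ((2 * (Real.pi : ℂ)) ^ 2)⁻¹ *
      ((Real.sqrt ((l - S.card) + Sᶜ.card).factorial)⁻¹ : ℝ) *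
      ∫ q, createdPart m c f y f₀ y₀ S ξ q *
        ((fieldConst : ℂ)⁻¹ * contraction m c y q.2 (timeShift y₀ q.1)) ^ (l - S.card)
        ∂(volume.prod (sourceMeasures n)) := by
  have hae : wickIntegrand m l f₀ Φ S ξ =ᵐ[shellMeasures m (l - S.card)] fun η =>
      ((2 * (Real.pi : ℂ)) ^ 2)⁻¹ *
      ((Real.sqrt ((l - S.card) + Sᶜ.card).factorial)⁻¹ : ℝ) *
      ∫ q, createdPart m c f y f₀ y₀ S ξ q * annihilatedPart m c y y₀ η q
        ∂(volume.prod (sourceMeasures n)) :=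
    hξ.mono fun η hη => wickIntegrand_eq_integral hf₀ S ξ η hη
  have hinteg := integrable_createdPart_mul_annihilatedPart (m := m) hC hL hsep hy hb hf hf₀ S ξ
    (l - S.card)
  refine ⟨(hinteg.integral_prod_left.const_mul _).congr hae.symm, ?_⟩
  rw [integral_congr_ae hae, integral_const_mul, integral_integral_swap hinteg]
  simp only [integral_const_mul, integral_annihilatedPart hL hy]

/-- Of the `l` factors `fieldConst`, `#S` belong to the created waves and the other `l - #S` cancel
the inverses attached to the contractions. -/
theorem wickPoly_integrand_eq (l N : ℕ) (ξ : Fin N → R3)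
    (q : (Fin 4 → ℝ) × (Fin n → Source)) :
    f₀ (timeShift y₀ q.1) * sourceWeight m c f y q.2 * (((Real.sqrt N.factorial)⁻¹ : ℝ) *
      wickPoly l (contraction m c y q.2 (timeShift y₀ q.1))
        (fun a => fieldConst * planeWave m (ξ a) (timeShift y₀ q.1))
        (fun a => sourceField m c y q.2 (ξ a))) =
    ∑ S : Finset (Fin N) with S.card ≤ l, (((Real.sqrt N.factorial)⁻¹ : ℝ) * fieldConst ^ l /
      ((l - S.card).factorial : ℂ)) * (createdPart m c f y f₀ y₀ S ξ q *
        ((fieldConst : ℂ)⁻¹ * contraction m c y q.2 (timeShift y₀ q.1)) ^ (l - S.card)) := by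
  have h0 : (fieldConst : ℂ) ≠ 0 := by exact_mod_cast fieldConst_pos.ne'
  rw [wickPoly, Finset.mul_sum, Finset.mul_sum]
  refine Finset.sum_congr rfl fun S hS => ?_
  have hS' : S.card ≤ l := (Finset.mem_filter.1 hS).2
  rw [createdPart, Finset.prod_mul_distrib, Finset.prod_const, mul_pow, inv_pow]
  have e : (fieldConst : ℂ) ^ l = fieldConst ^ (l - S.card) * fieldConst ^ S.card := by
    rw [← pow_add, Nat.sub_add_cancel hS']
  rw [e]
  field_simp

/-- Each of the `l` fields carries one `fieldConst`; the factor `(2π)²` undoes the normalization of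
`fourier4`. -/
theorem wick_normalization (l : ℕ) :
    ((Real.sqrt Real.pi ^ l * (2 * Real.pi) ^ 2 / (2 * Real.pi) ^ (2 * l) : ℝ) : ℂ) =
      (fieldConst : ℂ) ^ l * (2 * (Real.pi : ℂ)) ^ 2 := by
  rw [fieldConst, ← Complex.ofReal_pow, div_pow, ← pow_mul]
  push_cast
  ring

/-- A Wick power acts on a superposition of coherent vectors by `wickState`. -/
theorem ae_wickFormula_eq_wickState (hC : ∀ i, ‖c i‖ ≤ C) (hL : 0 < L)
    (hsep : ∀ i k, i < k → L ≤ y k - y i) (hy : ∀ i, L ≤ y i - y₀)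
    (hb : n * pairBound C L < 1 / 2) (hf : ∀ i, f i ∈ testSpace (Fin 4))
    (hf₀ : f₀ ∈ testSpace (Fin 4)) {Φ : Fock m}
    (hΦ : ∀ N, component Φ N =ᵐ[shellMeasures m N] sourceState m c f y N) (l N : ℕ) :
    ∀ᵐ ξ ∂(shellMeasures m N),
      (∀ S : Finset (Fin N), S.card ≤ l →
        Integrable (wickIntegrand m l f₀ Φ S ξ) (shellMeasures m (l - S.card))) ∧
      wickFormula m l f₀ Φ N ξ = l.factorial * wickState m c f y f₀ y₀ l N ξ := by
  have hae : ∀ᵐ ξ ∂(shellMeasures m N), ∀ S : Finset (Fin N),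
      ∀ᵐ η ∂(shellMeasures m (l - S.card)), component Φ ((l - S.card) + Sᶜ.card)
        (Fin.append η (fun i => ξ (Sᶜ.orderEmbOfFin rfl i))) =
      sourceState m c f y ((l - S.card) + Sᶜ.card)
        (Fin.append η (fun i => ξ (Sᶜ.orderEmbOfFin rfl i))) := by
    rw [ae_all_iff]
    intro S
    exact ae_ae_append_of_ae (shellMeasure m) _ (Sᶜ.orderEmbOfFin rfl).injective (hΦ _)
  filter_upwards [hae] with ξ hξ
  have key := fun S : Finset (Fin N) =>
    integrable_wickIntegrand_and_integral_eq (y₀ := y₀) hC hL hsep hy hb hf hf₀ S ξ (hξ S)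
  refine ⟨fun S _ => (key S).1, ?_⟩
  rw [wickFormula, wickState]
  simp only [wickPoly_integrand_eq]
  rw [integral_finsetSum _ fun S _ =>
    (integrable_createdPart_mul_contraction hC hL hsep hy hb hf hf₀ S ξ _).const_mul _,
    wick_normalization, Finset.mul_sum, Finset.mul_sum]
  refine Finset.sum_congr rfl fun S _ => ?_
  -- The factorial root in the numerator cancels the normalization of the coherent component of `Φ`;
  -- the one in the denominator is that of the resulting `N`-particle component.
  rw [integral_const_mul, (key S).2, Real.sqrt_div (Nat.cast_nonneg _)]
  have h1 : (Real.sqrt ((l - S.card) + Sᶜ.card).factorial : ℂ) ≠ 0 := by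
    have : (0 : ℝ) < ((l - S.card) + Sᶜ.card).factorial := by positivity
    exact_mod_cast (Real.sqrt_pos.2 this).ne'
  have h2 : (Real.pi : ℂ) ≠ 0 := by exact_mod_cast Real.pi_ne_zero
  push_cast
  field_simp

end Step

/-! ### The exponential series -/

theorem measurable_wickPoly {α : Type*} [MeasurableSpace α] {𝕜 : Type*} [RCLike 𝕜] {N : ℕ}
    (l : ℕ) {X : α → 𝕜} {a b : α → Fin N → 𝕜} (hX : Measurable X)
    (ha : ∀ k, Measurable fun u => a u k) (hb : ∀ k, Measurable fun u => b u k) :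
    Measurable (fun u => wickPoly l (X u) (a u) (b u)) := by
  unfold wickPoly
  refine Finset.measurable_sum _ fun S _ => Measurable.mul (by fun_prop) (Measurable.mul ?_ ?_)
  · exact Finset.measurable_prod _ fun k _ => ha k
  · exact Finset.measurable_prod _ fun k _ => hb k

/-- The integrand of the contribution of order `l` to the Wick exponential of a source with
coupling `c₀`, applied to a superposition of coherent vectors. -/
def expIntegrand (m : ℝ) {n : ℕ} (c₀ : ℂ) (c : Fin n → ℂ) (f₀ : (Fin 4 → ℂ) → ℂ)
    (f : Fin n → (Fin 4 → ℂ) → ℂ) (y₀ : ℝ) (y : Fin n → ℝ) (l N : ℕ) (ξ : Fin N → R3)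
    (p : Source × (Fin n → Source)) : ℂ :=
  f₀ (timeShift y₀ p.1.2) * sourceWeight m c f y p.2 * (((Real.sqrt N.factorial)⁻¹ : ℝ) *
    wickPoly l (c₀ * p.1.1 * contraction m c y p.2 (timeShift y₀ p.1.2))
      (fun a => c₀ * p.1.1 * (fieldConst * planeWave m (ξ a) (timeShift y₀ p.1.2)))
      (fun a => sourceField m c y p.2 (ξ a)))

/-- The contribution of order `l` to the Wick exponential. -/
def expState (m : ℝ) {n : ℕ} (c₀ : ℂ) (c : Fin n → ℂ) (f₀ : (Fin 4 → ℂ) → ℂ)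
    (f : Fin n → (Fin 4 → ℂ) → ℂ) (y₀ : ℝ) (y : Fin n → ℝ) (l N : ℕ) (ξ : Fin N → R3) : ℂ :=
  ∫ p, expIntegrand m c₀ c f₀ f y₀ y l N ξ p ∂(sourceMeasure.prod (sourceMeasures n))

/-- The bound of `expIntegrand`, up to the exponential decay in the momenta. -/
def expBound {n : ℕ} (C L : ℝ) (f₀ : (Fin 4 → ℂ) → ℂ) (f : Fin n → (Fin 4 → ℂ) → ℂ) (y₀ : ℝ)
    (y : Fin n → ℝ) (l N : ℕ) (p : Source × (Fin n → Source)) : ℝ :=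
  ‖f₀ (timeShift y₀ p.1.2)‖ *
    (testBound f y p.2 * Real.exp (pairBound C L * totalAmp p.2 ^ 2)) *
    ((Real.sqrt N.factorial)⁻¹ * wickPoly l (pairBound C L * (|p.1.1| * totalAmp p.2))
      (fun _ : Fin N => fieldConst * C * |p.1.1|) (fun _ => fieldConst * C * totalAmp p.2))

/-- The sum of `expBound` over all orders. -/
def expMajorant {n : ℕ} (C L : ℝ) (f₀ : (Fin 4 → ℂ) → ℂ) (f : Fin n → (Fin 4 → ℂ) → ℂ) (y₀ : ℝ)
    (y : Fin n → ℝ) (N : ℕ) (p : Source × (Fin n → Source)) : ℝ :=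
  ‖f₀ (timeShift y₀ p.1.2)‖ *
    (testBound f y p.2 * Real.exp (pairBound C L * totalAmp p.2 ^ 2)) *
    ((Real.sqrt N.factorial)⁻¹ * (Real.exp (pairBound C L * (|p.1.1| * totalAmp p.2)) *
      (fieldConst * C * (|p.1.1| + totalAmp p.2)) ^ N))

theorem hasSum_expBound {n : ℕ} (C L : ℝ) (f₀ : (Fin 4 → ℂ) → ℂ) (f : Fin n → (Fin 4 → ℂ) → ℂ)
    (y₀ : ℝ) (y : Fin n → ℝ) (N : ℕ) (p : Source × (Fin n → Source)) :
    HasSum (fun l => expBound C L f₀ f y₀ y l N p) (expMajorant C L f₀ f y₀ y N p) := by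
  have h := hasSum_wickPoly (pairBound C L * (|p.1.1| * totalAmp p.2))
    (fun _ : Fin N => fieldConst * C * |p.1.1|) (fun _ => fieldConst * C * totalAmp p.2)
  rw [← Real.exp_eq_exp_ℝ, Fin.prod_const, ← mul_add] at h
  exact (h.mul_left _).mul_left _

section Step

variable {m : ℝ} {n : ℕ} {c₀ : ℂ} {c : Fin n → ℂ} {f₀ : (Fin 4 → ℂ) → ℂ}
  {f : Fin n → (Fin 4 → ℂ) → ℂ} {y₀ : ℝ} {y : Fin n → ℝ} {C L : ℝ}

theorem expBound_nonneg (hC : 0 ≤ C) (l N : ℕ) (p : Source × (Fin n → Source)) :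
    0 ≤ expBound C L f₀ f y₀ y l N p := by
  have h1 := testBound_nonneg f y p.2
  have h2 := totalAmp_nonneg p.2
  have h3 := pairBound_nonneg C L
  have h4 := fieldConst_pos
  have h5 : 0 ≤ wickPoly l (pairBound C L * (|p.1.1| * totalAmp p.2))
      (fun _ : Fin N => fieldConst * C * |p.1.1|) (fun _ => fieldConst * C * totalAmp p.2) :=
    wickPoly_nonneg l (by positivity) (fun _ => by positivity) fun _ => by positivity
  unfold expBound
  positivity

theorem measurable_expBound (hf₀ : f₀ ∈ testSpace (Fin 4)) (hf : ∀ i, f i ∈ testSpace (Fin 4))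
    (l N : ℕ) : Measurable (expBound C L f₀ f y₀ y l N) := by
  have hm₀ := hf₀.1.continuous.measurable
  have hm := measurable_testBound hf y
  unfold expBound
  refine Measurable.mul (Measurable.mul (hm₀.comp (by fun_prop)).norm (by fun_prop))
    (Measurable.const_mul (measurable_wickPoly l (by fun_prop) (fun _ => by fun_prop)
      fun _ => by fun_prop) _)

theorem measurable_expMajorant (hf₀ : f₀ ∈ testSpace (Fin 4))
    (hf : ∀ i, f i ∈ testSpace (Fin 4)) (N : ℕ) : Measurable (expMajorant C L f₀ f y₀ y N) := by
  have hm₀ := hf₀.1.continuous.measurable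
  have hm := measurable_testBound hf y
  unfold expMajorant
  exact Measurable.mul (Measurable.mul (hm₀.comp (by fun_prop)).norm (by fun_prop)) (by fun_prop)

theorem measurable_expIntegrand (hf₀ : f₀ ∈ testSpace (Fin 4))
    (hf : ∀ i, f i ∈ testSpace (Fin 4)) (l N : ℕ) :
    Measurable fun r : (Fin N → R3) × (Source × (Fin n → Source)) =>
      expIntegrand m c₀ c f₀ f y₀ y l N r.1 r.2 := by
  have hm₀ := hf₀.1.continuous.measurable
  have hm := measurable_sourceWeight m c hf y
  unfold expIntegrand
  refine Measurable.mul (Measurable.mul (hm₀.comp (by fun_prop)) (hm.comp (by fun_prop)))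
    (Measurable.const_mul (measurable_wickPoly l (by fun_prop) (fun _ => by fun_prop)
      fun _ => by fun_prop) _)

/-- New wave and old source field both decay at least like `exp(-y₀ ω)`, so `wickPoly_prod_mul`
separates the momenta from the sources. -/
theorem norm_expIntegrand_le (hC₀ : ‖c₀‖ ≤ C) (hC : ∀ i, ‖c i‖ ≤ C) (hL : 0 < L)
    (hsep : ∀ i k, i < k → L ≤ y k - y i) (hy : ∀ i, L ≤ y i - y₀) (l N : ℕ)
    (ξ : Fin N → R3) (p : Source × (Fin n → Source)) :
    ‖expIntegrand m c₀ c f₀ f y₀ y l N ξ p‖ ≤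
      (∏ a, Real.exp (-(y₀ * energy m (ξ a)))) * expBound C L f₀ f y₀ y l N p := by
  have hC0 : 0 ≤ C := (norm_nonneg _).trans hC₀
  have h1 := norm_sourceWeight_le m f hC hL hsep p.2
  have h2 := norm_mul_contraction_le m hC hL hy hC₀ p.1 p.2
  have h3 := norm_wickPoly_le (N := N) l h2
    (a := fun a => c₀ * p.1.1 * (fieldConst * planeWave m (ξ a) (timeShift y₀ p.1.2)))
    (b := fun a => sourceField m c y p.2 (ξ a))
    (a' := fun a => Real.exp (-(y₀ * energy m (ξ a))) * (fieldConst * C * |p.1.1|))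
    (b' := fun a => Real.exp (-(y₀ * energy m (ξ a))) * (fieldConst * C * totalAmp p.2))
    (fun a => by
      rw [norm_mul, norm_mul, norm_mul, norm_planeWave_timeShift, Complex.norm_real,
        Complex.norm_real, Real.norm_of_nonneg fieldConst_pos.le, Real.norm_eq_abs]
      calc _ ≤ C * |p.1.1| * (fieldConst * Real.exp (-(y₀ * energy m (ξ a)))) := by
            have := fieldConst_pos
            gcongr
        _ = _ := by ring)
    (fun a => norm_sourceField_le m hC (fun i => by linarith [hy i]) p.2 (ξ a))
  rw [wickPoly_prod_mul] at h3
  have hs : 0 ≤ (Real.sqrt N.factorial)⁻¹ := by positivity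
  rw [expIntegrand, norm_mul, norm_mul, norm_mul, Complex.norm_real, Real.norm_of_nonneg hs]
  have h4 : 0 ≤ testBound f y p.2 * Real.exp (pairBound C L * totalAmp p.2 ^ 2) :=
    mul_nonneg (testBound_nonneg f y p.2) (Real.exp_pos _).le
  calc _ ≤ ‖f₀ (timeShift y₀ p.1.2)‖ *
        (testBound f y p.2 * Real.exp (pairBound C L * totalAmp p.2 ^ 2)) *
        ((Real.sqrt N.factorial)⁻¹ * ((∏ a, Real.exp (-(y₀ * energy m (ξ a)))) *
          wickPoly l (pairBound C L * (|p.1.1| * totalAmp p.2))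
            (fun _ : Fin N => fieldConst * C * |p.1.1|)
            (fun _ => fieldConst * C * totalAmp p.2))) := by gcongr
    _ = _ := by
      rw [expBound]
      ring

/-- With `b` the pair bound, `b τ² + b |t| τ ≤ b (|t| + τ)²`; the majorant is thus controlled by the
bound already available for `n + 1` sources. -/
theorem expMajorant_le (N : ℕ) (hC : 0 ≤ C) (p : Source × (Fin n → Source)) :
    expMajorant C L f₀ f y₀ y N p ≤
      testBound (Fin.cons f₀ f : Fin (n + 1) → (Fin 4 → ℂ) → ℂ) (Fin.cons y₀ y)
          (Fin.cons p.1 p.2) *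
        Real.exp (pairBound C L * totalAmp (Fin.cons p.1 p.2 : Fin (n + 1) → Source) ^ 2) *
        ((Real.sqrt N.factorial)⁻¹ *
          (fieldConst * C * totalAmp (Fin.cons p.1 p.2 : Fin (n + 1) → Source)) ^ N) := by
  have e1 : totalAmp (Fin.cons p.1 p.2 : Fin (n + 1) → Source) = |p.1.1| + totalAmp p.2 := by
    simp [totalAmp, Fin.sum_univ_succ]
  have e2 : testBound (Fin.cons f₀ f : Fin (n + 1) → (Fin 4 → ℂ) → ℂ) (Fin.cons y₀ y)
      (Fin.cons p.1 p.2) = ‖f₀ (timeShift y₀ p.1.2)‖ * testBound f y p.2 := by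
    simp [testBound, Fin.prod_univ_succ]
  rw [e1, e2, expMajorant]
  have h1 := testBound_nonneg f y p.2
  have h2 := totalAmp_nonneg p.2
  have h3 := pairBound_nonneg C L
  have h4 := fieldConst_pos
  have h5 : Real.exp (pairBound C L * totalAmp p.2 ^ 2) *
      Real.exp (pairBound C L * (|p.1.1| * totalAmp p.2)) ≤
      Real.exp (pairBound C L * (|p.1.1| + totalAmp p.2) ^ 2) := by
    rw [← Real.exp_add, Real.exp_le_exp, ← mul_add]
    gcongr
    nlinarith [abs_nonneg p.1.1, mul_nonneg (abs_nonneg p.1.1) h2]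
  calc _ = ‖f₀ (timeShift y₀ p.1.2)‖ * testBound f y p.2 *
        (Real.exp (pairBound C L * totalAmp p.2 ^ 2) *
          Real.exp (pairBound C L * (|p.1.1| * totalAmp p.2))) *
        ((Real.sqrt N.factorial)⁻¹ * (fieldConst * C * (|p.1.1| + totalAmp p.2)) ^ N) := by ring
    _ ≤ _ := by gcongr

theorem cons_mem_testSpace (hf₀ : f₀ ∈ testSpace (Fin 4)) (hf : ∀ i, f i ∈ testSpace (Fin 4))
    (i : Fin (n + 1)) :
    (Fin.cons f₀ f : Fin (n + 1) → (Fin 4 → ℂ) → ℂ) i ∈ testSpace (Fin 4) := by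
  refine Fin.cases ?_ (fun i => ?_) i
  · simpa using hf₀
  · simpa using hf i

theorem expMajorant_nonneg (hC : 0 ≤ C) (N : ℕ) (p : Source × (Fin n → Source)) :
    0 ≤ expMajorant C L f₀ f y₀ y N p :=
  (hasSum_expBound C L f₀ f y₀ y N p).nonneg fun l => expBound_nonneg hC l N p

theorem integrable_expMajorant (hC : 0 ≤ C) (hb : (n + 1 : ℕ) * pairBound C L < 1 / 2)
    (hf₀ : f₀ ∈ testSpace (Fin 4)) (hf : ∀ i, f i ∈ testSpace (Fin 4)) (N : ℕ) :
    Integrable (expMajorant C L f₀ f y₀ y N) (sourceMeasure.prod (sourceMeasures n)) := by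
  have h := ((integrable_pi_fin_succ_iff _ _ _).1 (integrable_testBound_mul_exp_mul_pow
    (cons_mem_testSpace hf₀ hf) (Fin.cons y₀ y) (pairBound_nonneg C L) hb N)).const_mul
      ((Real.sqrt N.factorial)⁻¹ * (fieldConst * C) ^ N)
  refine h.mono' (measurable_expMajorant hf₀ hf N).aestronglyMeasurable (ae_of_all _ fun p => ?_)
  rw [Real.norm_of_nonneg (expMajorant_nonneg hC N p)]
  refine (expMajorant_le N hC p).trans_eq ?_
  rw [mul_pow]
  ring

/-- Dominated convergence at fixed `ξ`. Summing `wickPoly` over all orders produces exactly the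
exponential and the shifted field of `sourceWeight_cons` and `sourceField_cons`. -/
theorem hasSum_expState (hC₀ : ‖c₀‖ ≤ C) (hC : ∀ i, ‖c i‖ ≤ C) (hL : 0 < L)
    (hsep : ∀ i k, i < k → L ≤ y k - y i) (hy : ∀ i, L ≤ y i - y₀)
    (hb : (n + 1 : ℕ) * pairBound C L < 1 / 2) (hf₀ : f₀ ∈ testSpace (Fin 4))
    (hf : ∀ i, f i ∈ testSpace (Fin 4)) (N : ℕ) (ξ : Fin N → R3) :
    HasSum (fun l => expState m c₀ c f₀ f y₀ y l N ξ)
      (sourceState m (Fin.cons c₀ c : Fin (n + 1) → ℂ) (Fin.cons f₀ f) (Fin.cons y₀ y) N ξ) := by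
  have hC0 : 0 ≤ C := (norm_nonneg _).trans hC₀
  have hsum := fun p => (hasSum_expBound C L f₀ f y₀ y N p).mul_left
    (∏ a, Real.exp (-(y₀ * energy m (ξ a))))
  rw [sourceState, integral_pi_fin_succ]
  refine hasSum_integral_of_dominated_convergence
    (fun l p => (∏ a, Real.exp (-(y₀ * energy m (ξ a)))) * expBound C L f₀ f y₀ y l N p)
    (fun l => ((measurable_expIntegrand hf₀ hf l N).comp
      (measurable_const.prodMk measurable_id)).aestronglyMeasurable)
    (fun l => ae_of_all _ fun p => norm_expIntegrand_le hC₀ hC hL hsep hy l N ξ p)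
    (ae_of_all _ fun p => (hsum p).summable) ?_ (ae_of_all _ fun p => ?_)
  · simp only [(hsum _).tsum_eq]
    exact (integrable_expMajorant hC0 hb hf₀ hf N).const_mul _
  · rw [sourceWeight_cons]
    simp only [sourceField_cons, Fin.cons_zero, Fin.cons_succ]
    have h := hasSum_wickPoly (c₀ * p.1.1 * contraction m c y p.2 (timeShift y₀ p.1.2))
      (fun a => c₀ * p.1.1 * (fieldConst * planeWave m (ξ a) (timeShift y₀ p.1.2)))
      (fun a => sourceField m c y p.2 (ξ a))
    rw [← Complex.exp_eq_exp_ℂ] at h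
    have h' := (h.mul_left (((Real.sqrt N.factorial)⁻¹ : ℝ) : ℂ)).mul_left
      (f₀ (timeShift y₀ p.1.2) * sourceWeight m c f y p.2)
    rw [mul_left_comm ((((Real.sqrt N.factorial)⁻¹ : ℝ) : ℂ)), ← mul_assoc] at h'
    exact h'

/-- By homogeneity the amplitude of the new source enters only as `t^l`, so its integral is a
Gaussian moment. -/
theorem expState_eq (l N : ℕ) (ξ : Fin N → R3) :
    expState m c₀ c f₀ f y₀ y l N ξ =
      c₀ ^ l * (∫ t : ℝ, (t : ℂ) ^ l ∂stdGauss) * wickState m c f y f₀ y₀ l N ξ := by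
  have h := measurePreserving_prodAssoc stdGauss (volume : Measure (Fin 4 → ℝ)) (sourceMeasures n)
  rw [mul_assoc, wickState, ← integral_prod_mul, ← integral_const_mul, ← h.integral_comp', expState]
  refine integral_congr_ae (ae_of_all _ fun p => ?_)
  simp only [expIntegrand, wickPoly_mul, mul_pow]
  have e1 : (MeasurableEquiv.prodAssoc p).1 = p.1.1 := rfl
  have e2 : (MeasurableEquiv.prodAssoc p).2.1 = p.1.2 := rfl
  have e3 : (MeasurableEquiv.prodAssoc p).2.2 = p.2 := rfl
  rw [e1, e2, e3]
  ring

/-- The odd moments drop out and the even ones give precisely the coefficients of the Wick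
exponential of `c₀² / 2` times `φ²`. -/
theorem hasSum_wickState (hC₀ : ‖c₀‖ ≤ C) (hC : ∀ i, ‖c i‖ ≤ C) (hL : 0 < L)
    (hsep : ∀ i k, i < k → L ≤ y k - y i) (hy : ∀ i, L ≤ y i - y₀)
    (hb : (n + 1 : ℕ) * pairBound C L < 1 / 2) (hf₀ : f₀ ∈ testSpace (Fin 4))
    (hf : ∀ i, f i ∈ testSpace (Fin 4)) (N : ℕ) (ξ : Fin N → R3) :
    HasSum (fun k : ℕ => (c₀ ^ 2 / 2) ^ k / (k.factorial : ℂ) *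
        (((2 * k).factorial : ℂ) * wickState m c f y f₀ y₀ (2 * k) N ξ))
      (sourceState m (Fin.cons c₀ c : Fin (n + 1) → ℂ) (Fin.cons f₀ f) (Fin.cons y₀ y) N ξ) := by
  have h := hasSum_expState (m := m) hC₀ hC hL hsep hy hb hf₀ hf N ξ
  have hinj : Function.Injective (fun k : ℕ => 2 * k) := fun i j hij => by simpa using hij
  rw [← hinj.hasSum_iff] at h
  · convert h using 2 with k
    simp only [Function.comp_apply]
    rw [expState_eq, integral_pow_even_stdGauss, pow_mul, div_pow]
    field_simp
  · intro l hl
    obtain ⟨k, hk | hk⟩ := Nat.even_or_odd' l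
    · exact absurd ⟨k, hk.symm⟩ hl
    · rw [expState_eq, hk, integral_pow_odd_stdGauss]
      simp

end Step

/-! ### Components of Fock vectors -/

/-- The `N`-particle component as a continuous linear map. -/
def componentCLM (m : ℝ) (N : ℕ) : Fock m →L[ℂ] Lp ℂ 2 (shellMeasures m N) :=
  (particleSpace m N).subtypeL.comp (lp.evalCLM ℂ (fun n : ℕ => particleSpace m n) 2 N)

theorem component_eq (m : ℝ) (Φ : Fock m) (N : ℕ) : component Φ N = componentCLM m N Φ := rfl

theorem component_smul_ae (m : ℝ) (a : ℂ) (Φ : Fock m) (N : ℕ) :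
    component (a • Φ) N =ᵐ[shellMeasures m N] fun ξ => a * component Φ N ξ := by
  simp only [component_eq, map_smul]
  exact Lp.coeFn_smul _ _

theorem component_sum_ae (m : ℝ) (a : ℕ → ℂ) (χ : ℕ → Fock m) (N K : ℕ) :
    component (∑ k ∈ Finset.range K, a k • χ k) N =ᵐ[shellMeasures m N]
      fun ξ => ∑ k ∈ Finset.range K, a k * component (χ k) N ξ := by
  induction K with
  | zero =>
    simp only [Finset.range_zero, Finset.sum_empty, component_eq, map_zero]
    exact Lp.coeFn_zero _ _ _
  | succ K ih =>
    simp only [Finset.sum_range_succ]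
    have h1 := Lp.coeFn_add (componentCLM m N (∑ k ∈ Finset.range K, a k • χ k))
      (componentCLM m N (a K • χ K))
    rw [← map_add] at h1
    filter_upwards [h1, ih, component_smul_ae m (a K) (χ K) N] with ξ e1 e2 e3
    rw [component_eq, e1, Pi.add_apply, ← component_eq, ← component_eq, e2, e3]

/-- Norm convergence gives almost everywhere convergence of each component along a subsequence,
which identifies its limit with the pointwise one. -/
theorem component_ae_eq_of_tendsto {m : ℝ} {Φ : ℕ → Fock m} {Ψ : Fock m}
    (h : Tendsto Φ atTop (𝓝 Ψ)) {N : ℕ} {g : ℕ → (Fin N → R3) → ℂ} {g' : (Fin N → R3) → ℂ}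
    (hg : ∀ K, component (Φ K) N =ᵐ[shellMeasures m N] g K)
    (hlim : ∀ ξ, Tendsto (fun K => g K ξ) atTop (𝓝 (g' ξ))) :
    component Ψ N =ᵐ[shellMeasures m N] g' := by
  have h1 : Tendsto (fun K => componentCLM m N (Φ K)) atTop (𝓝 (componentCLM m N Ψ)) :=
    ((componentCLM m N).continuous.tendsto Ψ).comp h
  obtain ⟨ns, hns, hae⟩ := (tendstoInMeasure_of_tendsto_Lp h1).exists_seq_tendsto_ae
  filter_upwards [hae, ae_all_iff.2 hg] with ξ e1 e2
  refine tendsto_nhds_unique e1 ?_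
  have : (fun i => (componentCLM m N (Φ (ns i)) : (Fin N → R3) → ℂ) ξ) = fun i => g (ns i) ξ :=
    funext fun i => e2 (ns i)
  rw [this]
  exact (hlim ξ).comp hns.tendsto_atTop

theorem component_of_isWickExpSqApply {m : ℝ} {n : ℕ} {c₀ : ℂ} {c : Fin n → ℂ}
    {f₀ : (Fin 4 → ℂ) → ℂ} {f : Fin n → (Fin 4 → ℂ) → ℂ} {y₀ : ℝ} {y : Fin n → ℝ} {C L : ℝ}
    (hC₀ : ‖c₀‖ ≤ C) (hC : ∀ i, ‖c i‖ ≤ C) (hL : 0 < L)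
    (hsep : ∀ i k, i < k → L ≤ y k - y i) (hy : ∀ i, L ≤ y i - y₀)
    (hb : (n + 1 : ℕ) * pairBound C L < 1 / 2) (hf₀ : f₀ ∈ testSpace (Fin 4))
    (hf : ∀ i, f i ∈ testSpace (Fin 4)) {Φ Ψ : Fock m}
    (hΦ : ∀ N, component Φ N =ᵐ[shellMeasures m N] sourceState m c f y N)
    (hΨ : IsWickExpSqApply m (c₀ ^ 2 / 2) f₀ Φ Ψ) (N : ℕ) :
    component Ψ N =ᵐ[shellMeasures m N] sourceState m (Fin.cons c₀ c : Fin (n + 1) → ℂ)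
      (Fin.cons f₀ f) (Fin.cons y₀ y) N := by
  obtain ⟨χ, hχ, hlim⟩ := hΨ
  have hb' : n * pairBound C L < 1 / 2 := by
    have := pairBound_nonneg C L
    push_cast at hb
    linarith
  refine component_ae_eq_of_tendsto hlim (fun K => ?_)
    (fun ξ => (hasSum_wickState hC₀ hC hL hsep hy hb hf₀ hf N ξ).tendsto_sum_nat)
  have h1 : ∀ᵐ ξ ∂(shellMeasures m N), ∀ k, component (χ k) N ξ =
      ((2 * k).factorial : ℂ) * wickState m c f y f₀ y₀ (2 * k) N ξ := by
    rw [ae_all_iff]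
    intro k
    filter_upwards [hχ k N, ae_wickFormula_eq_wickState (y₀ := y₀) hC hL hsep hy hb' hf hf₀ hΦ
      (2 * k) N] with ξ e1 e2
    rw [e1.2, e2.2]
  filter_upwards [component_sum_ae m (fun k => (c₀ ^ 2 / 2) ^ k / (k.factorial : ℂ)) χ N K, h1]
    with ξ e1 e2
  rw [e1]
  exact Finset.sum_congr rfl fun k _ => by rw [e2]

/-! ### Products of Wick exponentials -/

theorem isWickExpSqProduct_zero_iff {m : ℝ} {g : Fin 0 → ℂ} {f : Fin 0 → (Fin 4 → ℂ) → ℂ}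
    {Ψ : Fock m} : IsWickExpSqProduct m g f Ψ ↔ Ψ = vacuum m := by
  constructor
  · rintro ⟨V, h1, h2, -⟩
    rw [← h2, ← h1]
    rfl
  · rintro rfl
    exact ⟨fun _ => vacuum m, rfl, rfl, fun j => j.elim0⟩

theorem isWickExpSqProduct_succ_iff {m : ℝ} {n : ℕ} {g : Fin (n + 1) → ℂ}
    {f : Fin (n + 1) → (Fin 4 → ℂ) → ℂ} {Ψ : Fock m} :
    IsWickExpSqProduct m g f Ψ ↔ ∃ Φ : Fock m,
      IsWickExpSqProduct m (fun i => g i.succ) (fun i => f i.succ) Φ ∧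
        IsWickExpSqApply m (g 0) (f 0) Φ Ψ := by
  constructor
  · rintro ⟨V, h1, h2, h3⟩
    refine ⟨V 1, ⟨fun i => V i.succ, ?_, rfl, fun j => ?_⟩, ?_⟩
    · exact h1
    · exact h3 j.succ
    · have := h3 0
      rw [Fin.castSucc_zero, h2] at this
      exact this
  · rintro ⟨Φ, ⟨V, h1, h2, h3⟩, h⟩
    refine ⟨Fin.cons Ψ V, ?_, rfl, fun j => ?_⟩
    · rw [← Fin.succ_last, Fin.cons_succ, h1]
    · refine Fin.cases ?_ (fun i => ?_) j
      · rw [Fin.castSucc_zero, Fin.cons_zero, Fin.cons_succ, h2]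
        exact h
      · rw [← Fin.succ_castSucc, Fin.cons_succ, Fin.cons_succ]
        exact h3 i

theorem eq_of_component_ae_eq {m : ℝ} {Φ Ψ : Fock m}
    (h : ∀ N, component Φ N =ᵐ[shellMeasures m N] component Ψ N) : Φ = Ψ :=
  lp.ext (funext fun N => Subtype.ext (Lp.ext (h N)))

/-- The formula determines every term of the series almost everywhere. -/
theorem IsWickExpSqApply.unique {m : ℝ} {g : ℂ} {f : (Fin 4 → ℂ) → ℂ} {Φ Ψ Ψ' : Fock m}
    (h : IsWickExpSqApply m g f Φ Ψ) (h' : IsWickExpSqApply m g f Φ Ψ') : Ψ = Ψ' := by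
  obtain ⟨χ, hχ, hlim⟩ := h
  obtain ⟨χ', hχ', hlim'⟩ := h'
  have : χ = χ' := by
    funext k
    refine eq_of_component_ae_eq fun N => ?_
    filter_upwards [hχ k N, hχ' k N] with ξ e1 e2
    rw [e1.2, e2.2]
  subst this
  exact tendsto_nhds_unique hlim hlim'

theorem IsWickExpSqProduct.unique {m : ℝ} {n : ℕ} {g : Fin n → ℂ} {f : Fin n → (Fin 4 → ℂ) → ℂ}
    {Ψ Ψ' : Fock m} (h : IsWickExpSqProduct m g f Ψ) (h' : IsWickExpSqProduct m g f Ψ') :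
    Ψ = Ψ' := by
  induction n generalizing Ψ Ψ' with
  | zero => rw [isWickExpSqProduct_zero_iff.1 h, isWickExpSqProduct_zero_iff.1 h']
  | succ n ih =>
    obtain ⟨Φ, h1, h2⟩ := isWickExpSqProduct_succ_iff.1 h
    obtain ⟨Φ', h1', h2'⟩ := isWickExpSqProduct_succ_iff.1 h'
    rw [← ih h1 h1'] at h2'
    exact h2.unique h2'

theorem component_vacuum_ae (m : ℝ) (c : Fin 0 → ℂ) (f : Fin 0 → (Fin 4 → ℂ) → ℂ)
    (y : Fin 0 → ℝ) (N : ℕ) :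
    component (vacuum m) N =ᵐ[shellMeasures m N] sourceState m c f y N := by
  cases N with
  | zero =>
    have h1 : component (vacuum m) 0 = (memLp_one_zero m).toLp := by
      rw [component, vacuum, lp.single_apply_self]
    rw [h1]
    filter_upwards [(memLp_one_zero m).coeFn_toLp] with ξ hξ
    rw [hξ]
    simp [sourceState, sourceWeight, interaction, sourceMeasures, Measure.real]
  | succ N =>
    have h1 : component (vacuum m) (N + 1) =
        ((0 : Lp ℂ 2 (shellMeasures m (N + 1))) : (Fin (N + 1) → R3) → ℂ) := by
      rw [component, vacuum, lp.single_apply_ne _ _ _ (Nat.succ_ne_zero N)]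
      rfl
    rw [h1]
    filter_upwards [Lp.coeFn_zero ℂ 2 (shellMeasures m (N + 1))] with ξ hξ
    rw [hξ]
    simp [sourceState, sourceField]

/-- The components of a product of Wick exponentials applied to the vacuum, as integrals over any
sufficiently separated contours. -/
theorem component_of_isWickExpSqProduct {m : ℝ} {n : ℕ} {c : Fin n → ℂ}
    {f : Fin n → (Fin 4 → ℂ) → ℂ} {y : Fin n → ℝ} {C L : ℝ} (hC : ∀ i, ‖c i‖ ≤ C) (hL : 0 < L)
    (hsep : ∀ i k, i < k → L ≤ y k - y i) (hb : n * pairBound C L < 1 / 2)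
    (hf : ∀ i, f i ∈ testSpace (Fin 4)) {Ψ : Fock m}
    (hΨ : IsWickExpSqProduct m (fun i => c i ^ 2 / 2) f Ψ) (N : ℕ) :
    component Ψ N =ᵐ[shellMeasures m N] sourceState m c f y N := by
  induction n generalizing Ψ N with
  | zero =>
    rw [isWickExpSqProduct_zero_iff.1 hΨ]
    exact component_vacuum_ae m c f y N
  | succ n ih =>
    obtain ⟨Φ, h1, h2⟩ := isWickExpSqProduct_succ_iff.1 hΨ
    have hb' : n * pairBound C L < 1 / 2 := by
      have := pairBound_nonneg C L
      push_cast at hb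
      linarith
    have hsep' : ∀ i k : Fin n, i < k → L ≤ y k.succ - y i.succ := fun i k hik =>
      hsep _ _ (Fin.succ_lt_succ_iff.2 hik)
    have hΦ := fun N => ih (c := fun i => c i.succ) (f := fun i => f i.succ)
      (y := fun i => y i.succ) (fun i => hC _) hsep' hb' (fun i => hf _) h1 N
    have h := component_of_isWickExpSqApply (y₀ := y 0) (hC 0) (fun i => hC _) hL hsep'
      (fun i => hsep _ _ (Fin.succ_pos i)) hb (hf 0) (fun i => hf _) hΦ h2 N
    have e1 : (Fin.cons (c 0) fun i => c i.succ : Fin (n + 1) → ℂ) = c := Fin.cons_self_tail c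
    have e2 : (Fin.cons (f 0) fun i => f i.succ : Fin (n + 1) → (Fin 4 → ℂ) → ℂ) = f :=
      Fin.cons_self_tail f
    have e3 : (Fin.cons (y 0) fun i => y i.succ : Fin (n + 1) → ℝ) = y := Fin.cons_self_tail y
    rwa [e1, e2, e3] at h

/-! ### Existence of the products -/

/-- Symmetric functions are the common fixed points of the isometries permuting the momenta. The
resulting completeness lets absolutely convergent series converge in Fock space. -/
theorem isClosed_particleSpace (m : ℝ) (N : ℕ) :
    IsClosed (particleSpace m N : Set (Lp ℂ 2 (shellMeasures m N))) := by
  have h : (particleSpace m N : Set (Lp ℂ 2 (shellMeasures m N))) =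
      ⋂ σ : Equiv.Perm (Fin N), {g | Lp.compMeasurePreservingₗᵢ ℂ (fun ξ : Fin N → R3 => ξ ∘ σ)
        (measurePreserving_perm m σ) g = g} := by
    ext g
    simp only [Set.mem_iInter, Set.mem_ofPred_eq, SetLike.mem_coe]
    refine forall_congr' fun σ => ?_
    have e := Lp.coeFn_compMeasurePreserving g (measurePreserving_perm m σ)
    constructor
    · intro hg
      exact Lp.ext (e.trans hg)
    · intro hg
      have e' : (Lp.compMeasurePreserving (fun ξ : Fin N → R3 => ξ ∘ σ)
        (measurePreserving_perm m σ)) g = g := hg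
      rw [e'] at e
      exact e.symm
  rw [h]
  exact isClosed_iInter fun σ => isClosed_eq (LinearIsometry.continuous _) continuous_id

instance (m : ℝ) (N : ℕ) : CompleteSpace (particleSpace m N) :=
  (isClosed_particleSpace m N).completeSpace_coe

/-! ### Norm estimates for the terms of the Wick exponential -/

/-- The product of exponentials of the energies that dominates the momentum space functions. -/
def momentumDecay (m y₀ : ℝ) (N : ℕ) (ξ : Fin N → R3) : ℝ :=
  ∏ a, Real.exp (-(y₀ * energy m (ξ a)))

theorem momentumDecay_nonneg (m y₀ : ℝ) (N : ℕ) (ξ : Fin N → R3) : 0 ≤ momentumDecay m y₀ N ξ :=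
  Finset.prod_nonneg fun _ _ => (Real.exp_pos _).le

theorem momentumDecay_sq (m y₀ : ℝ) (N : ℕ) (ξ : Fin N → R3) :
    momentumDecay m y₀ N ξ ^ 2 = momentumDecay m (2 * y₀) N ξ := by
  rw [momentumDecay, momentumDecay, ← Finset.prod_pow]
  refine Finset.prod_congr rfl fun a _ => ?_
  rw [← Real.exp_nat_mul]
  congr 1
  push_cast
  ring

theorem integrable_momentumDecay (m : ℝ) {y₀ : ℝ} (hy₀ : 0 < y₀) (N : ℕ) :
    Integrable (momentumDecay m y₀ N) (shellMeasures m N) :=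
  Integrable.fintype_prod (μ := fun _ : Fin N => shellMeasure m)
    (f := fun _ : Fin N => fun p => Real.exp (-(y₀ * energy m p)))
    fun _ => integrable_exp_neg_energy m hy₀

theorem integral_momentumDecay_le (m : ℝ) {y₀ : ℝ} (hy₀ : 0 < y₀) (N : ℕ) :
    ∫ ξ, momentumDecay m y₀ N ξ ∂(shellMeasures m N) ≤ (shellConst / y₀ ^ 2) ^ N := by
  have h := integral_fintype_prod_eq_pow (𝕜 := ℝ) (ι := Fin N) (μ := shellMeasure m)
    (fun p => Real.exp (-(y₀ * energy m p)))
  rw [Fintype.card_fin] at h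
  unfold momentumDecay
  rw [h]
  exact pow_le_pow_left₀ (integral_nonneg fun _ => (Real.exp_pos _).le)
    (integral_exp_neg_energy_le m hy₀) N

theorem memLp_momentumDecay (m : ℝ) {y₀ : ℝ} (hy₀ : 0 < y₀) (N : ℕ) :
    MemLp (momentumDecay m y₀ N) 2 (shellMeasures m N) := by
  refine (memLp_two_iff_integrable_sq
    (integrable_momentumDecay m hy₀ N).aestronglyMeasurable).2 ?_
  simp only [momentumDecay_sq]
  exact integrable_momentumDecay m (by positivity) N

/-- Squaring doubles the decay rate, whence `2 * y₀`. -/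
theorem norm_toLp_momentumDecay_le (m : ℝ) {y₀ : ℝ} (hy₀ : 0 < y₀) (N : ℕ) :
    ‖(memLp_momentumDecay m hy₀ N).toLp‖ ≤ Real.sqrt (shellConst / (2 * y₀) ^ 2) ^ N := by
  have hs : 0 ≤ shellConst / (2 * y₀) ^ 2 := by
    have := shellConst_nonneg
    positivity
  have h1 : ‖(memLp_momentumDecay m hy₀ N).toLp‖ ^ 2 =
      ∫ ξ, momentumDecay m (2 * y₀) N ξ ∂(shellMeasures m N) := by
    rw [← real_inner_self_eq_norm_sq, L2.inner_def]
    refine integral_congr_ae ?_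
    filter_upwards [(memLp_momentumDecay m hy₀ N).coeFn_toLp] with ξ hξ
    rw [hξ, real_inner_self_eq_norm_sq, Real.norm_eq_abs, sq_abs, momentumDecay_sq]
  refine (abs_le_of_sq_le_sq' ?_ (by positivity)).2
  rw [h1, ← pow_mul, mul_comm N 2, pow_mul, Real.sq_sqrt hs]
  exact integral_momentumDecay_le m (by positivity) N

theorem exists_particleSpace_of_bound (m : ℝ) {y₀ : ℝ} (hy₀ : 0 < y₀) {N : ℕ}
    {g : (Fin N → R3) → ℂ} (hg : AEStronglyMeasurable g (shellMeasures m N))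
    (hsymm : ∀ (σ : Equiv.Perm (Fin N)) ξ, g (ξ ∘ σ) = g ξ) {D : ℝ} (hD : 0 ≤ D)
    (hbound : ∀ ξ, ‖g ξ‖ ≤ D * momentumDecay m y₀ N ξ) :
    ∃ v : particleSpace m N, ((v : Lp ℂ 2 (shellMeasures m N)) : (Fin N → R3) → ℂ)
      =ᵐ[shellMeasures m N] g ∧ ‖v‖ ≤ D * Real.sqrt (shellConst / (2 * y₀) ^ 2) ^ N := by
  have hmem : MemLp g 2 (shellMeasures m N) := by
    refine (memLp_momentumDecay m hy₀ N).of_le_mul (c := D) hg (ae_of_all _ fun ξ => ?_)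
    rw [Real.norm_of_nonneg (momentumDecay_nonneg m y₀ N ξ)]
    exact hbound ξ
  refine ⟨⟨hmem.toLp, fun σ => ?_⟩, hmem.coeFn_toLp, ?_⟩
  · have h1 := hmem.coeFn_toLp
    have h2 := (measurePreserving_perm m σ).quasiMeasurePreserving.ae h1
    filter_upwards [h1, h2] with ξ e1 e2
    rw [e2, e1, hsymm]
  · have h : ‖hmem.toLp‖ ≤ D * ‖(memLp_momentumDecay m hy₀ N).toLp‖ := ?_
    · exact h.trans (mul_le_mul_of_nonneg_left (norm_toLp_momentumDecay_le m hy₀ N) hD)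
    refine Lp.norm_le_mul_norm_of_ae_le_mul ?_
    filter_upwards [hmem.coeFn_toLp, (memLp_momentumDecay m hy₀ N).coeFn_toLp] with ξ e1 e2
    rw [e1, e2, Real.norm_of_nonneg (momentumDecay_nonneg m y₀ N ξ)]
    exact hbound ξ

/-- Summable norms are square summable: the sum of squares is at most the square of the sum. -/
theorem exists_fock_of_summable (m : ℝ) (v : ∀ N, particleSpace m N) {a : ℕ → ℝ}
    (ha : Summable a) (hv : ∀ N, ‖v N‖ ≤ a N) :
    ∃ Φ : Fock m, (∀ N, Φ N = v N) ∧ ‖Φ‖ ≤ ∑' N, a N := by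
  have ha0 : ∀ N, 0 ≤ a N := fun N => (norm_nonneg _).trans (hv N)
  have hfin : ∀ s : Finset ℕ, ∑ N ∈ s, ‖v N‖ ^ (2 : ENNReal).toReal ≤
      (∑' N, a N) ^ (2 : ENNReal).toReal := fun s => by
    simp only [ENNReal.toReal_ofNat, Real.rpow_two]
    calc ∑ N ∈ s, ‖v N‖ ^ 2 ≤ ∑ N ∈ s, a N ^ 2 :=
          Finset.sum_le_sum fun N _ => pow_le_pow_left₀ (norm_nonneg _) (hv N) 2
      _ ≤ (∑ N ∈ s, a N) ^ 2 := Finset.sum_sq_le_sq_sum_of_nonneg fun N _ => ha0 N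
      _ ≤ _ := pow_le_pow_left₀ (Finset.sum_nonneg fun N _ => ha0 N)
          (ha.sum_le_tsum s fun N _ => ha0 N) 2
  refine ⟨⟨v, memℓp_gen' hfin⟩, fun N => rfl, ?_⟩
  exact lp.norm_le_of_forall_sum_le (by simp) (tsum_nonneg ha0) hfin

/-- The square of a term is the product of `(2a²)^N / N!` and `2^{-N}`, so the term is at most their
sum; the two series add up to `exp(2a²) + 2`. -/
theorem sum_pow_div_sqrt_factorial_le (s : Finset ℕ) (a : ℝ) :
    ∑ N ∈ s, (Real.sqrt N.factorial)⁻¹ * a ^ N ≤ 3 * Real.exp (2 * a ^ 2) := by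
  have h1 : ∀ N : ℕ, (Real.sqrt N.factorial)⁻¹ * a ^ N ≤
      (2 * a ^ 2) ^ N / N.factorial + (1 / 2) ^ N := fun N => by
    have hf : (0 : ℝ) < N.factorial := by positivity
    have e1 : ((Real.sqrt N.factorial)⁻¹ * a ^ N) ^ 2 =
        ((2 * a ^ 2) ^ N / N.factorial) * (1 / 2) ^ N := by
      rw [mul_pow, inv_pow, Real.sq_sqrt hf.le, mul_pow, div_eq_mul_inv, mul_right_comm,
        mul_right_comm (2 ^ N), ← mul_pow]
      norm_num
      ring
    have e2 : 0 ≤ (2 * a ^ 2) ^ N / (N.factorial : ℝ) := by positivity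
    have e3 : (0 : ℝ) ≤ (1 / 2) ^ N := by positivity
    refine abs_le_of_sq_le_sq' ?_ (by positivity) |>.2
    rw [e1]
    nlinarith
  have h2 : HasSum (fun N : ℕ => (2 * a ^ 2) ^ N / N.factorial) (Real.exp (2 * a ^ 2)) := by
    rw [Real.exp_eq_exp_ℝ]
    exact NormedSpace.expSeries_div_hasSum_exp _
  have h3 : HasSum (fun N : ℕ => ((1 : ℝ) / 2) ^ N) 2 := hasSum_geometric_two
  refine (Finset.sum_le_sum fun N _ => h1 N).trans ?_
  have h4 := sum_le_hasSum s (fun N _ => by positivity) (h2.add h3)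
  have h5 : 1 ≤ Real.exp (2 * a ^ 2) := Real.one_le_exp (by positivity)
  linarith

section Existence

variable {m : ℝ} {n : ℕ} {c₀ : ℂ} {c : Fin n → ℂ} {f₀ : (Fin 4 → ℂ) → ℂ}
  {f : Fin n → (Fin 4 → ℂ) → ℂ} {y₀ : ℝ} {y : Fin n → ℝ} {C L : ℝ}

theorem integrable_expBound (hC : 0 ≤ C) (hb : (n + 1 : ℕ) * pairBound C L < 1 / 2)
    (hf₀ : f₀ ∈ testSpace (Fin 4)) (hf : ∀ i, f i ∈ testSpace (Fin 4)) (l N : ℕ) :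
    Integrable (expBound C L f₀ f y₀ y l N) (sourceMeasure.prod (sourceMeasures n)) := by
  refine (integrable_expMajorant (y₀ := y₀) (y := y) hC hb hf₀ hf N).mono'
    (measurable_expBound hf₀ hf l N).aestronglyMeasurable (ae_of_all _ fun p => ?_)
  rw [Real.norm_of_nonneg (expBound_nonneg hC l N p)]
  exact le_hasSum (hasSum_expBound C L f₀ f y₀ y N p) l fun j _ => expBound_nonneg hC j N p

theorem norm_expState_le (hC₀ : ‖c₀‖ ≤ C) (hC : ∀ i, ‖c i‖ ≤ C) (hL : 0 < L)
    (hsep : ∀ i k, i < k → L ≤ y k - y i) (hy : ∀ i, L ≤ y i - y₀)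
    (hb : (n + 1 : ℕ) * pairBound C L < 1 / 2) (hf₀ : f₀ ∈ testSpace (Fin 4))
    (hf : ∀ i, f i ∈ testSpace (Fin 4)) (l N : ℕ) (ξ : Fin N → R3) :
    ‖expState m c₀ c f₀ f y₀ y l N ξ‖ ≤
      (∫ p, expBound C L f₀ f y₀ y l N p ∂(sourceMeasure.prod (sourceMeasures n))) *
        momentumDecay m y₀ N ξ := by
  have hC0 : 0 ≤ C := (norm_nonneg _).trans hC₀
  rw [mul_comm, ← integral_const_mul]
  exact norm_integral_le_of_norm_le ((integrable_expBound hC0 hb hf₀ hf l N).const_mul _)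
    (ae_of_all _ fun p => norm_expIntegrand_le hC₀ hC hL hsep hy l N ξ p)

theorem stronglyMeasurable_expState (hf₀ : f₀ ∈ testSpace (Fin 4))
    (hf : ∀ i, f i ∈ testSpace (Fin 4)) (l N : ℕ) :
    StronglyMeasurable (expState m c₀ c f₀ f y₀ y l N) :=
  (measurable_expIntegrand hf₀ hf l N).stronglyMeasurable.integral_prod_right

theorem expState_comp_perm (l N : ℕ) (σ : Equiv.Perm (Fin N)) (ξ : Fin N → R3) :
    expState m c₀ c f₀ f y₀ y l N (ξ ∘ σ) = expState m c₀ c f₀ f y₀ y l N ξ := by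
  refine integral_congr_ae (ae_of_all _ fun p => ?_)
  exact congrArg (fun u => f₀ (timeShift y₀ p.1.2) * sourceWeight m c f y p.2 *
    (((Real.sqrt N.factorial)⁻¹ : ℝ) * u))
    (wickPoly_comp_perm l (c₀ * p.1.1 * contraction m c y p.2 (timeShift y₀ p.1.2))
      (fun a => c₀ * p.1.1 * (fieldConst * planeWave m (ξ a) (timeShift y₀ p.1.2)))
      (fun a => sourceField m c y p.2 (ξ a)) σ)

/-- Summing over the particle number costs a second factor `exp(b τ²)`, `b` the pair bound, because
`L ≤ y₀`. The doubled exponent is why existence needs the threshold `1/4` instead of `1/2`. -/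
theorem sum_expMajorant_le (hC : 0 ≤ C) (hL : 0 < L) (hy₀ : L ≤ y₀) (s : Finset ℕ)
    (p : Source × (Fin n → Source)) :
    ∑ N ∈ s, expMajorant C L f₀ f y₀ y N p * Real.sqrt (shellConst / (2 * y₀) ^ 2) ^ N ≤
      3 * (testBound (Fin.cons f₀ f : Fin (n + 1) → (Fin 4 → ℂ) → ℂ) (Fin.cons y₀ y)
          (Fin.cons p.1 p.2) *
        Real.exp (2 * pairBound C L *
          totalAmp (Fin.cons p.1 p.2 : Fin (n + 1) → Source) ^ 2)) := by
  set w : Fin (n + 1) → Source := Fin.cons p.1 p.2 with hw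
  set T := testBound (Fin.cons f₀ f : Fin (n + 1) → (Fin 4 → ℂ) → ℂ) (Fin.cons y₀ y) w with hT
  have hT0 : 0 ≤ T := testBound_nonneg _ _ _
  have hτ := totalAmp_nonneg w
  have hκ := fieldConst_pos
  have hsc := shellConst_nonneg
  set r := Real.sqrt (shellConst / (2 * y₀) ^ 2) with hr
  have hr0 : 0 ≤ r := Real.sqrt_nonneg _
  have hr2 : r ^ 2 = shellConst / (2 * y₀) ^ 2 := Real.sq_sqrt (by positivity)
  have h1 : ∀ N ∈ s, expMajorant C L f₀ f y₀ y N p * r ^ N ≤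
      T * Real.exp (pairBound C L * totalAmp w ^ 2) *
        ((Real.sqrt N.factorial)⁻¹ * (fieldConst * C * totalAmp w * r) ^ N) := fun N _ => by
    refine (mul_le_mul_of_nonneg_right (expMajorant_le N hC p) (by positivity)).trans_eq ?_
    rw [mul_pow _ r]
    ring
  refine (Finset.sum_le_sum h1).trans ?_
  rw [← Finset.mul_sum]
  refine (mul_le_mul_of_nonneg_left (sum_pow_div_sqrt_factorial_le s _)
    (by positivity)).trans ?_
  have h2 : 2 * (fieldConst * C * totalAmp w * r) ^ 2 ≤ pairBound C L * totalAmp w ^ 2 := by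
    have h3 : shellConst / (2 * y₀) ^ 2 ≤ shellConst / L ^ 2 / 2 := by
      rw [div_div]
      gcongr
      nlinarith
    calc 2 * (fieldConst * C * totalAmp w * r) ^ 2 =
        2 * (C ^ 2 * fieldConst ^ 2 * totalAmp w ^ 2) * (shellConst / (2 * y₀) ^ 2) := by
          rw [← hr2]
          ring
      _ ≤ 2 * (C ^ 2 * fieldConst ^ 2 * totalAmp w ^ 2) * (shellConst / L ^ 2 / 2) := by gcongr
      _ = _ := by
        rw [pairBound]
        ring
  calc T * Real.exp (pairBound C L * totalAmp w ^ 2) *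
        (3 * Real.exp (2 * (fieldConst * C * totalAmp w * r) ^ 2)) ≤
      T * Real.exp (pairBound C L * totalAmp w ^ 2) *
        (3 * Real.exp (pairBound C L * totalAmp w ^ 2)) := by gcongr
    _ = 3 * (T * (Real.exp (pairBound C L * totalAmp w ^ 2) *
        Real.exp (pairBound C L * totalAmp w ^ 2))) := by ring
    _ = _ := by
      rw [← Real.exp_add]
      congr 3
      ring

/-- A finite set of pairs is enlarged to the product of its projections; summing under the integral
first over orders, then over particle numbers, gives a bound independent of the set. -/
theorem summable_integral_expBound (hC : 0 ≤ C) (hL : 0 < L) (hy₀ : L ≤ y₀)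
    (hb : (n + 1 : ℕ) * pairBound C L < 1 / 4) (hf₀ : f₀ ∈ testSpace (Fin 4))
    (hf : ∀ i, f i ∈ testSpace (Fin 4)) :
    Summable fun q : ℕ × ℕ =>
      (∫ p, expBound C L f₀ f y₀ y q.1 q.2 p ∂(sourceMeasure.prod (sourceMeasures n))) *
        Real.sqrt (shellConst / (2 * y₀) ^ 2) ^ q.2 := by
  have hb0 := pairBound_nonneg C L
  have hb' : (n + 1 : ℕ) * pairBound C L < 1 / 2 := by linarith
  have hG := ((integrable_pi_fin_succ_iff _ _ _).1 (integrable_testBound_mul_exp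
    (cons_mem_testSpace hf₀ hf) (Fin.cons y₀ y) (b := 2 * pairBound C L) (by positivity)
    (by linarith))).const_mul 3
  refine summable_of_sum_le (c := ∫ p : Source × (Fin n → Source), 3 * (testBound
      (Fin.cons f₀ f : Fin (n + 1) → (Fin 4 → ℂ) → ℂ) (Fin.cons y₀ y) (Fin.cons p.1 p.2) *
        Real.exp (2 * pairBound C L * totalAmp (Fin.cons p.1 p.2 : Fin (n + 1) → Source) ^ 2))
      ∂(sourceMeasure.prod (sourceMeasures n)))
    (fun q => mul_nonneg (integral_nonneg fun p => expBound_nonneg hC _ _ p) (by positivity))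
    fun F => ?_
  · simp only [← integral_mul_const]
    rw [← integral_finsetSum _ fun q _ => (integrable_expBound hC hb' hf₀ hf _ _).mul_const _]
    refine integral_mono (integrable_finsetSum _ fun q _ =>
      (integrable_expBound hC hb' hf₀ hf _ _).mul_const _) hG fun p => ?_
    refine le_trans ?_ (sum_expMajorant_le hC hL hy₀ (F.image Prod.snd) p)
    refine (Finset.sum_le_sum_of_subset_of_nonneg Finset.subset_product fun q _ _ =>
      mul_nonneg (expBound_nonneg hC _ _ p) (by positivity)).trans ?_
    rw [Finset.sum_product_right]
    refine Finset.sum_le_sum fun N _ => ?_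
    dsimp only
    rw [← Finset.sum_mul]
    refine mul_le_mul_of_nonneg_right ?_ (by positivity)
    exact sum_le_hasSum _ (fun l _ => expBound_nonneg hC l N p)
      (hasSum_expBound C L f₀ f y₀ y N p)

/-- The contributions of all orders to the Wick exponential are Fock vectors with summable
norms. -/
theorem exists_fock_expState (hC₀ : ‖c₀‖ ≤ C) (hC : ∀ i, ‖c i‖ ≤ C) (hL : 0 < L) (hy₀ : L ≤ y₀)
    (hsep : ∀ i k, i < k → L ≤ y k - y i) (hy : ∀ i, L ≤ y i - y₀)
    (hb : (n + 1 : ℕ) * pairBound C L < 1 / 4) (hf₀ : f₀ ∈ testSpace (Fin 4))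
    (hf : ∀ i, f i ∈ testSpace (Fin 4)) :
    ∃ X : ℕ → Fock m, (∀ l N, component (X l) N =ᵐ[shellMeasures m N]
      expState m c₀ c f₀ f y₀ y l N) ∧ Summable fun l => ‖X l‖ := by
  have hC0 : 0 ≤ C := (norm_nonneg _).trans hC₀
  have hsum := summable_integral_expBound (y := y) hC0 hL hy₀ hb hf₀ hf
  have hb' : (n + 1 : ℕ) * pairBound C L < 1 / 2 := by linarith
  have hv : ∀ l N, ∃ v : particleSpace m N,
      ((v : Lp ℂ 2 (shellMeasures m N)) : (Fin N → R3) → ℂ) =ᵐ[shellMeasures m N]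
        expState m c₀ c f₀ f y₀ y l N ∧ ‖v‖ ≤
      (∫ p, expBound C L f₀ f y₀ y l N p ∂(sourceMeasure.prod (sourceMeasures n))) *
        Real.sqrt (shellConst / (2 * y₀) ^ 2) ^ N := fun l N =>
    exists_particleSpace_of_bound m (hL.trans_le hy₀)
      (stronglyMeasurable_expState hf₀ hf l N).aestronglyMeasurable
      (fun σ ξ => expState_comp_perm l N σ ξ) (integral_nonneg fun p => expBound_nonneg hC0 _ _ p)
      fun ξ => norm_expState_le hC₀ hC hL hsep hy hb' hf₀ hf l N ξ
  choose v hv1 hv2 using hv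
  have hX := fun l => exists_fock_of_summable m (v l) (hsum.prod_factor l) (hv2 l)
  choose X hX1 hX2 using hX
  refine ⟨X, fun l N => ?_, ?_⟩
  · rw [component, hX1]
    exact hv1 l N
  · exact Summable.of_nonneg_of_le (fun l => norm_nonneg _) hX2 hsum.prod

/-- The terms are built with the coupling `C` instead of `c₀`: dividing by `C^{2k}` yields the
individual Wick powers even if `c₀ = 0`, and `‖c₀ / C‖ ≤ 1` keeps the series summable. -/
theorem exists_isWickExpSqApply (hCpos : 0 < C) (hC₀ : ‖c₀‖ ≤ C) (hC : ∀ i, ‖c i‖ ≤ C)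
    (hL : 0 < L) (hy₀ : L ≤ y₀) (hsep : ∀ i k, i < k → L ≤ y k - y i) (hy : ∀ i, L ≤ y i - y₀)
    (hb : (n + 1 : ℕ) * pairBound C L < 1 / 4) (hf₀ : f₀ ∈ testSpace (Fin 4))
    (hf : ∀ i, f i ∈ testSpace (Fin 4)) {Φ : Fock m}
    (hΦ : ∀ N, component Φ N =ᵐ[shellMeasures m N] sourceState m c f y N) :
    ∃ Ψ : Fock m, IsWickExpSqApply m (c₀ ^ 2 / 2) f₀ Φ Ψ := by
  have hCC : (C : ℂ) ≠ 0 := by exact_mod_cast hCpos.ne'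
  have hb' : n * pairBound C L < 1 / 2 := by
    have := pairBound_nonneg C L
    push_cast at hb
    linarith
  obtain ⟨X, hX1, hX2⟩ := exists_fock_expState (m := m) (c₀ := (C : ℂ)) (C := C)
    (by rw [Complex.norm_real, Real.norm_of_nonneg hCpos.le]) hC hL hy₀ hsep hy hb hf₀ hf
  let χ : ℕ → Fock m := fun k => (2 ^ k * (k.factorial : ℂ) / (C : ℂ) ^ (2 * k)) • X (2 * k)
  have hsum : Summable fun k => ((c₀ ^ 2 / 2) ^ k / (k.factorial : ℂ)) • χ k := by
    have hinj : Function.Injective (fun k : ℕ => 2 * k) := fun i j hij => by simpa using hij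
    refine Summable.of_norm_bounded (hX2.comp_injective hinj) fun k => ?_
    simp only [χ, smul_smul, Function.comp_apply]
    have e : (c₀ ^ 2 / 2) ^ k / (k.factorial : ℂ) *
        (2 ^ k * (k.factorial : ℂ) / (C : ℂ) ^ (2 * k)) = (c₀ / C) ^ (2 * k) := by
      have hk : (k.factorial : ℂ) ≠ 0 := by exact_mod_cast k.factorial_ne_zero
      rw [div_pow, div_pow, pow_mul c₀]
      field_simp
    rw [e, norm_smul, norm_pow, norm_div, Complex.norm_real, Real.norm_of_nonneg hCpos.le]
    refine mul_le_of_le_one_left (norm_nonneg _) (pow_le_one₀ (by positivity) ?_)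
    rwa [div_le_one hCpos]
  refine ⟨_, χ, fun k N => ?_, hsum.hasSum.tendsto_sum_nat⟩
  filter_upwards [component_smul_ae m (2 ^ k * (k.factorial : ℂ) / (C : ℂ) ^ (2 * k)) (X (2 * k)) N,
    hX1 (2 * k) N, ae_wickFormula_eq_wickState (y₀ := y₀) hC hL hsep hy hb' hf hf₀ hΦ (2 * k) N]
    with ξ e1 e2 e3
  refine ⟨e3.1, ?_⟩
  have hk : (k.factorial : ℂ) ≠ 0 := by exact_mod_cast k.factorial_ne_zero
  rw [e3.2, e1, e2, expState_eq, integral_pow_even_stdGauss]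
  field_simp

end Existence

theorem exists_isWickExpSqProduct {m : ℝ} {n : ℕ} {c : Fin n → ℂ} {f : Fin n → (Fin 4 → ℂ) → ℂ}
    {C L : ℝ} (hCpos : 0 < C) (hC : ∀ i, ‖c i‖ ≤ C) (hL : 0 < L)
    (hb : n * pairBound C L < 1 / 4) (hf : ∀ i, f i ∈ testSpace (Fin 4)) :
    ∃ Ψ : Fock m, IsWickExpSqProduct m (fun i => c i ^ 2 / 2) f Ψ := by
  induction n with
  | zero => exact ⟨vacuum m, isWickExpSqProduct_zero_iff.2 rfl⟩
  | succ n ih =>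
    have hb' : n * pairBound C L < 1 / 4 := by
      have := pairBound_nonneg C L
      push_cast at hb
      linarith
    obtain ⟨Φ, hΦ⟩ := ih (c := fun i => c i.succ) (f := fun i => f i.succ) (fun i => hC _) hb'
      (fun i => hf _)
    -- Existence does not refer to contours, so any separated ones serve: the new operator sits at
    -- `L`, the earlier ones at `2L, 3L, …`.
    let y : Fin n → ℝ := fun i => L * ((i : ℕ) + 2)
    have hsep : ∀ i k : Fin n, i < k → L ≤ y k - y i := fun i k hik => by
      have h : ((i : ℕ) : ℝ) + 1 ≤ (k : ℕ) := by exact_mod_cast Fin.lt_def.1 hik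
      simp only [y]
      nlinarith
    have hcomp := fun N => component_of_isWickExpSqProduct (fun i => hC _) hL hsep
      (by linarith) (fun i => hf _) hΦ N
    obtain ⟨Ψ, hΨ⟩ := exists_isWickExpSqApply (c₀ := c 0) (f₀ := f 0) (y₀ := L) hCpos (hC 0)
      (fun i => hC _) hL le_rfl hsep (fun i => by
        have h : (0 : ℝ) ≤ (i : ℕ) := Nat.cast_nonneg _
        simp only [y]
        nlinarith) hb (hf 0) (fun i => hf _) hcomp
    exact ⟨Ψ, isWickExpSqProduct_succ_iff.2 ⟨Φ, hΦ, hΨ⟩⟩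

/-! ### The determinant on the contours -/

/-- The coupling `c` with `c² / 2 = -r i l²`. -/
def coupling (l : ℝ) (r : ℤ) : ℂ := Complex.I * (Real.sqrt 2 : ℝ) * l * phase r

theorem phase_sq {r : ℤ} (hr : r = 1 ∨ r = -1) : phase r ^ 2 = Complex.I * r := by
  rw [phase, ← Complex.exp_nat_mul]
  rcases hr with rfl | rfl
  · rw [show ((2 : ℕ) : ℂ) * (Complex.I * ((1 : ℤ) : ℂ) * Real.pi / 4) =
      Real.pi / 2 * Complex.I by push_cast; ring, Complex.exp_pi_div_two_mul_I]
    simp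
  · rw [show ((2 : ℕ) : ℂ) * (Complex.I * ((-1 : ℤ) : ℂ) * Real.pi / 4) =
      -Real.pi / 2 * Complex.I by push_cast; ring, Complex.exp_neg_pi_div_two_mul_I]
    simp

theorem norm_phase (r : ℤ) : ‖phase r‖ = 1 := by
  rw [phase, show Complex.I * (r : ℂ) * Real.pi / 4 = ((r * Real.pi / 4 : ℝ) : ℂ) * Complex.I by
    push_cast; ring]
  exact Complex.norm_exp_ofReal_mul_I _

theorem ofReal_sqrt_two_sq : ((Real.sqrt 2 : ℝ) : ℂ) ^ 2 = 2 := by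
  rw [← Complex.ofReal_pow, Real.sq_sqrt two_pos.le]
  norm_num

theorem coupling_sq_div_two (l : ℝ) {r : ℤ} (hr : r = 1 ∨ r = -1) :
    coupling l r ^ 2 / 2 = -(r : ℂ) * Complex.I * (l : ℂ) ^ 2 := by
  rw [coupling, mul_pow, mul_pow, mul_pow, phase_sq hr, Complex.I_sq, ofReal_sqrt_two_sq]
  ring

theorem coupling_mul_coupling (l : ℝ) (r s : ℤ) :
    coupling l r * coupling l s = -(2 * phase r * phase s * (l : ℂ) ^ 2) := by
  rw [coupling, coupling]
  linear_combination (Complex.I ^ 2 * (l : ℂ) ^ 2 * phase r * phase s) * ofReal_sqrt_two_sq +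
    2 * (l : ℂ) ^ 2 * phase r * phase s * Complex.I_sq

theorem norm_coupling (l : ℝ) (r : ℤ) : ‖coupling l r‖ = Real.sqrt 2 * |l| := by
  simp [coupling, norm_phase, abs_of_nonneg (Real.sqrt_nonneg 2)]

theorem contour_apply {n : ℕ} (y : Fin n → ℝ) (x : Fin n → Fin 4 → ℝ) (j : Fin n) :
    contour y x j = timeShift (y j) (x j) := rfl

theorem vevMatrix_diag (m l : ℝ) {n : ℕ} (r : Fin n → ℤ) (z : Fin n → Fin 4 → ℂ) (j : Fin n) :
    vevMatrix m l r z j j = 1 := by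
  simp [vevMatrix]

theorem vevMatrix_isSymm (m l : ℝ) {n : ℕ} (r : Fin n → ℤ) (z : Fin n → Fin 4 → ℂ) :
    (vevMatrix m l r z).IsSymm := by
  refine Matrix.IsSymm.ext fun i j => ?_
  simp only [vevMatrix, Matrix.of_apply, eq_comm (a := j), min_comm j, max_comm j]
  split_ifs
  · rfl
  · ring

theorem vevMatrix_of_lt (m l : ℝ) {n : ℕ} (r : Fin n → ℤ) (z : Fin n → Fin 4 → ℂ) {j k : Fin n}
    (h : j < k) :
    vevMatrix m l r z j k = -(coupling l (r j) * coupling l (r k) * twoPoint m (z j - z k)) := by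
  rw [coupling_mul_coupling]
  simp only [vevMatrix, Matrix.of_apply, if_neg h.ne, min_eq_left h.le, max_eq_right h.le]
  ring

theorem norm_vevMatrix_le {m l : ℝ} {n : ℕ} {r : Fin n → ℤ} {y : Fin n → ℝ} {C L : ℝ}
    (hC : ∀ j, ‖coupling l (r j)‖ ≤ C) (hL : 0 < L) (hsep : ∀ i k, i < k → L ≤ y k - y i)
    (x : Fin n → Fin 4 → ℝ) (j k : Fin n) (hjk : j ≠ k) :
    ‖vevMatrix m l r (contour y x) j k‖ ≤ pairBound C L := by
  wlog h : j < k generalizing j k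
  · rw [(vevMatrix_isSymm m l r (contour y x)).apply k j]
    exact this k j hjk.symm (lt_of_le_of_ne (not_lt.1 h) hjk.symm)
  rw [vevMatrix_of_lt m l r _ h, norm_neg, norm_mul, norm_mul, contour_apply, contour_apply,
    pairBound]
  have h1 := hC j
  have h2 := hC k
  have h3 := norm_twoPoint_le m hL (hsep j k h) (x j) (x k)
  have h4 : 0 ≤ C := (norm_nonneg _).trans h1
  rw [sq]
  gcongr

theorem sum_sum_ite_ne_eq {n : ℕ} (B : Fin n → Fin n → ℂ) (hB : ∀ i j, B j i = B i j) :
    ∑ i, ∑ j, (if i = j then 0 else B i j) = 2 * ∑ i, ∑ j, (if i < j then B i j else 0) := by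
  have h : ∀ i j, (if i = j then 0 else B i j) =
      (if i < j then B i j else 0) + (if j < i then B j i else 0) := fun i j => by
    rcases lt_trichotomy i j with h | h | h
    · simp [h, h.ne, h.not_gt]
    · simp [h]
    · simp [h, h.ne', h.not_gt, hB]
  simp only [h, Finset.sum_add_distrib]
  rw [Finset.sum_comm (f := fun i j => if j < i then B j i else 0)]
  ring

/-- By `coupling_mul_coupling` each pair contributes `-a_jk t_j t_k`, half of what the symmetric
off-diagonal part contributes, and the unit diagonal cancels `∑ t_i²`. -/
theorem interaction_eq_quadForm (m l : ℝ) {n : ℕ} (r : Fin n → ℤ) (y : Fin n → ℝ) (t : Fin n → ℝ)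
    (x : Fin n → Fin 4 → ℝ) :
    interaction m (fun j => coupling l (r j)) y (fun j => (t j, x j)) =
      (∑ i, (t i : ℂ) ^ 2 - quadForm (vevMatrix m l r (contour y x)) t) / 2 := by
  set A := vevMatrix m l r (contour y x) with hA
  have e1 : ∑ i, (t i : ℂ) ^ 2 - quadForm A t =
      ∑ i, ∑ j, (if i = j then 0 else -(A i j * t i * t j)) := by
    rw [quadForm, ← Finset.sum_sub_distrib]
    refine Finset.sum_congr rfl fun i _ => ?_
    have e : ∀ j, (if i = j then 0 else -(A i j * t i * t j)) =
        (if i = j then (t i : ℂ) ^ 2 else 0) - A i j * t i * t j := fun j => by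
      split_ifs with h
      · subst h
        rw [hA, vevMatrix_diag]
        ring
      · ring
    simp only [e, Finset.sum_sub_distrib, Finset.sum_ite_eq, Finset.mem_univ, if_true]
  have hs : ∀ i j, A j i = A i j := (vevMatrix_isSymm m l r (contour y x)).apply
  rw [e1, sum_sum_ite_ne_eq (fun i j => -(A i j * t i * t j)) fun i j => by
    rw [hs i j]
    ring, mul_div_cancel_left₀ _ two_ne_zero, interaction]
  refine Finset.sum_congr rfl fun i _ => Finset.sum_congr rfl fun j _ => ?_
  split_ifs with h
  · rw [hA, vevMatrix_of_lt m l r _ h, contour_apply, contour_apply]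
    ring
  · rfl

section Determinant

variable {m l : ℝ} {n : ℕ} {r : Fin n → ℤ} {y : Fin n → ℝ} {C L : ℝ}

theorem norm_det_vevMatrix_sub_one_le (hC : ∀ j, ‖coupling l (r j)‖ ≤ C) (hL : 0 < L)
    (hsep : ∀ i k, i < k → L ≤ y k - y i) (hb1 : pairBound C L ≤ 1)
    (hbf : n.factorial * pairBound C L ≤ 1 / 2) (x : Fin n → Fin 4 → ℝ) :
    ‖(vevMatrix m l r (contour y x)).det - 1‖ ≤ 1 / 2 :=
  (norm_det_sub_one_le _ (pairBound_nonneg C L) hb1 (vevMatrix_diag m l r _)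
    (norm_vevMatrix_le hC hL hsep x)).trans hbf

theorem norm_det_vevMatrix_cpow_le (hC : ∀ j, ‖coupling l (r j)‖ ≤ C) (hL : 0 < L)
    (hsep : ∀ i k, i < k → L ≤ y k - y i) (hb1 : pairBound C L ≤ 1)
    (hbf : n.factorial * pairBound C L ≤ 1 / 2) (x : Fin n → Fin 4 → ℝ) :
    ‖(vevMatrix m l r (contour y x)).det ^ (-(1 / 2) : ℂ)‖ ≤ (1 / 2 : ℝ) ^ (-(1 / 2) : ℝ) := by
  have h := norm_det_vevMatrix_sub_one_le (m := m) hC hL hsep hb1 hbf x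
  set d := (vevMatrix m l r (contour y x)).det
  have h1 : 1 / 2 ≤ ‖d‖ := by
    have := norm_sub_norm_le (1 : ℂ) d
    rw [norm_sub_rev, norm_one] at this
    linarith
  have e : (-(1 / 2) : ℂ) = ((-(1 / 2) : ℝ) : ℂ) := by push_cast; rfl
  rw [e, Complex.norm_cpow_real]
  exact Real.rpow_le_rpow_of_nonpos (by norm_num) h1 (by norm_num)

theorem measurable_det_vevMatrix_cpow :
    Measurable fun x => (vevMatrix m l r (contour y x)).det ^ (-(1 / 2) : ℂ) := by
  refine Measurable.pow_const ?_ _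
  simp only [Matrix.det_apply]
  refine Finset.measurable_sum _ fun σ _ => Measurable.const_smul ?_ _
  refine Finset.measurable_prod _ fun i _ => ?_
  simp only [vevMatrix, Matrix.of_apply, contour_apply]
  split_ifs
  · fun_prop
  · refine Measurable.const_mul ((measurable_twoPoint m).comp ?_) _
    exact Measurable.sub (by fun_prop) (by fun_prop)

theorem norm_le_norm_contour (x : Fin n → Fin 4 → ℝ) :
    ‖x‖ ≤ ‖fun a : Fin n × Fin 4 => contour y x a.1 a.2‖ := by
  refine (pi_norm_le_iff_of_nonneg (norm_nonneg _)).2 fun j =>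
    (pi_norm_le_iff_of_nonneg (norm_nonneg _)).2 fun μ => ?_
  refine le_trans ?_ (norm_le_pi_norm _ (j, μ))
  rw [Real.norm_eq_abs, contour_apply, ← re_timeShift (y j) (x j) μ]
  exact Complex.abs_re_le_norm _

/-- One order serves two purposes: integrability over `4n` real dimensions and a tube containing the
contour. -/
theorem exists_order_contour (y : Fin n → ℝ) :
    ∃ k : ℕ, n * 4 < k ∧ ∀ (x : Fin n → Fin 4 → ℝ) (a : Fin n × Fin 4),
      |(contour y x a.1 a.2).im| ≤ k := by
  obtain ⟨k, hk⟩ := exists_nat_ge (∑ j, |y j|)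
  refine ⟨k + (n * 4 + 1), by omega, fun x a => ?_⟩
  rw [contour_apply, im_timeShift]
  push_cast
  have h1 : |y a.1| ≤ ∑ j, |y j| :=
    Finset.single_le_sum (f := fun j => |y j|) (fun j _ => abs_nonneg _) (Finset.mem_univ a.1)
  have h2 : (0 : ℝ) ≤ n * 4 + 1 := by positivity
  split_ifs
  · linarith
  · rw [abs_zero]
    positivity

theorem integrable_order {k : ℕ} (hk : n * 4 < k) :
    Integrable fun x : Fin n → Fin 4 → ℝ => ((1 + ‖x‖) ^ k)⁻¹ :=
  integrable_inv_one_add_norm_pow (E := Fin n → Fin 4 → ℝ) volume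
    (by simpa [Module.finrank_pi_fintype] using hk)

theorem norm_detIntegrand_le (hC : ∀ j, ‖coupling l (r j)‖ ≤ C) (hL : 0 < L)
    (hsep : ∀ i k, i < k → L ≤ y k - y i) (hb1 : pairBound C L ≤ 1)
    (hbf : n.factorial * pairBound C L ≤ 1 / 2) {k : ℕ}
    (hk : ∀ (x : Fin n → Fin 4 → ℝ) (a : Fin n × Fin 4), |(contour y x a.1 a.2).im| ≤ k)
    {F : (Fin n × Fin 4 → ℂ) → ℂ} {B : ℝ} (hF : SeminormLE k B F) (x : Fin n → Fin 4 → ℝ) :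
    ‖detIntegrand m l r y F x‖ ≤ (1 / 2 : ℝ) ^ (-(1 / 2) : ℝ) * B * ((1 + ‖x‖) ^ k)⁻¹ := by
  have hB : 0 ≤ B := le_trans (by positivity) (hF 0 (by simp))
  have h1 := hF _ (hk x)
  have h2 := norm_le_norm_contour (y := y) x
  have h3 : ‖F fun a => contour y x a.1 a.2‖ ≤ B * ((1 + ‖x‖) ^ k)⁻¹ := by
    rw [← div_eq_mul_inv, le_div_iff₀' (by positivity)]
    refine le_trans ?_ h1
    gcongr
  rw [detIntegrand, norm_mul, mul_assoc]
  exact mul_le_mul (norm_det_vevMatrix_cpow_le hC hL hsep hb1 hbf x) h3 (norm_nonneg _)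
    (by positivity)

theorem continuous_contour (y : Fin n → ℝ) :
    Continuous fun (x : Fin n → Fin 4 → ℝ) (a : Fin n × Fin 4) => contour y x a.1 a.2 := by
  refine continuous_pi fun a => ?_
  unfold contour
  fun_prop

theorem integrable_detIntegrand (hC : ∀ j, ‖coupling l (r j)‖ ≤ C) (hL : 0 < L)
    (hsep : ∀ i k, i < k → L ≤ y k - y i) (hb1 : pairBound C L ≤ 1)
    (hbf : n.factorial * pairBound C L ≤ 1 / 2) {F : (Fin n × Fin 4 → ℂ) → ℂ}
    (hF : F ∈ testSpace (Fin n × Fin 4)) : Integrable (detIntegrand m l r y F) := by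
  obtain ⟨k, hk, hk'⟩ := exists_order_contour y
  obtain ⟨B, hB⟩ := hF.2 k
  refine ((integrable_order hk).const_mul _).mono' ?_
    (ae_of_all _ fun x => norm_detIntegrand_le hC hL hsep hb1 hbf hk' hB x)
  exact (measurable_det_vevMatrix_cpow.mul
    (hF.1.continuous.comp (continuous_contour y)).measurable).aestronglyMeasurable

theorem isTemperedUltrahyperfunction_detFunctional (hC : ∀ j, ‖coupling l (r j)‖ ≤ C)
    (hL : 0 < L) (hsep : ∀ i k, i < k → L ≤ y k - y i) (hb1 : pairBound C L ≤ 1)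
    (hbf : n.factorial * pairBound C L ≤ 1 / 2) :
    IsTemperedUltrahyperfunction (detFunctional m l r y) := by
  refine ⟨⟨fun F G => ?_, fun a F => ?_⟩, ?_⟩
  · simp only [detFunctional]
    rw [← integral_add (integrable_detIntegrand hC hL hsep hb1 hbf F.2)
      (integrable_detIntegrand hC hL hsep hb1 hbf G.2)]
    congr 1
    funext x
    simp only [detIntegrand, Submodule.coe_add, Pi.add_apply]
    ring
  · simp only [detFunctional, smul_eq_mul]
    rw [← integral_const_mul]
    congr 1
    funext x
    simp only [detIntegrand, Submodule.coe_smul, Pi.smul_apply, smul_eq_mul]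
    ring
  · obtain ⟨k, hk, hk'⟩ := exists_order_contour y
    refine ⟨k, (1 / 2 : ℝ) ^ (-(1 / 2) : ℝ) *
      ∫ x : Fin n → Fin 4 → ℝ, ((1 + ‖x‖) ^ k)⁻¹, fun F _ B hB => ?_⟩
    refine (norm_integral_le_of_norm_le ((integrable_order hk).const_mul _)
      (ae_of_all _ fun x => norm_detIntegrand_le hC hL hsep hb1 hbf hk' hB x)).trans_eq ?_
    rw [integral_const_mul]
    ring

/-! ### The vacuum expectation value -/

/-- The space `Fin 0 → R3` is a single point of mass one, so almost everywhere equality is equality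
there. -/
theorem inner_vacuum_eq {g : (Fin 0 → R3) → ℂ} {Ψ : Fock m}
    (hΨ : component Ψ 0 =ᵐ[shellMeasures m 0] g) (ξ : Fin 0 → R3) :
    inner ℂ (vacuum m) Ψ = g ξ := by
  rw [vacuum, lp.inner_single_left, Submodule.coe_inner, L2.inner_def]
  have h : ∀ᵐ ζ ∂(shellMeasures m 0), inner ℂ
      (MemLp.toLp _ (memLp_one_zero m) ζ)
      ((Ψ 0 : Lp ℂ 2 (shellMeasures m 0)) ζ) = g ξ := by
    filter_upwards [(memLp_one_zero m).coeFn_toLp, hΨ] with ζ e1 e2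
    have e3 : ((Ψ 0 : Lp ℂ 2 (shellMeasures m 0)) ζ) = g ζ := e2
    rw [e1, e3, Subsingleton.elim ζ ξ]
    simp
  rw [integral_congr_ae h]
  simp [Measure.real]

/-- Without outer momenta only the weight is integrated. Performing the amplitude integrals first,
at fixed positions, gives the Gaussian integral of the matrix `A`. -/
theorem sourceState_zero_eq_detFunctional (hC : ∀ j, ‖coupling l (r j)‖ ≤ C) (hL : 0 < L)
    (hsep : ∀ i k, i < k → L ≤ y k - y i) (hb1 : pairBound C L ≤ 1)
    (hbn : n * pairBound C L < 1 / 2) (hbf : n.factorial * pairBound C L ≤ 1 / 2)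
    {f : Fin n → (Fin 4 → ℂ) → ℂ} (hf : ∀ j, f j ∈ testSpace (Fin 4)) (ξ : Fin 0 → R3) :
    sourceState m (fun j => coupling l (r j)) f y 0 ξ =
      detFunctional m l r y (tensorFun f) := by
  have hinteg : Integrable (sourceWeight m (fun j => coupling l (r j)) f y) (sourceMeasures n) :=
    (integrable_testBound_mul_exp hf y (pairBound_nonneg C L) hbn).mono'
      (measurable_sourceWeight m _ hf y).aestronglyMeasurable
      (ae_of_all _ fun w => norm_sourceWeight_le m f hC hL hsep w)
  have hmp := (measurePreserving_arrowProdEquivProdArrow ℝ (Fin 4 → ℝ) (Fin n)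
    (fun _ => stdGauss) (fun _ => (volume : Measure (Fin 4 → ℝ)))).symm
  have hinteg' := (hmp.integrable_comp_emb (MeasurableEquiv.measurableEmbedding _)).2 hinteg
  rw [Function.comp_def] at hinteg'
  have e0 : sourceState m (fun j => coupling l (r j)) f y 0 ξ =
      ∫ w, sourceWeight m (fun j => coupling l (r j)) f y w ∂(sourceMeasures n) := by
    simp [sourceState]
  rw [e0]
  change ∫ w, sourceWeight m (fun j => coupling l (r j)) f y w
    ∂(Measure.pi fun _ : Fin n => stdGauss.prod (volume : Measure (Fin 4 → ℝ))) = _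
  rw [← hmp.integral_comp', integral_prod_symm _ hinteg', detFunctional, volume_pi]
  congr 1
  funext x
  have e1 : ∀ t : Fin n → ℝ,
      (MeasurableEquiv.arrowProdEquivProdArrow ℝ (Fin 4 → ℝ) (Fin n)).symm (t, x) =
        fun j => (t j, x j) := fun t => rfl
  simp only [e1, sourceWeight, interaction_eq_quadForm]
  rw [integral_const_mul, integral_cexp_quadForm_eq_det _ (vevMatrix_isSymm m l r _)
    (pairBound_nonneg C L) hb1 hbn.le hbf (vevMatrix_diag m l r _)
    (norm_vevMatrix_le hC hL hsep x), detIntegrand, mul_comm]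
  rfl

end Determinant

/-- For given couplings, all smallness conditions hold for contours that are sufficiently far
apart. -/
theorem exists_pairBound_lt (n : ℕ) (C : ℝ) :
    ∃ L : ℝ, 0 < L ∧ (n.factorial + n) * pairBound C L < 1 / 4 := by
  set K := C ^ 2 * (fieldConst ^ 2 * shellConst) with hK
  have hK0 : 0 ≤ K := by
    have := shellConst_nonneg
    positivity
  set a : ℝ := n.factorial + n with ha
  have ha0 : 0 ≤ a := by positivity
  -- Since the pair bound is `K / L²`, the claim becomes `4aK < (1 + 4aK)²`.
  refine ⟨1 + 4 * (a * K), by positivity, ?_⟩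
  have e : pairBound C (1 + 4 * (a * K)) = K / (1 + 4 * (a * K)) ^ 2 := by
    rw [pairBound, hK]
    ring
  rw [e, ← mul_div_assoc, div_lt_div_iff₀ (by positivity) (by norm_num)]
  nlinarith [mul_nonneg ha0 hK0, sq_nonneg (a * K)]

end WickField

end

/-! ### The vacuum expectation value as a tempered ultra-hyperfunction -/

open WickField in
theorem proposition3p3 (n : ℕ) (l : ℝ) :
    ∃ L : ℝ, 0 < L ∧
      ∀ (m : ℝ), 0 ≤ m → ∀ r : Fin n → ℤ, (∀ j, r j = 1 ∨ r j = -1) →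
        -- all products `ρ⁽¹⁾(f₁) ⋯ ρ⁽ⁿ⁾(f_n) Φ₀` are well defined
        (∀ f : Fin n → (Fin 4 → ℂ) → ℂ, (∀ j, f j ∈ testSpace (Fin 4)) →
          ∃! Ψ : Fock m,
            IsWickExpSqProduct m (fun j => -(r j : ℂ) * Complex.I * (l : ℂ) ^ 2) f Ψ) ∧
        ∀ y : Fin n → ℝ, (∀ j k, j < k → L < y k - y j) →
          -- `(det A)^{-1/2}` is well defined on the contour and as a generalized function
          (∀ x, ‖(vevMatrix m l r (contour y x)).det - 1‖ < 1) ∧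
          (∀ F ∈ testSpace (Fin n × Fin 4), MeasureTheory.Integrable (detIntegrand m l r y F)) ∧
          IsTemperedUltrahyperfunction (detFunctional m l r y) ∧
          -- the vacuum expectation value
          ∀ f : Fin n → (Fin 4 → ℂ) → ℂ, (∀ j, f j ∈ testSpace (Fin 4)) →
            ∀ Ψ : Fock m,
              IsWickExpSqProduct m (fun j => -(r j : ℂ) * Complex.I * (l : ℂ) ^ 2) f Ψ →
              inner ℂ (vacuum m) Ψ = detFunctional m l r y (tensorFun f) := by
  -- The summand `1` keeps the bound on the couplings positive for `l = 0`, as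
  -- `exists_isWickExpSqProduct` requires; only `n` and `l` enter the choice of `L`.
  set C : ℝ := Real.sqrt 2 * |l| + 1 with hCdef
  have hCpos : 0 < C := by positivity
  obtain ⟨L, hL, hLb⟩ := exists_pairBound_lt n C
  have hb0 := pairBound_nonneg C L
  have hfac : (1 : ℝ) ≤ n.factorial := by exact_mod_cast n.factorial_pos
  have hn0 : 0 ≤ (n : ℝ) * pairBound C L := by positivity
  have hfac0 : pairBound C L ≤ n.factorial * pairBound C L := le_mul_of_one_le_left hb0 hfac
  have hsum : n.factorial * pairBound C L + n * pairBound C L < 1 / 4 := by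
    rwa [← add_mul]
  have hb1 : pairBound C L ≤ 1 := by linarith
  have hbn : n * pairBound C L < 1 / 4 := by linarith
  have hbn' : n * pairBound C L < 1 / 2 := by linarith
  have hbf : n.factorial * pairBound C L ≤ 1 / 2 := by linarith
  refine ⟨L, hL, fun m _ r hr => ?_⟩
  have hC : ∀ j, ‖coupling l (r j)‖ ≤ C := fun j => by
    rw [norm_coupling]
    linarith
  have hg : (fun j => -(r j : ℂ) * Complex.I * (l : ℂ) ^ 2) =
      fun j => coupling l (r j) ^ 2 / 2 :=
    funext fun j => (coupling_sq_div_two l (hr j)).symm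
  rw [hg]
  refine ⟨fun f hf => ?_, fun y hy => ?_⟩
  · obtain ⟨Ψ, hΨ⟩ := exists_isWickExpSqProduct (m := m) hCpos hC hL hbn hf
    exact ⟨Ψ, hΨ, fun Ψ' hΨ' => hΨ'.unique hΨ⟩
  · have hsep : ∀ i k, i < k → L ≤ y k - y i := fun i k h => (hy i k h).le
    refine ⟨fun x => ?_, fun F hF => integrable_detIntegrand hC hL hsep hb1 hbf hF,
      isTemperedUltrahyperfunction_detFunctional hC hL hsep hb1 hbf, fun f hf Ψ hΨ => ?_⟩
    · exact (norm_det_vevMatrix_sub_one_le hC hL hsep hb1 hbf x).trans_lt (by norm_num)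
    · rw [inner_vacuum_eq (component_of_isWickExpSqProduct hC hL hsep hbn' hf hΨ 0) isEmptyElim,
        sourceState_zero_eq_detFunctional hC hL hsep hb1 hbn' hbf hf]
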